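/- Let $n\in\mathbb N$, $s\in(0,1)$, $T>0$. For $E\subset\mathbb R^n$ and $x\in\partial E$ let $$H_s(x,E):=\lim_{\delta\searrow0}\,s(1-s)\int_{\mathbb R^n\setminus B_\delta(x)}\frac{\chi_{\mathbb R^n\setminus E}(y)-\chi_E(y)}{|x-y|^{n+s}}\,dy$$ be the fractional mean curvature. Let $(E_t)_{t\in[0,T]}$ be a family of subsets of $\mathbb R^n$, possibly with unbounded boundaries, that is a classical solution of the fractional mean curvature flow $$\partial_t x\cdot\nu=-H_s(x,E_t)\qquad\text{for } x\in\partial E_t,\ t\in[0,T],$$ where $\nu$ is the outer unit normal of $E_t$. Here "classical" means two things. First, near every point $(x_0,t_0)$ of $\mathbb R^n\times[0,T]$ there is a $C^1$ function $u(x,t)$ such that, for $(x,t)$ near $(x_0,t_0)$ with $t\in[0,T]$, $x\in E_t$ where $u(x,t)<0$ and $x\notin E_t$ where $u(x,t)>0$, and such that $\nabla_xu(x_0,t_0)\neq0$ if $u(x_0,t_0)=0$. Second, through every $x_0\in\partial E_{t_0}$ passes a curve $t\mapsto x(t)\in\partial E_t$, defined for $t\in[0,T]$ near $t_0$ and differentiable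 at $t_0$, with $x(t_0)=x_0$, that satisfies the equation at $t_0$. Assume that 1. the function $(x,t)\mapsto H_s(x,E_t)$ is differentiable on $\{(x,t): t\in[0,T],\ x\in\partial E_t\}$; 2. $\partial E_t$ is uniformly spatially $C^2$ on $[0,T]$: there are $r>0$ and $C$ such that, for every $t\in[0,T]$ and $x\in\partial E_t$, in the cylinder of radius $r$ and half-height $r$ centred at $x$ with axis normal to $\partial E_t$ at $x$, the set $E_t$ is (up to its boundary points) the subgraph of a $C^2$ function $g$ over the tangent hyperplane at $x$, with $g(0)=0$, $\nabla g(0)=0$ and $|D^2g|\le C$; 3. $E_0$ has strictly positive fractional mean curvature, i.e. $H_s(x,E_0)>0$ for every $x\in\partial E_0$. Then $E_t$ has strictly positive fractional mean curvature for every $t\in[0,T]$, i.e. $H_s(x,E_t)$ exists and $H_s(x,E_t)>0$ for every $t\in[0,T]$ and every $x\in\partial E_t$. -/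

import Mathlib

open Set Filter Topology MeasureTheory

noncomputable section

namespace FracFlow

/-- Euclidean space `ℝⁿ`. -/
abbrev Space (n : ℕ) : Type := EuclideanSpace ℝ (Fin n)

/-- The signed indicator: `1` off `E` and `-1` on `E`. -/
def signedIndicator {n : ℕ} (E : Set (Space n)) (y : Space n) : ℝ :=
  Eᶜ.indicator (fun _ => (1 : ℝ)) y - E.indicator (fun _ => (1 : ℝ)) y

/-- The truncated integral `s (1 - s) ∫_{ℝⁿ ∖ B_δ(x)} χ̃_E(y) / |x - y|^{n+s} dy`. -/
def truncatedCurv {n : ℕ} (s : ℝ) (E : Set (Space n)) (x : Space n) (δ : ℝ) : ℝ :=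
  s * (1 - s) * ∫ y in (Metric.ball x δ)ᶜ, signedIndicator E y / ‖x - y‖ ^ ((n : ℝ) + s)

/-- The fractional mean curvature of `E` at `x` exists and equals `h`. -/
def HasFracMeanCurv {n : ℕ} (s : ℝ) (E : Set (Space n)) (x : Space n) (h : ℝ) : Prop :=
  Tendsto (truncatedCurv s E x) (𝓝[>] 0) (𝓝 h)

/-- The fractional mean curvature `H_s(x, E)`, as the limit of the truncated integrals. -/
def fracMeanCurv {n : ℕ} (s : ℝ) (E : Set (Space n)) (x : Space n) : ℝ :=
  limUnder (𝓝[>] 0) (truncatedCurv s E x)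

/-- At every boundary point of `E` the fractional mean curvature exists and is strictly positive. -/
def StrictlyPositiveCurv {n : ℕ} (s : ℝ) (E : Set (Space n)) : Prop :=
  ∀ x ∈ frontier E, ∃ h : ℝ, 0 < h ∧ HasFracMeanCurv s E x h

/-- `ν` is the outer unit normal of `E` at `x`: near `x`, the set `E` contains every cone around
`-ν` of opening less than `π`, and its complement contains every such cone around `ν`. -/
def IsOuterNormal {n : ℕ} (E : Set (Space n)) (x ν : Space n) : Prop :=
  ‖ν‖ = 1 ∧ ∀ η : ℝ, 0 < η → ∀ᶠ y in 𝓝 x,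
    (inner ℝ (y - x) ν < -(η * ‖y - x‖) → y ∈ E) ∧
    (η * ‖y - x‖ < inner ℝ (y - x) ν → y ∉ E)

/-- The track of the moving boundary in space-time, for times in `[0, T]`. -/
def boundaryTrack {n : ℕ} (T : ℝ) (E : ℝ → Set (Space n)) : Set (Space n × ℝ) :=
  {p | p.2 ∈ Icc 0 T ∧ p.1 ∈ frontier (E p.2)}

/-- The sets `E t`, `t ∈ [0, T]`, have boundaries that move in a `C¹` way: near every point of
space-time, `E t` is given by the sign of a `C¹` function `u` of `(x, t)`, negative inside and
positive outside, with nonzero spatial gradient at its zeros (points that lie on no boundary are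
included, with `u ≠ 0` there, so that no piece of boundary can appear, disappear or switch sides
abruptly). -/
def IsC1Family {n : ℕ} (T : ℝ) (E : ℝ → Set (Space n)) : Prop :=
  ∀ t₀ ∈ Icc 0 T, ∀ x₀ : Space n, ∃ u : Space n × ℝ → ℝ,
    ContDiff ℝ 1 u ∧
    (u (x₀, t₀) = 0 → fderiv ℝ (fun x => u (x, t₀)) x₀ ≠ 0) ∧
    ∀ᶠ p in 𝓝[univ ×ˢ Icc 0 T] (x₀, t₀),
      (u p < 0 → p.1 ∈ E p.2) ∧ (0 < u p → p.1 ∉ E p.2)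

/-- `E t`, `t ∈ [0, T]`, is a classical solution of `∂ₜ x · ν = -H_s`: the boundaries move in a
`C¹` way, and through every boundary point passes a trajectory `γ` of boundary points whose velocity
at that point has normal component `-H_s`. (The normal component of the velocity is the same for
all such trajectories.) -/
structure IsFracMeanCurvFlow {n : ℕ} (s T : ℝ) (E : ℝ → Set (Space n)) : Prop where
  isC1Family : IsC1Family T E
  motion : ∀ t₀ ∈ Icc 0 T, ∀ x₀ ∈ frontier (E t₀),
    ∃ (ν : Space n) (γ : ℝ → Space n) (v : Space n),
      IsOuterNormal (E t₀) x₀ ν ∧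
      γ t₀ = x₀ ∧
      (∀ᶠ t in 𝓝[Icc 0 T] t₀, γ t ∈ frontier (E t)) ∧
      HasDerivWithinAt γ v (Icc 0 T) t₀ ∧
      inner ℝ v ν = -fracMeanCurv s (E t₀) x₀

/-- In the cylinder of radius and half-height `r` around `x` with axis `ν`, the set `E` is the
subgraph of a `C²` function `g` over the hyperplane orthogonal to `ν`; the graph is tangent to this
hyperplane at `x`, and the second derivative of `g` is bounded by `C`. -/
def IsC2SubgraphAt {n : ℕ} (r C : ℝ) (E : Set (Space n)) (x ν : Space n) : Prop :=
  ‖ν‖ = 1 ∧ ∃ g : (Submodule.span ℝ {ν})ᗮ → ℝ,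
    ContDiffOn ℝ 2 g (Metric.ball 0 r) ∧ g 0 = 0 ∧ fderiv ℝ g 0 = 0 ∧
    (∀ w ∈ Metric.ball 0 r, ‖iteratedFDeriv ℝ 2 g w‖ ≤ C) ∧
    ∀ w ∈ Metric.ball 0 r, ∀ z ∈ Ioo (-r) r,
      (z < g w → x + (w : Space n) + z • ν ∈ E) ∧
      (g w < z → x + (w : Space n) + z • ν ∉ E)

/-- The boundaries of `E t` are uniformly `C²` in space for `t ∈ [0, T]`: one radius `r` and one
bound `C` serve for all times and all boundary points. -/
def UniformlyC2 {n : ℕ} (T : ℝ) (E : ℝ → Set (Space n)) : Prop :=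
  ∃ r C : ℝ, 0 < r ∧ ∀ t ∈ Icc 0 T, ∀ x ∈ frontier (E t),
    ∃ ν : Space n, IsC2SubgraphAt r C (E t) x ν

end FracFlow

end

noncomputable section

namespace FracFlow

variable {n : ℕ}

/-- Near `x`, the set `A` lies below the paraboloid `⟪z, ν⟫ = K ‖z‖²` and contains what is below
`⟪z, ν⟫ = - K ‖z‖²`. -/
def FlatAt (r K : ℝ) (A : Set (Space n)) (x ν : Space n) : Prop :=
  ‖ν‖ = 1 ∧ ∀ z : Space n, ‖z‖ < r →
    (inner ℝ z ν < -(K * ‖z‖ ^ 2) → x + z ∈ A) ∧ (K * ‖z‖ ^ 2 < inner ℝ z ν → x + z ∉ A)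

theorem abs_le_mul_sq_of_norm_iteratedFDeriv_two_le {V : Type*} [NormedAddCommGroup V]
    [NormedSpace ℝ V] {g : V → ℝ} {r C : ℝ} (hg : ContDiffOn ℝ 2 g (Metric.ball 0 r))
    (h0 : g 0 = 0) (h1 : fderiv ℝ g 0 = 0)
    (h2 : ∀ w ∈ Metric.ball (0 : V) r, ‖iteratedFDeriv ℝ 2 g w‖ ≤ C) {w : V} (hw : ‖w‖ < r) :
    |g w| ≤ C * ‖w‖ ^ 2 := by
  have hr : 0 < r := (norm_nonneg w).trans_lt hw
  have hat : ∀ v ∈ Metric.ball (0 : V) r, ContDiffAt ℝ 2 g v := fun v hv =>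
    hg.contDiffAt (Metric.isOpen_ball.mem_nhds hv)
  have hC : 0 ≤ C := (norm_nonneg _).trans (h2 0 (Metric.mem_ball_self hr))
  have hd : ∀ v ∈ Metric.ball (0 : V) r, ‖fderiv ℝ g v‖ ≤ C * ‖v‖ := by
    intro v hv
    have := (convex_ball (0 : V) r).norm_image_sub_le_of_norm_fderiv_le (𝕜 := ℝ)
      (f := fderiv ℝ g) (C := C) (x := 0) (y := v)
      (fun u hu => ((hat u hu).fderiv_right (m := 1) (by norm_num)).differentiableAt (by simp))
      (fun u hu => by
        rw [← norm_iteratedFDeriv_one, norm_iteratedFDeriv_fderiv]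
        exact h2 u hu) (Metric.mem_ball_self hr) hv
    simpa [h1] using this
  have := (convex_closedBall (0 : V) ‖w‖).norm_image_sub_le_of_norm_fderiv_le (𝕜 := ℝ)
    (f := g) (C := C * ‖w‖) (x := 0) (y := w)
    (fun u hu => (hat u (Metric.closedBall_subset_ball hw hu)).differentiableAt (by simp))
    (fun u hu => (hd u (Metric.closedBall_subset_ball hw hu)).trans
      (by gcongr; simpa using hu)) (by simp) (by simp)
  simpa [h0, pow_two, mul_assoc] using this

theorem IsC2SubgraphAt.flatAt {r C : ℝ} {A : Set (Space n)} {x ν : Space n}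
    (h : IsC2SubgraphAt r C A x ν) : FlatAt r |C| A x ν := by
  obtain ⟨hν, g, hg, h0, h1, h2, h3⟩ := h
  refine ⟨hν, fun z hz => ?_⟩
  set a : ℝ := inner ℝ z ν with ha
  have haz : |a| ≤ ‖z‖ := by
    simpa [hν] using abs_real_inner_le_norm z ν
  have hνν : inner ℝ ν ν = (1 : ℝ) := by rw [real_inner_self_eq_norm_sq, hν]; norm_num
  have hw : z - a • ν ∈ (Submodule.span ℝ {ν})ᗮ := by
    rw [Submodule.mem_orthogonal_singleton_iff_inner_right, inner_sub_right, inner_smul_right,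
      hνν, real_inner_comm, ← ha]
    ring
  set w : (Submodule.span ℝ {ν})ᗮ := ⟨z - a • ν, hw⟩ with hwdef
  have hwz : ‖w‖ ≤ ‖z‖ := by
    have h4 : ‖z - a • ν‖ ^ 2 = ‖z‖ ^ 2 - a ^ 2 := by
      rw [norm_sub_sq_real, inner_smul_right, ← ha, norm_smul, hν, Real.norm_eq_abs, mul_one,
        sq_abs]
      ring
    have : ‖z - a • ν‖ ≤ ‖z‖ := by
      apply le_of_sq_le_sq _ (norm_nonneg z)
      nlinarith [sq_nonneg a]
    simpa [hwdef] using this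
  have hwr : ‖w‖ < r := hwz.trans_lt hz
  have hgw := abs_le_mul_sq_of_norm_iteratedFDeriv_two_le hg h0 h1
    (fun u hu => (h2 u hu).trans (le_abs_self C)) hwr
  have hgw' : |g w| ≤ |C| * ‖z‖ ^ 2 := hgw.trans (by gcongr)
  have har : a ∈ Ioo (-r) r := by
    constructor <;> [have := neg_abs_le a; have := le_abs_self a] <;> linarith
  have hxz : x + (w : Space n) + a • ν = x + z := by simp [hwdef, add_assoc]
  have := h3 w (by simpa using hwr) a har
  rw [hxz] at this
  have h5 := abs_le.1 hgw'
  exact ⟨fun h => this.1 (by linarith), fun h => this.2 (by linarith)⟩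

theorem FlatAt.compl {r K : ℝ} {A : Set (Space n)} {x ν : Space n} (h : FlatAt r K A x ν) :
    FlatAt r K Aᶜ x (-ν) := by
  refine ⟨by simpa using h.1, fun z hz => ⟨fun h1 => ?_, fun h1 => ?_⟩⟩
  · rw [inner_neg_right] at h1
    exact (h.2 z hz).2 (by linarith)
  · rw [inner_neg_right] at h1
    exact not_not.2 ((h.2 z hz).1 (by linarith))

theorem FlatAt.inner_le_of_mem_closure {r K : ℝ} {A : Set (Space n)} {x ν y : Space n}
    (h : FlatAt r K A x ν) (hy : y ∈ closure A) (hr : ‖y - x‖ < r) :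
    inner ℝ (y - x) ν ≤ K * ‖y - x‖ ^ 2 := by
  by_contra! hlt
  have ho : IsOpen {w : Space n | ‖w - x‖ < r ∧ K * ‖w - x‖ ^ 2 < inner ℝ (w - x) ν} := by
    have h1 : IsOpen {w : Space n | ‖w - x‖ < r} := isOpen_lt (by fun_prop) (by fun_prop)
    have h2 : IsOpen {w : Space n | K * ‖w - x‖ ^ 2 < inner ℝ (w - x) ν} :=
      isOpen_lt (by fun_prop) (by fun_prop)
    exact h1.inter h2
  obtain ⟨w, hw, hwA⟩ := mem_closure_iff.1 hy _ ho ⟨hr, hlt⟩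
  have := (h.2 (w - x) hw.1).2 hw.2
  exact this (by simpa using hwA)

theorem FlatAt.le_inner_of_mem_closure_compl {r K : ℝ} {A : Set (Space n)} {x ν y : Space n}
    (h : FlatAt r K A x ν) (hy : y ∈ closure Aᶜ) (hr : ‖y - x‖ < r) :
    -(K * ‖y - x‖ ^ 2) ≤ inner ℝ (y - x) ν := by
  have := h.compl.inner_le_of_mem_closure hy hr
  rw [inner_neg_right] at this
  linarith

theorem FlatAt.isOuterNormal {r K : ℝ} {A : Set (Space n)} {x ν : Space n} (hr : 0 < r)
    (h : FlatAt r K A x ν) : IsOuterNormal A x ν := by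
  refine ⟨h.1, fun η hη => ?_⟩
  have hpos : 0 < min r (η / (|K| + 1)) := lt_min hr (by positivity)
  filter_upwards [Metric.ball_mem_nhds x hpos] with y hy
  rw [Metric.mem_ball, dist_eq_norm, lt_min_iff, lt_div_iff₀ (by positivity)] at hy
  have h1 := h.2 (y - x) hy.1
  have h2 : K * ‖y - x‖ ^ 2 ≤ η * ‖y - x‖ := by
    have : K * ‖y - x‖ ≤ η := by
      nlinarith [le_abs_self K, norm_nonneg (y - x)]
    nlinarith [norm_nonneg (y - x)]
  rw [add_sub_cancel] at h1
  exact ⟨fun h => h1.1 (by linarith), fun h => h1.2 (by linarith)⟩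

/-- The ray from `x` in a direction pointing strictly inwards starts in the interior of `A`. -/
theorem IsOuterNormal.eventually_mem_interior {A : Set (Space n)} {x ν : Space n}
    (h : IsOuterNormal A x ν) {ι : Type*} {l : Filter ι} {ε : ι → ℝ} {d : ι → Space n}
    {d₀ : Space n} (hε : ∀ᶠ i in l, 0 < ε i) (hε0 : Tendsto ε l (𝓝 0)) (hd : Tendsto d l (𝓝 d₀))
    (hd₀ : inner ℝ d₀ ν < 0) : ∀ᶠ i in l, x + ε i • d i ∈ interior A := by
  set η : ℝ := -inner ℝ d₀ ν / (2 * (‖d₀‖ + 1)) with hηdef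
  have hη : 0 < η := div_pos (by linarith) (by positivity)
  have hin := h.2 η hη
  have hlim : Tendsto (fun i => x + ε i • d i) l (𝓝 x) := by
    simpa using tendsto_const_nhds.add (hε0.smul hd)
  have hc : ∀ᶠ i in l, inner ℝ (d i) ν < -(η * ‖d i‖) := by
    have h1 : Tendsto (fun i => inner ℝ (d i) ν) l (𝓝 (inner ℝ d₀ ν)) := hd.inner tendsto_const_nhds
    have h2 : Tendsto (fun i => -(η * ‖d i‖)) l (𝓝 (-(η * ‖d₀‖))) :=
      (hd.norm.const_mul η).neg
    refine h1.eventually_lt h2 ?_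
    have : η * ‖d₀‖ < -inner ℝ d₀ ν := by
      rw [hηdef, div_mul_eq_mul_div, div_lt_iff₀ (by positivity)]
      nlinarith [norm_nonneg d₀]
    linarith
  filter_upwards [hlim.eventually hin.eventually_nhds, hε, hc] with i h1 h2 h3
  rw [mem_interior_iff_mem_nhds]
  have ho : IsOpen {y : Space n | inner ℝ (y - x) ν < -(η * ‖y - x‖)} :=
    isOpen_lt (by fun_prop) (by fun_prop)
  have hmem : x + ε i • d i ∈ {y : Space n | inner ℝ (y - x) ν < -(η * ‖y - x‖)} := by
    simp only [mem_ofPred_eq, add_sub_cancel_left, inner_smul_left, norm_smul, Real.norm_eq_abs,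
      abs_of_pos h2, RCLike.conj_to_real]
    nlinarith
  filter_upwards [h1, ho.mem_nhds hmem] with y hy1 hy2
  exact hy1.1 hy2

theorem IsOuterNormal.compl {A : Set (Space n)} {x ν : Space n} (h : IsOuterNormal A x ν) :
    IsOuterNormal Aᶜ x (-ν) := by
  refine ⟨by simpa using h.1, fun η hη => ?_⟩
  filter_upwards [h.2 η hη] with y hy
  rw [inner_neg_right]
  exact ⟨fun h => hy.2 (by linarith), fun h => not_not.2 (hy.1 (by linarith))⟩

theorem tendsto_id_nhdsGT_zero : Tendsto (fun ε : ℝ => ε) (𝓝[>] 0) (𝓝 0) :=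
  tendsto_id.mono_left nhdsWithin_le_nhds

theorem IsOuterNormal.eventually_ray {A : Set (Space n)} {x ν d : Space n}
    (h : IsOuterNormal A x ν) (hd : inner ℝ d ν < 0) :
    ∀ᶠ ε : ℝ in 𝓝[>] 0, x + ε • d ∈ interior A :=
  h.eventually_mem_interior (d := fun _ => d) eventually_mem_nhdsWithin tendsto_id_nhdsGT_zero
    tendsto_const_nhds hd

theorem IsOuterNormal.eventually_ray_compl {A : Set (Space n)} {x ν d : Space n}
    (h : IsOuterNormal A x ν) (hd : 0 < inner ℝ d ν) :
    ∀ᶠ ε : ℝ in 𝓝[>] 0, x + ε • d ∈ interior Aᶜ :=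
  h.compl.eventually_ray (by rw [inner_neg_right]; linarith)

theorem inner_sub_pos_of_ne {ν ν' : Space n} (h : ‖ν‖ = 1) (h' : ‖ν'‖ = 1) (hne : ν ≠ ν') :
    0 < inner ℝ (ν - ν') ν ∧ inner ℝ (ν - ν') ν' < 0 := by
  have h1 : inner ℝ ν ν' < (1 : ℝ) := (inner_lt_one_iff_real_of_norm_eq_one h h').2 hne
  rw [inner_sub_left, inner_sub_left, real_inner_self_eq_norm_sq, real_inner_self_eq_norm_sq, h, h',
    real_inner_comm]
  constructor <;> linarith

theorem IsOuterNormal.unique {A : Set (Space n)} {x ν ν' : Space n} (h : IsOuterNormal A x ν)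
    (h' : IsOuterNormal A x ν') : ν = ν' := by
  by_contra hne
  obtain ⟨h1, h2⟩ := inner_sub_pos_of_ne h.1 h'.1 hne
  obtain ⟨ε, h3, h4⟩ := ((h.eventually_ray_compl h1).and (h'.eventually_ray h2)).exists
  exact interior_subset h3 (interior_subset h4)

/-- A functional which is nonnegative on a half space is a multiple of its normal. -/
theorem eq_mul_inner_of_nonneg_on_halfspace {ν : Space n} (hν : ‖ν‖ = 1) (l : Space n →L[ℝ] ℝ)
    (h : ∀ d, 0 < inner ℝ d ν → 0 ≤ l d) (d : Space n) : l d = l ν * inner ℝ d ν := by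
  have hνν : inner ℝ ν ν = (1 : ℝ) := by rw [real_inner_self_eq_norm_sq, hν]; norm_num
  set e := d - (inner ℝ d ν : ℝ) • ν with he
  have heν : inner ℝ e ν = (0 : ℝ) := by
    rw [he, inner_sub_left, inner_smul_left, hνν]; simp
  have hle : l e = 0 := by
    by_contra hne
    have := h (ν + (-(l ν + 1) / l e) • e) (by
      rw [inner_add_left, inner_smul_left, heν, hνν]; norm_num)
    rw [map_add, map_smul, smul_eq_mul, div_mul_cancel₀ _ hne] at this
    linarith
  have : l d = l e + l ((inner ℝ d ν : ℝ) • ν) := by rw [← map_add, he, sub_add_cancel]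
  rw [this, hle, map_smul, smul_eq_mul]; ring

theorem volume_slab_le {ν : Space n} (hν : ‖ν‖ = 1) {ρ η : ℝ} (hρ : 0 ≤ ρ) (hη : 0 ≤ η) :
    volume {z : Space n | ‖z‖ ≤ ρ ∧ |inner ℝ z ν| ≤ η}
      ≤ ENNReal.ofReal (2 * η * (2 * ρ) ^ (n - 1)) := by
  have hn : 0 < n := by
    rcases Nat.eq_zero_or_pos n with rfl | h
    · rw [Subsingleton.elim ν 0] at hν; simp at hν
    · exact h
  let i₀ : Fin n := ⟨0, hn⟩
  obtain ⟨b, hb⟩ := Orthonormal.exists_orthonormalBasis_extension_of_card_eq (𝕜 := ℝ)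
    (E := Space n) (ι := Fin n) (by simp) (v := fun _ => ν) (s := {i₀}) (by
      constructor
      · intro i; simpa using hν
      · intro i j hij; exact absurd (Subsingleton.elim i j) hij)
  have hb0 : b i₀ = ν := hb i₀ rfl
  let f : Fin n → ℝ := fun i => if i = i₀ then η else ρ
  have hsub : {z : Space n | ‖z‖ ≤ ρ ∧ |inner ℝ z ν| ≤ η} ⊆
      b.repr ⁻¹' ((MeasurableEquiv.toLp 2 (Fin n → ℝ)).symm ⁻¹' (Icc (-f) f)) := by
    rintro z ⟨hz1, hz2⟩
    have key : ∀ i, |b.repr z i| ≤ f i := by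
      intro i
      rw [b.repr_apply_apply]
      by_cases hi : i = i₀
      · simp only [f, hi, if_true, hb0]
        rwa [real_inner_comm]
      · simp only [f, hi, if_false]
        have := abs_real_inner_le_norm (b i) z
        rw [b.norm_eq_one, one_mul] at this
        exact this.trans hz1
    exact ⟨fun i => (abs_le.1 (key i)).1, fun i => (abs_le.1 (key i)).2⟩
  refine (measure_mono hsub).trans ?_
  rw [b.measurePreserving_repr.measure_preimage
      (((MeasurableEquiv.toLp 2 (Fin n → ℝ)).symm.measurable measurableSet_Icc).nullMeasurableSet),
    (EuclideanSpace.volume_preserving_symm_measurableEquiv_toLp (Fin n)).measure_preimage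
      measurableSet_Icc.nullMeasurableSet, Real.volume_Icc_pi,
    ← ENNReal.ofReal_prod_of_nonneg]
  · apply ENNReal.ofReal_le_ofReal
    rw [Fintype.prod_eq_mul_prod_compl i₀]
    have : ∀ i ∈ ({i₀}ᶜ : Finset (Fin n)), f i - (-f) i = 2 * ρ := by
      intro i hi
      have hi' : i ≠ i₀ := by simpa using hi
      simp only [f, Pi.neg_apply, hi', if_false]; ring
    rw [Finset.prod_congr rfl this, Finset.prod_const, Finset.card_compl]
    simp only [f, Pi.neg_apply, if_true, Fintype.card_fin, Finset.card_singleton]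
    apply le_of_eq; ring
  · intro i _
    have : 0 ≤ f i := by simp only [f]; split_ifs <;> assumption
    simp only [Pi.neg_apply]; linarith

theorem lintegral_rpow_neg_le_of_volume_le {S : Set (Space n)} (hS : MeasurableSet S) {c p q : ℝ}
    (hc : 0 ≤ c) (hq : 0 < q) (hqp : q < p)
    (h : ∀ ρ : ℝ, 0 < ρ → ρ ≤ 1 → volume (S ∩ Metric.ball 0 ρ) ≤ ENNReal.ofReal (c * ρ ^ p)) :
    ∫⁻ z in S ∩ Metric.ball 0 1, ENNReal.ofReal (‖z‖ ^ (-q))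
      ≤ ENNReal.ofReal (c * 2 ^ q * (1 - 2 ^ (q - p))⁻¹) := by
  let U : ℕ → Set (Space n) := fun k =>
    (S ∩ Metric.ball 0 ((2 : ℝ)⁻¹ ^ k)) \ Metric.ball 0 ((2 : ℝ)⁻¹ ^ (k + 1))
  have hUm : ∀ k, MeasurableSet (U k) := fun k =>
    (hS.inter measurableSet_ball).diff measurableSet_ball
  have hcover : S ∩ Metric.ball 0 1 ⊆ {0} ∪ ⋃ k, U k := by
    rintro z ⟨hzS, hz1⟩
    rw [mem_ball_zero_iff] at hz1
    by_cases hz : z = 0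
    · exact Or.inl hz
    right
    obtain ⟨k, hk1, hk2⟩ := exists_nat_pow_near_of_lt_one (norm_pos_iff.2 hz) hz1.le
      (by norm_num : (0 : ℝ) < 2⁻¹) (by norm_num)
    refine mem_iUnion.2 ?_
    rcases eq_or_lt_of_le hk2 with heq | hlt
    · rcases k with _ | k
      · simp at heq; exact absurd heq hz1.ne
      · refine ⟨k, ⟨hzS, ?_⟩, ?_⟩
        · rw [mem_ball_zero_iff, heq, pow_succ]
          have : (0 : ℝ) < 2⁻¹ ^ k := by positivity
          linarith
        · rw [mem_ball_zero_iff, heq]; exact lt_irrefl _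
    · exact ⟨k, ⟨hzS, by rwa [mem_ball_zero_iff]⟩, by rw [mem_ball_zero_iff]; exact hk1.not_gt⟩
  have hUbound : ∀ k, ∫⁻ z in U k, ENNReal.ofReal (‖z‖ ^ (-q))
      ≤ ENNReal.ofReal (c * 2 ^ q * (2 ^ (q - p)) ^ k) := by
    intro k
    calc ∫⁻ z in U k, ENNReal.ofReal (‖z‖ ^ (-q))
        ≤ ∫⁻ z in U k, ENNReal.ofReal (((2 : ℝ)⁻¹ ^ (k + 1)) ^ (-q)) := by
          apply setLIntegral_mono' (hUm k)
          intro z hz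
          apply ENNReal.ofReal_le_ofReal
          have h1 : (2 : ℝ)⁻¹ ^ (k + 1) ≤ ‖z‖ := by
            have := hz.2
            rw [mem_ball_zero_iff] at this
            exact not_lt.1 this
          exact Real.rpow_le_rpow_of_nonpos (by positivity) h1 (by linarith)
      _ = ENNReal.ofReal (((2 : ℝ)⁻¹ ^ (k + 1)) ^ (-q)) * volume (U k) := setLIntegral_const _ _
      _ ≤ ENNReal.ofReal (((2 : ℝ)⁻¹ ^ (k + 1)) ^ (-q)) *
            ENNReal.ofReal (c * ((2 : ℝ)⁻¹ ^ k) ^ p) := by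
          gcongr
          exact (measure_mono sdiff_subset).trans
            (h _ (by positivity) (pow_le_one₀ (by norm_num) (by norm_num)))
      _ = ENNReal.ofReal (c * 2 ^ q * (2 ^ (q - p)) ^ k) := by
          rw [← ENNReal.ofReal_mul (by positivity)]
          congr 1
          have e1 : ((2 : ℝ)⁻¹ ^ (k + 1)) ^ (-q) = 2 ^ q * (2 ^ q) ^ k := by
            rw [inv_pow, Real.inv_rpow (by positivity), Real.rpow_neg (by positivity), inv_inv,
              ← Real.rpow_natCast, ← Real.rpow_mul (by norm_num), ← Real.rpow_natCast,
              ← Real.rpow_mul (by norm_num), ← Real.rpow_add (by norm_num)]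
            congr 1; push_cast; ring
          have e2 : ((2 : ℝ)⁻¹ ^ k) ^ p = (2 ^ (-p)) ^ k := by
            rw [inv_pow, Real.inv_rpow (by positivity), ← Real.rpow_natCast,
              ← Real.rpow_mul (by norm_num), ← Real.rpow_natCast, ← Real.rpow_mul (by norm_num),
              ← Real.rpow_neg (by norm_num)]
            congr 1; ring
          rw [e1, e2, show q - p = q + -p by ring, Real.rpow_add (by norm_num), mul_pow]; ring
  have hr1 : (2 : ℝ) ^ (q - p) < 1 := Real.rpow_lt_one_of_one_lt_of_neg (by norm_num) (by linarith)
  have hr0 : (0 : ℝ) ≤ 2 ^ (q - p) := by positivity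
  calc ∫⁻ z in S ∩ Metric.ball 0 1, ENNReal.ofReal (‖z‖ ^ (-q))
      ≤ ∫⁻ z in {0} ∪ ⋃ k, U k, ENNReal.ofReal (‖z‖ ^ (-q)) := lintegral_mono_set hcover
    _ ≤ (∫⁻ z in {(0 : Space n)}, ENNReal.ofReal (‖z‖ ^ (-q))) +
          ∫⁻ z in ⋃ k, U k, ENNReal.ofReal (‖z‖ ^ (-q)) :=
        lintegral_union_le _ _ _
    _ ≤ 0 + ∑' k, ∫⁻ z in U k, ENNReal.ofReal (‖z‖ ^ (-q)) := by
        refine add_le_add ?_ ?_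
        · rw [lintegral_singleton, norm_zero, Real.zero_rpow (by linarith)]; simp
        · exact lintegral_iUnion_le _ _
    _ ≤ ∑' k, ENNReal.ofReal (c * 2 ^ q * (2 ^ (q - p)) ^ k) := by
        rw [zero_add]; exact ENNReal.tsum_le_tsum hUbound
    _ = ENNReal.ofReal (c * 2 ^ q * (1 - 2 ^ (q - p))⁻¹) := by
        rw [← ENNReal.ofReal_tsum_of_nonneg (fun k => by positivity)
          ((summable_geometric_of_lt_one hr0 hr1).mul_left _), tsum_mul_left,
          tsum_geometric_of_lt_one hr0 hr1]

theorem integrableOn_rpow_neg_of_volume_le {S : Set (Space n)} (hS : MeasurableSet S) {c p q : ℝ}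
    (hc : 0 ≤ c) (hq : 0 < q) (hqp : q < p)
    (h : ∀ ρ : ℝ, 0 < ρ → ρ ≤ 1 → volume (S ∩ Metric.ball 0 ρ) ≤ ENNReal.ofReal (c * ρ ^ p)) :
    IntegrableOn (fun z : Space n => ‖z‖ ^ (-q)) (S ∩ Metric.ball 0 1) ∧
      ∫ z in S ∩ Metric.ball 0 1, ‖z‖ ^ (-q) ≤ c * 2 ^ q * (1 - 2 ^ (q - p))⁻¹ := by
  have h1 := lintegral_rpow_neg_le_of_volume_le hS hc hq hqp h
  have hm : Measurable fun z : Space n => ‖z‖ ^ (-q) := by fun_prop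
  have hr1 : (2 : ℝ) ^ (q - p) < 1 := Real.rpow_lt_one_of_one_lt_of_neg (by norm_num) (by linarith)
  have h0 : 0 ≤ c * 2 ^ q * (1 - 2 ^ (q - p))⁻¹ := by
    have : 0 ≤ (1 - (2 : ℝ) ^ (q - p))⁻¹ := inv_nonneg.2 (by linarith)
    positivity
  refine ⟨⟨hm.aestronglyMeasurable, ?_⟩, ?_⟩
  · rw [hasFiniteIntegral_iff_ofReal (ae_of_all _ fun z => by positivity)]
    exact h1.trans_lt ENNReal.ofReal_lt_top
  · rw [integral_eq_lintegral_of_nonneg_ae (ae_of_all _ fun z => by positivity)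
      hm.aestronglyMeasurable]
    exact ENNReal.toReal_le_of_le_ofReal h0 h1

theorem integrableOn_rpow_neg_compl_ball {q δ : ℝ} (hq : (n : ℝ) < q) (hδ : 0 < δ) :
    IntegrableOn (fun z : Space n => ‖z‖ ^ (-q)) (Metric.ball 0 δ)ᶜ := by
  have h1 : Integrable (fun z : Space n => (1 + δ⁻¹) ^ q * (1 + ‖z‖) ^ (-q)) :=
    (integrable_one_add_norm (by simpa using hq)).const_mul _
  have hm : Measurable fun z : Space n => ‖z‖ ^ (-q) := by fun_prop
  have hq0 : 0 ≤ q := (Nat.cast_nonneg n).trans hq.le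
  refine h1.integrableOn.mono' hm.aestronglyMeasurable ?_
  refine ae_restrict_of_forall_mem measurableSet_ball.compl fun z hz => ?_
  have hz' : δ ≤ ‖z‖ := by
    rw [mem_compl_iff, mem_ball_zero_iff, not_lt] at hz; exact hz
  have hz0 : 0 < ‖z‖ := hδ.trans_le hz'
  rw [Real.norm_of_nonneg (by positivity), Real.rpow_neg hz0.le, Real.rpow_neg (by positivity),
    ← div_eq_mul_inv, ← one_div, div_le_div_iff₀ (by positivity) (by positivity), one_mul,
    ← Real.mul_rpow (by positivity) hz0.le]
  apply Real.rpow_le_rpow (by positivity) _ hq0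
  have : 1 ≤ δ⁻¹ * ‖z‖ := by
    rw [inv_mul_eq_div, le_div_iff₀ hδ]; linarith
  linarith

theorem volume_frontier_eq_zero {r K : ℝ} {A : Set (Space n)} (hr : 0 < r) (hK : 0 ≤ K)
    (h : ∀ x ∈ frontier A, ∃ ν, FlatAt r K A x ν) : volume (frontier A) = 0 := by
  rw [← Measure.restrict_eq_zero, ← ae_eq_bot, ← Filter.eventually_false_iff_eq_bot]
  filter_upwards [Besicovitch.ae_tendsto_measure_inter_div volume (frontier A),
    ae_restrict_mem isClosed_frontier.measurableSet] with x hx hxF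
  obtain ⟨ν, hν⟩ := h x hxF
  have hn : 0 < n := by
    rcases Nat.eq_zero_or_pos n with rfl | h
    · have := hν.1
      rw [Subsingleton.elim ν 0] at this; simp at this
    · exact h
  have hv : volume (Metric.ball (0 : Space n) 1) ≠ 0 := (Metric.measure_ball_pos _ _ one_pos).ne'
  have hv' : volume (Metric.ball (0 : Space n) 1) ≠ ⊤ := measure_ball_lt_top.ne
  set v := volume (Metric.ball (0 : Space n) 1) with hvdef
  have hle : ∀ᶠ ρ : ℝ in 𝓝[>] 0,
      volume (frontier A ∩ Metric.closedBall x ρ) / volume (Metric.closedBall x ρ) ≤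
        ENNReal.ofReal (2 * K * 2 ^ (n - 1) * ρ) / v := by
    filter_upwards [Ioo_mem_nhdsGT hr] with ρ hρ
    have hsub : frontier A ∩ Metric.closedBall x ρ ⊆
        (fun y => y - x) ⁻¹' {z : Space n | ‖z‖ ≤ ρ ∧ |inner ℝ z ν| ≤ K * ρ ^ 2} := by
      rintro y ⟨hyF, hy⟩
      rw [Metric.mem_closedBall, dist_eq_norm] at hy
      rw [frontier_eq_closure_inter_closure] at hyF
      have h1 := hν.inner_le_of_mem_closure hyF.1 (hy.trans_lt hρ.2)
      have h2 := hν.le_inner_of_mem_closure_compl hyF.2 (hy.trans_lt hρ.2)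
      have h3 : K * ‖y - x‖ ^ 2 ≤ K * ρ ^ 2 := by gcongr
      exact ⟨hy, abs_le.2 ⟨by linarith, by linarith⟩⟩
    have h4 : volume (frontier A ∩ Metric.closedBall x ρ) ≤
        ENNReal.ofReal (2 * (K * ρ ^ 2) * (2 * ρ) ^ (n - 1)) := by
      refine (measure_mono hsub).trans ?_
      simp only [sub_eq_add_neg]
      rw [measure_preimage_add_right]
      exact volume_slab_le hν.1 hρ.1.le (by have := hρ.1; positivity)
    have hρ0 : 0 < ρ := hρ.1
    rw [Measure.addHaar_closedBall _ _ hρ0.le, finrank_euclideanSpace_fin]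
    have h5 : 2 * (K * ρ ^ 2) * (2 * ρ) ^ (n - 1) = (2 * K * 2 ^ (n - 1) * ρ) * ρ ^ n := by
      obtain ⟨m, rfl⟩ : ∃ m, n = m + 1 := ⟨n - 1, by omega⟩
      simp only [Nat.add_sub_cancel]
      rw [mul_pow]; ring
    rw [h5, ENNReal.ofReal_mul (by positivity), mul_comm] at h4
    refine (ENNReal.div_le_div_right h4 _).trans ?_
    rw [ENNReal.mul_div_mul_left _ _ (by simp; positivity) (by simp)]
  have hlim : Tendsto (fun ρ : ℝ => ENNReal.ofReal (2 * K * 2 ^ (n - 1) * ρ) / v) (𝓝[>] 0)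
      (𝓝 0) := by
    have : Tendsto (fun ρ : ℝ => ENNReal.ofReal (2 * K * 2 ^ (n - 1) * ρ) / v) (𝓝[>] 0)
        (𝓝 (ENNReal.ofReal (2 * K * 2 ^ (n - 1) * 0) / v)) := by
      apply ENNReal.Tendsto.div_const _ (Or.inr hv)
      exact ENNReal.tendsto_ofReal (tendsto_id_nhdsGT_zero.const_mul _)
    simpa using this
  exact absurd (le_of_tendsto_of_tendsto hx hlim hle) (by simp)

theorem nullMeasurableSet_of_volume_frontier {A : Set (Space n)} (h : volume (frontier A) = 0) :
    NullMeasurableSet A := by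
  refine ⟨interior A, isOpen_interior.measurableSet, ?_⟩
  have : closure A =ᵐ[volume] interior A := by
    rw [← closure_sdiff_interior] at h
    exact (ae_le_set.2 h).antisymm (interior_subset.trans subset_closure).eventuallyLE
  exact (subset_closure.eventuallyLE.trans this.le).antisymm interior_subset.eventuallyLE

theorem signedIndicator_of_mem {A : Set (Space n)} {y : Space n} (h : y ∈ A) :
    signedIndicator A y = -1 := by
  simp [signedIndicator, h]

theorem signedIndicator_of_notMem {A : Set (Space n)} {y : Space n} (h : y ∉ A) :
    signedIndicator A y = 1 := by
  simp [signedIndicator, h]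

theorem abs_signedIndicator (A : Set (Space n)) (y : Space n) : |signedIndicator A y| = 1 := by
  by_cases h : y ∈ A
  · simp [signedIndicator_of_mem h]
  · simp [signedIndicator_of_notMem h]

theorem aestronglyMeasurable_signedIndicator {A : Set (Space n)} (hA : NullMeasurableSet A) :
    AEStronglyMeasurable (signedIndicator A) volume :=
  (aestronglyMeasurable_const.indicator₀ hA.compl).sub (aestronglyMeasurable_const.indicator₀ hA)

theorem aestronglyMeasurable_signedIndicator_add {A : Set (Space n)} (hA : NullMeasurableSet A)
    (x : Space n) : AEStronglyMeasurable (fun z => signedIndicator A (x + z)) volume :=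
  (aestronglyMeasurable_signedIndicator hA).comp_quasiMeasurePreserving
    (quasiMeasurePreserving_add_left volume x)

theorem aestronglyMeasurable_signedIndicator_sub {A : Set (Space n)} (hA : NullMeasurableSet A)
    (x : Space n) : AEStronglyMeasurable (fun z => signedIndicator A (x - z)) volume :=
  (aestronglyMeasurable_signedIndicator hA).comp_quasiMeasurePreserving
    (quasiMeasurePreserving_sub_left volume x)

theorem FlatAt.pos_dim {r K : ℝ} {A : Set (Space n)} {x ν : Space n} (h : FlatAt r K A x ν) :
    0 < n := by
  rcases Nat.eq_zero_or_pos n with rfl | hn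
  · have := h.1
    rw [Subsingleton.elim ν 0] at this; simp at this
  · exact hn

/-- The sum of the signed indicator at the two points `x + z` and `x - z`. -/
def symIndicator (A : Set (Space n)) (x z : Space n) : ℝ :=
  signedIndicator A (x + z) + signedIndicator A (x - z)

theorem abs_symIndicator_le (A : Set (Space n)) (x z : Space n) : |symIndicator A x z| ≤ 2 := by
  refine (abs_add_le _ _).trans ?_
  rw [abs_signedIndicator, abs_signedIndicator]; norm_num

theorem FlatAt.symIndicator_eq_zero {r K : ℝ} {A : Set (Space n)} {x ν z : Space n}
    (h : FlatAt r K A x ν) (hz : ‖z‖ < r) (hK : K * ‖z‖ ^ 2 < |inner ℝ z ν|) :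
    symIndicator A x z = 0 := by
  have h1 := h.2 z hz
  have h2 := h.2 (-z) (by rwa [norm_neg])
  rw [norm_neg, inner_neg_left, ← sub_eq_add_neg] at h2
  rcases lt_abs.1 hK with h3 | h3
  · rw [symIndicator, signedIndicator_of_notMem (h1.2 h3),
      signedIndicator_of_mem (h2.1 (by linarith))]; norm_num
  · rw [symIndicator, signedIndicator_of_mem (h1.1 (by linarith)),
      signedIndicator_of_notMem (h2.2 h3)]; norm_num

theorem aestronglyMeasurable_symIndicator {A : Set (Space n)} (hA : NullMeasurableSet A)
    (x : Space n) : AEStronglyMeasurable (symIndicator A x) volume :=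
  (aestronglyMeasurable_signedIndicator_add hA x).add (aestronglyMeasurable_signedIndicator_sub hA x)

/-- The symmetrized singular integral converges absolutely, with a uniform bound. -/
theorem exists_integral_abs_symIndicator_le (n : ℕ) {s : ℝ} (hs : s ∈ Ioo (0 : ℝ) 1) {r K : ℝ}
    (hr : 0 < r) (hK : 0 ≤ K) : ∃ C : ℝ, 0 ≤ C ∧ ∀ (A : Set (Space n)) (x ν : Space n),
      FlatAt r K A x ν → NullMeasurableSet A →
      Integrable (fun z => symIndicator A x z * ‖z‖ ^ (-((n : ℝ) + s))) ∧
      ∫ z, |symIndicator A x z| * ‖z‖ ^ (-((n : ℝ) + s)) ≤ C := by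
  set q : ℝ := (n : ℝ) + s with hq
  set r₀ := min r 1 with hr₀
  have hr₀pos : 0 < r₀ := lt_min hr one_pos
  have hqn : (n : ℝ) < q := by have := hs.1; linarith
  have hq0 : 0 < q := lt_of_le_of_lt (Nat.cast_nonneg n) hqn
  set c : ℝ := 2 * K * 2 ^ (n - 1) with hc
  have hfar := integrableOn_rpow_neg_compl_ball hqn hr₀pos
  set D := c * 2 ^ q * (1 - 2 ^ (q - ((n : ℝ) + 1)))⁻¹ with hD
  have hm : Measurable fun z : Space n => ‖z‖ ^ (-q) := by fun_prop
  refine ⟨max 0 (2 * D + 2 * ∫ z in (Metric.ball (0 : Space n) r₀)ᶜ, ‖z‖ ^ (-q)),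
    le_max_left _ _, fun A x ν h hA => ?_⟩
  have hn := h.pos_dim
  set S : Set (Space n) := {z | |inner ℝ z ν| ≤ K * ‖z‖ ^ 2} with hS
  have hSm : MeasurableSet S :=
    (isClosed_le (by fun_prop) (by fun_prop)).measurableSet
  have hnear := integrableOn_rpow_neg_of_volume_le (S := S) hSm (c := c) (p := (n : ℝ) + 1)
    (q := q) (by positivity) hq0 (by have := hs.2; linarith) (by
      intro ρ hρ _
      have hsub : S ∩ Metric.ball 0 ρ ⊆ {z : Space n | ‖z‖ ≤ ρ ∧ |inner ℝ z ν| ≤ K * ρ ^ 2} := by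
        rintro z ⟨hz1, hz2⟩
        rw [mem_ball_zero_iff] at hz2
        exact ⟨hz2.le, (show |inner ℝ z ν| ≤ K * ‖z‖ ^ 2 from hz1).trans (by gcongr)⟩
      refine (measure_mono hsub).trans ((volume_slab_le h.1 hρ.le (by positivity)).trans ?_)
      apply ENNReal.ofReal_le_ofReal
      apply le_of_eq
      obtain ⟨m, rfl⟩ : ∃ m, n = m + 1 := ⟨n - 1, by omega⟩
      rw [hc, show ((m + 1 : ℕ) : ℝ) + 1 = ((m + 2 : ℕ) : ℝ) by push_cast; ring,
        Real.rpow_natCast]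
      simp only [Nat.add_sub_cancel]
      rw [mul_pow]; ring)
  set W : Space n → ℝ := fun z => 2 * (S ∩ Metric.ball 0 1).indicator (fun z => ‖z‖ ^ (-q)) z +
    2 * (Metric.ball (0 : Space n) r₀)ᶜ.indicator (fun z => ‖z‖ ^ (-q)) z with hW
  have hWi : Integrable W :=
    (((integrable_indicator_iff (hSm.inter measurableSet_ball)).2 hnear.1).const_mul 2).add
      (((integrable_indicator_iff measurableSet_ball.compl).2 hfar).const_mul 2)
  have hbound : ∀ z, |symIndicator A x z| * ‖z‖ ^ (-q) ≤ W z := by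
    intro z
    have hp : 0 ≤ ‖z‖ ^ (-q) := by positivity
    have hi1 : 0 ≤ (S ∩ Metric.ball 0 1).indicator (fun z : Space n => ‖z‖ ^ (-q)) z :=
      indicator_nonneg (fun z _ => by positivity) z
    have hi2 : 0 ≤ (Metric.ball (0 : Space n) r₀)ᶜ.indicator (fun z : Space n => ‖z‖ ^ (-q)) z :=
      indicator_nonneg (fun z _ => by positivity) z
    have h2 : |symIndicator A x z| * ‖z‖ ^ (-q) ≤ 2 * ‖z‖ ^ (-q) := by
      gcongr; exact abs_symIndicator_le A x z
    by_cases hz : ‖z‖ < r₀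
    · by_cases hzS : z ∈ S
      · have : z ∈ S ∩ Metric.ball 0 1 := ⟨hzS, by
          rw [mem_ball_zero_iff]; exact hz.trans_le (min_le_right _ _)⟩
        rw [indicator_of_mem this] at hi1
        simp only [hW]
        rw [indicator_of_mem this]
        linarith
      · have : K * ‖z‖ ^ 2 < |inner ℝ z ν| := not_le.1 hzS
        rw [h.symIndicator_eq_zero (hz.trans_le (min_le_left _ _)) this]
        simp only [hW]
        rw [abs_zero, zero_mul]; linarith
    · have : z ∈ (Metric.ball (0 : Space n) r₀)ᶜ := by
        rw [mem_compl_iff, mem_ball_zero_iff]; exact hz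
      simp only [hW]
      rw [indicator_of_mem this]
      linarith
  have hint : Integrable (fun z => symIndicator A x z * ‖z‖ ^ (-q)) := by
    refine hWi.mono' ((aestronglyMeasurable_symIndicator hA x).mul hm.aestronglyMeasurable)
      (ae_of_all _ fun z => ?_)
    rw [norm_mul, Real.norm_eq_abs, Real.norm_of_nonneg (by positivity : 0 ≤ ‖z‖ ^ (-q))]
    exact hbound z
  refine ⟨hint, ?_⟩
  have habs : Integrable (fun z => |symIndicator A x z| * ‖z‖ ^ (-q)) := by
    refine hint.norm.congr (ae_of_all _ fun z => ?_)
    simp only [norm_mul, Real.norm_eq_abs, abs_of_nonneg (by positivity : 0 ≤ ‖z‖ ^ (-q))]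
  refine (integral_mono habs hWi hbound).trans (le_trans ?_ (le_max_right _ _))
  simp only [hW]
  rw [integral_add (((integrable_indicator_iff (hSm.inter measurableSet_ball)).2
      hnear.1).const_mul 2) (((integrable_indicator_iff measurableSet_ball.compl).2 hfar).const_mul 2),
    integral_const_mul, integral_const_mul, integral_indicator (hSm.inter measurableSet_ball),
    integral_indicator measurableSet_ball.compl]
  linarith [hnear.2]

theorem integral_signedIndicator_mul_even {A : Set (Space n)} {x : Space n} {m : Space n → ℝ}
    (hm : ∀ z, m (-z) = m z) (hi : Integrable fun z => signedIndicator A (x + z) * m z) :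
    ∫ z, signedIndicator A (x + z) * m z = 2⁻¹ * ∫ z, symIndicator A x z * m z := by
  have hi' : Integrable fun z => signedIndicator A (x - z) * m z := by
    refine hi.comp_neg.congr (ae_of_all _ fun z => ?_)
    simp only [hm, ← sub_eq_add_neg]
  have h1 : ∫ z, signedIndicator A (x - z) * m z = ∫ z, signedIndicator A (x + z) * m z := by
    rw [← integral_neg_eq_self]
    simp only [hm, sub_neg_eq_add]
  have h2 : ∫ z, symIndicator A x z * m z =
      (∫ z, signedIndicator A (x + z) * m z) + ∫ z, signedIndicator A (x - z) * m z := by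
    rw [← integral_add hi hi']
    simp only [symIndicator, add_mul]
  rw [h2, h1]; ring

/-- The regularized kernel `(‖z‖² + δ²)^{-(n+s)/2}`. -/
def regKernel (n : ℕ) (s δ : ℝ) (z : Space n) : ℝ := (‖z‖ ^ 2 + δ ^ 2) ^ (-(((n : ℝ) + s) / 2))

theorem regKernel_neg (s δ : ℝ) (z : Space n) : regKernel n s δ (-z) = regKernel n s δ z := by
  simp [regKernel]

theorem regKernel_nonneg (s δ : ℝ) (z : Space n) : 0 ≤ regKernel n s δ z := by
  unfold regKernel; positivity

theorem continuous_regKernel (s : ℝ) {δ : ℝ} (hδ : 0 < δ) : Continuous (regKernel n s δ) := by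
  unfold regKernel
  refine Continuous.rpow_const (by fun_prop) fun z => Or.inl ?_
  positivity

theorem integrable_regKernel {s δ : ℝ} (hs : 0 < s) (hδ : 0 < δ) : Integrable (regKernel n s δ) := by
  have h1 : Integrable (fun z : Space n => (1 + ‖z‖ ^ 2) ^ (-((n : ℝ) + s) / 2)) :=
    integrable_rpow_neg_one_add_norm_sq (by simpa using hs)
  have h2 := ((h1.comp_smul (R := δ⁻¹) (by positivity)).const_mul ((δ ^ 2) ^ (-(((n : ℝ) + s) / 2))))
  refine h2.congr (ae_of_all _ fun z => ?_)
  simp only [regKernel]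
  rw [norm_smul, mul_pow, norm_inv, Real.norm_of_nonneg hδ.le, neg_div,
    ← Real.mul_rpow (by positivity) (by positivity)]
  congr 1
  field_simp
  ring

theorem regKernel_le {s δ : ℝ} (hs : 0 < s) {z : Space n} (hz : z ≠ 0) :
    regKernel n s δ z ≤ ‖z‖ ^ (-((n : ℝ) + s)) := by
  have hz0 : 0 < ‖z‖ := norm_pos_iff.2 hz
  have : ‖z‖ ^ (-((n : ℝ) + s)) = (‖z‖ ^ 2) ^ (-(((n : ℝ) + s) / 2)) := by
    rw [← Real.rpow_natCast ‖z‖ 2, ← Real.rpow_mul hz0.le]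
    congr 1; push_cast; ring
  rw [this, regKernel]
  apply Real.rpow_le_rpow_of_nonpos (by positivity) (by nlinarith [sq_nonneg δ])
  have : (0 : ℝ) ≤ n := Nat.cast_nonneg n
  linarith

theorem tendsto_regKernel (s : ℝ) {z : Space n} (hz : z ≠ 0) :
    Tendsto (fun δ => regKernel n s δ z) (𝓝[>] 0) (𝓝 (‖z‖ ^ (-((n : ℝ) + s)))) := by
  have hz0 : 0 < ‖z‖ := norm_pos_iff.2 hz
  have : ‖z‖ ^ (-((n : ℝ) + s)) = (‖z‖ ^ 2 + 0 ^ 2) ^ (-(((n : ℝ) + s) / 2)) := by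
    rw [← Real.rpow_natCast ‖z‖ 2, zero_pow two_ne_zero, add_zero, ← Real.rpow_mul hz0.le]
    congr 1; push_cast; ring
  rw [this]
  simp only [regKernel]
  refine Tendsto.rpow_const ?_ (Or.inl (by positivity))
  exact tendsto_const_nhds.add (tendsto_id_nhdsGT_zero.pow 2)

theorem ae_ne_zero (hn : 0 < n) : ∀ᵐ z : Space n, z ≠ 0 := by
  have : Nonempty (Fin n) := ⟨⟨0, hn⟩⟩
  have : Nontrivial (Space n) := inferInstance
  exact Measure.ae_ne volume 0

section Limits

variable {s r K : ℝ} {A : Set (Space n)} {x ν : Space n}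

/-- The absolutely convergent form of `∫ χ̃_A(y) / |x - y|^{n+s} dy`. -/
def symCurv (s : ℝ) (A : Set (Space n)) (x : Space n) : ℝ :=
  2⁻¹ * ∫ z, symIndicator A x z * ‖z‖ ^ (-((n : ℝ) + s))

theorem tendsto_regularized (hs : s ∈ Ioo (0 : ℝ) 1) (hr : 0 < r) (hK : 0 ≤ K)
    (h : FlatAt r K A x ν) (hA : NullMeasurableSet A) :
    Tendsto (fun δ => ∫ z, signedIndicator A (x + z) * regKernel n s δ z) (𝓝[>] 0)
      (𝓝 (symCurv s A x)) := by
  obtain ⟨C, -, hC⟩ := exists_integral_abs_symIndicator_le n hs hr hK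
  have hi := (hC A x ν h hA).1
  have hreg : ∀ δ : ℝ, 0 < δ → Integrable fun z => signedIndicator A (x + z) * regKernel n s δ z := by
    intro δ hδ
    refine (integrable_regKernel hs.1 hδ).bdd_mul (c := 1)
      (aestronglyMeasurable_signedIndicator_add hA x) (ae_of_all _ fun z => ?_)
    rw [Real.norm_eq_abs, abs_signedIndicator]
  have heq : (fun δ => 2⁻¹ * ∫ z, symIndicator A x z * regKernel n s δ z) =ᶠ[𝓝[>] 0]
      fun δ => ∫ z, signedIndicator A (x + z) * regKernel n s δ z := by
    filter_upwards [self_mem_nhdsWithin] with δ hδ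
    exact (integral_signedIndicator_mul_even (regKernel_neg s δ) (hreg δ hδ)).symm
  refine Tendsto.congr' heq (Tendsto.const_mul _ ?_)
  refine tendsto_integral_filter_of_dominated_convergence
    (fun z => ‖symIndicator A x z * ‖z‖ ^ (-((n : ℝ) + s))‖) ?_ ?_ hi.norm ?_
  · filter_upwards [self_mem_nhdsWithin] with δ hδ
    exact (aestronglyMeasurable_symIndicator hA x).mul
      (continuous_regKernel s hδ).aestronglyMeasurable
  · filter_upwards with δ
    filter_upwards [ae_ne_zero h.pos_dim] with z hz
    rw [norm_mul, norm_mul]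
    gcongr
    rw [Real.norm_of_nonneg (regKernel_nonneg _ _ _), Real.norm_of_nonneg (by positivity)]
    exact regKernel_le hs.1 hz
  · filter_upwards [ae_ne_zero h.pos_dim] with z hz
    exact (tendsto_regKernel s hz).const_mul _

theorem hasFracMeanCurv_symCurv (hs : s ∈ Ioo (0 : ℝ) 1) (hr : 0 < r) (hK : 0 ≤ K)
    (h : FlatAt r K A x ν) (hA : NullMeasurableSet A) :
    HasFracMeanCurv s A x (s * (1 - s) * symCurv s A x) := by
  obtain ⟨C, -, hC⟩ := exists_integral_abs_symIndicator_le n hs hr hK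
  have hi := (hC A x ν h hA).1
  set q : ℝ := (n : ℝ) + s with hq
  have hqn : (n : ℝ) < q := by have := hs.1; linarith
  have hmeas : Measurable fun z : Space n => ‖z‖ ^ (-q) := by fun_prop
  let m : ℝ → Space n → ℝ := fun δ => (Metric.ball (0 : Space n) δ)ᶜ.indicator fun z => ‖z‖ ^ (-q)
  have hmeven : ∀ δ z, m δ (-z) = m δ z := by
    intro δ z
    simp only [m, indicator, mem_compl_iff, mem_ball_zero_iff, norm_neg]
  have htr : ∀ δ : ℝ, truncatedCurv s A x δ =
      s * (1 - s) * ∫ z, signedIndicator A (x + z) * m δ z := by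
    intro δ
    rw [truncatedCurv, ← integral_indicator measurableSet_ball.compl,
      ← integral_add_left_eq_self _ x]
    congr 2
    ext z
    by_cases hz : ‖z‖ < δ
    · simp [m, indicator, hz]
    · have e : ‖z‖ ^ (-q) = (‖z‖ ^ ((n : ℝ) + s))⁻¹ := Real.rpow_neg (norm_nonneg z) _
      simp [m, indicator, hz, e, div_eq_mul_inv]
  have hmi : ∀ δ : ℝ, 0 < δ → Integrable (m δ) := fun δ hδ =>
    (integrable_indicator_iff measurableSet_ball.compl).2 (integrableOn_rpow_neg_compl_ball hqn hδ)
  have heq : (fun δ => s * (1 - s) * (2⁻¹ * ∫ z, symIndicator A x z * m δ z)) =ᶠ[𝓝[>] 0]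
      truncatedCurv s A x := by
    filter_upwards [self_mem_nhdsWithin] with δ hδ
    rw [htr, integral_signedIndicator_mul_even (hmeven δ)]
    refine (hmi δ hδ).bdd_mul (c := 1)
      (aestronglyMeasurable_signedIndicator_add hA x) (ae_of_all _ fun z => ?_)
    rw [Real.norm_eq_abs, abs_signedIndicator]
  refine Tendsto.congr' heq (Tendsto.const_mul _ (Tendsto.const_mul _ ?_))
  refine tendsto_integral_filter_of_dominated_convergence
    (fun z => ‖symIndicator A x z * ‖z‖ ^ (-q)‖) ?_ ?_ hi.norm ?_
  · filter_upwards with δ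
    exact (aestronglyMeasurable_symIndicator hA x).mul
      (hmeas.aestronglyMeasurable.indicator measurableSet_ball.compl)
  · filter_upwards with δ
    filter_upwards with z
    rw [norm_mul, norm_mul]
    gcongr
    exact norm_indicator_le_norm_self _ _
  · filter_upwards [ae_ne_zero h.pos_dim] with z hz
    refine Tendsto.const_mul _ (tendsto_const_nhds.congr' ?_)
    filter_upwards [Ioo_mem_nhdsGT (norm_pos_iff.2 hz)] with δ hδ
    simp only [m]
    rw [indicator_of_mem]
    rw [mem_compl_iff, mem_ball_zero_iff, not_lt]
    exact hδ.2.le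

theorem fracMeanCurv_eq (hs : s ∈ Ioo (0 : ℝ) 1) (hr : 0 < r) (hK : 0 ≤ K)
    (h : FlatAt r K A x ν) (hA : NullMeasurableSet A) :
    fracMeanCurv s A x = s * (1 - s) * symCurv s A x :=
  (hasFracMeanCurv_symCurv hs hr hK h hA).limUnder_eq

end Limits

theorem exists_abs_fracMeanCurv_le (n : ℕ) {s : ℝ} (hs : s ∈ Ioo (0 : ℝ) 1) {r K : ℝ}
    (hr : 0 < r) (hK : 0 ≤ K) : ∃ C : ℝ, 0 ≤ C ∧ ∀ (A : Set (Space n)) (x ν : Space n),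
      FlatAt r K A x ν → NullMeasurableSet A → |fracMeanCurv s A x| ≤ C := by
  obtain ⟨C, hC0, hC⟩ := exists_integral_abs_symIndicator_le n hs hr hK
  refine ⟨C, hC0, fun A x ν h hA => ?_⟩
  obtain ⟨-, h2⟩ := hC A x ν h hA
  have h1s : 0 ≤ 1 - s := by linarith [hs.2]
  have hs0 : 0 ≤ s := hs.1.le
  have h3 : |∫ z, symIndicator A x z * ‖z‖ ^ (-((n : ℝ) + s))| ≤ C := by
    refine (abs_integral_le_integral_abs).trans (le_trans (le_of_eq ?_) h2)
    congr 1
    ext z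
    rw [abs_mul, abs_of_nonneg (by positivity : 0 ≤ ‖z‖ ^ (-((n : ℝ) + s)))]
  rw [fracMeanCurv_eq hs hr hK h hA, symCurv, abs_mul, abs_mul (2⁻¹ : ℝ),
    abs_of_nonneg (by positivity : 0 ≤ s * (1 - s)),
    abs_of_nonneg (by norm_num : (0 : ℝ) ≤ 2⁻¹)]
  have h4 : s * (1 - s) ≤ 1 := by nlinarith
  have h5 : 0 ≤ s * (1 - s) := by positivity
  have h6 := abs_nonneg (∫ z, symIndicator A x z * ‖z‖ ^ (-((n : ℝ) + s)))
  nlinarith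

theorem exists_abs_det_sub_le (n : ℕ) : ∃ C : ℝ, 0 ≤ C ∧ ∀ B B' : Space n →L[ℝ] Space n,
    ‖B‖ ≤ 2 → ‖B'‖ ≤ 2 → |B.det - B'.det| ≤ C * ‖B - B'‖ := by
  let b := (EuclideanSpace.basisFun (Fin n) ℝ).toBasis
  let φ : (Space n →L[ℝ] Space n) →ₗ[ℝ] Matrix (Fin n) (Fin n) ℝ :=
    (LinearMap.toMatrix b b).toLinearMap ∘ₗ (ContinuousLinearMap.coeLM ℝ)
  have hdet : ∀ B : Space n →L[ℝ] Space n, B.det =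
      ∑ σ : Equiv.Perm (Fin n), (Equiv.Perm.sign σ : ℝ) * ∏ i, φ B (σ i) i := by
    intro B
    have h1 : B.det = (φ B).det := (LinearMap.det_toMatrix b (B : Space n →ₗ[ℝ] Space n)).symm
    rw [h1, Matrix.det_apply']
  have hentry : ∀ i j, ContDiff ℝ 1 fun B => φ B i j := by
    intro i j
    let l : (Space n →L[ℝ] Space n) →ₗ[ℝ] ℝ := (Matrix.entryLinearMap ℝ ℝ i j) ∘ₗ φ
    exact (LinearMap.toContinuousLinearMap l).contDiff
  have hsmooth : ContDiff ℝ 1 fun B : Space n →L[ℝ] Space n => B.det := by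
    have : (fun B : Space n →L[ℝ] Space n => B.det) = fun B =>
        ∑ σ : Equiv.Perm (Fin n), (Equiv.Perm.sign σ : ℝ) * ∏ i, φ B (σ i) i := funext hdet
    rw [this]
    exact ContDiff.sum fun σ _ => contDiff_const.mul (contDiff_prod fun i _ => hentry _ _)
  have : LocallyLipschitz fun B : Space n →L[ℝ] Space n => B.det := hsmooth.locallyLipschitz
  have hon : LocallyLipschitzOn (Metric.closedBall 0 2)
      fun B : Space n →L[ℝ] Space n => B.det := this.locallyLipschitzOn
  obtain ⟨L, hL⟩ := hon.exists_lipschitzOnWith_of_compact (isCompact_closedBall _ _)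
  refine ⟨L, L.2, fun B B' hB hB' => ?_⟩
  have := hL.dist_le_mul B (by simpa using hB) B' (by simpa using hB')
  rwa [Real.dist_eq, dist_eq_norm] at this

theorem abs_rpow_neg_sub_le {p m a b : ℝ} (hp : 0 ≤ p) (hm : 0 < m) (ha : m ≤ a) (hb : m ≤ b) :
    |a ^ (-p) - b ^ (-p)| ≤ p * m ^ (-p - 1) * |a - b| := by
  have := (convex_Ici m).norm_image_sub_le_of_norm_hasDerivWithin_le (f := fun t : ℝ => t ^ (-p))
    (f' := fun t => -p * t ^ (-p - 1)) (C := p * m ^ (-p - 1)) (x := b) (y := a)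
    (fun t ht => (Real.hasDerivAt_rpow_const (Or.inl (hm.trans_le ht).ne')).hasDerivWithinAt)
    (fun t ht => by
      rw [norm_mul, norm_neg, Real.norm_of_nonneg hp,
        Real.norm_of_nonneg (Real.rpow_nonneg (hm.le.trans ht) _)]
      have ht' : m ≤ t := ht
      exact mul_le_mul_of_nonneg_left (Real.rpow_le_rpow_of_nonpos hm ht' (by linarith)) hp) hb ha
  simpa using this

theorem sq_rpow_neg_half {x q : ℝ} (hx : 0 ≤ x) : (x ^ 2) ^ (-(q / 2)) = x ^ (-q) := by
  rw [← Real.rpow_natCast x 2, ← Real.rpow_mul hx]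
  congr 1; push_cast; ring

theorem regKernel_le_of_half_le {s δ : ℝ} (hs : 0 < s) {z u : Space n} (hz : z ≠ 0)
    (hu : ‖z‖ / 2 ≤ ‖u‖) :
    regKernel n s δ u ≤ 2 ^ ((n : ℝ) + s) * ‖z‖ ^ (-((n : ℝ) + s)) := by
  have hz0 : 0 < ‖z‖ := norm_pos_iff.2 hz
  have hn : (0 : ℝ) ≤ n := Nat.cast_nonneg n
  have hu0 : u ≠ 0 := norm_pos_iff.1 (by linarith)
  calc regKernel n s δ u ≤ ‖u‖ ^ (-((n : ℝ) + s)) := regKernel_le hs hu0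
    _ ≤ (‖z‖ / 2) ^ (-((n : ℝ) + s)) :=
        Real.rpow_le_rpow_of_nonpos (by positivity) hu (by linarith)
    _ = 2 ^ ((n : ℝ) + s) * ‖z‖ ^ (-((n : ℝ) + s)) := by
        rw [Real.div_rpow hz0.le (by norm_num), Real.rpow_neg (by norm_num : (0 : ℝ) ≤ 2),
          div_inv_eq_mul, mul_comm]

theorem abs_regKernel_sub_le {s δ : ℝ} (hs : 0 < s) {z u v : Space n} (hz : z ≠ 0)
    (hu : ‖z‖ / 2 ≤ ‖u‖) (hv : ‖z‖ / 2 ≤ ‖v‖) :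
    |regKernel n s δ u - regKernel n s δ v| ≤
      2 * ((n : ℝ) + s) * 2 ^ ((n : ℝ) + s) * ‖z‖ ^ (-((n : ℝ) + s)) *
        (|‖u‖ ^ 2 - ‖v‖ ^ 2| / ‖z‖ ^ 2) := by
  have hz0 : 0 < ‖z‖ := norm_pos_iff.2 hz
  have hn : (0 : ℝ) ≤ n := Nat.cast_nonneg n
  have hm : 0 < (‖z‖ / 2) ^ 2 := by positivity
  have key := abs_rpow_neg_sub_le (p := ((n : ℝ) + s) / 2) (a := ‖u‖ ^ 2 + δ ^ 2)
    (b := ‖v‖ ^ 2 + δ ^ 2) (by linarith) hm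
    (by have := pow_le_pow_left₀ (by positivity) hu 2; nlinarith [sq_nonneg δ])
    (by have := pow_le_pow_left₀ (by positivity) hv 2; nlinarith [sq_nonneg δ])
  refine key.trans (le_of_eq ?_)
  rw [Real.rpow_sub_one hm.ne', sq_rpow_neg_half (by positivity),
    Real.div_rpow hz0.le (by norm_num), Real.rpow_neg (by norm_num : (0 : ℝ) ≤ 2), div_inv_eq_mul,
    add_sub_add_right_eq_sub]
  field_simp

/-- A vector field which is small, together with its derivative, as seen from `y₀`. -/
structure SmallField (s N : ℝ) (Y : Space n → Space n) (y₀ : Space n) : Prop where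
  diff : Differentiable ℝ Y
  half : ∀ y, ‖fderiv ℝ Y y‖ ≤ 1 / 2
  lip : ∀ y y', ‖y - y₀‖ ≤ 1 → ‖y' - y₀‖ ≤ 1 →
    ‖fderiv ℝ Y y - fderiv ℝ Y y'‖ ≤ N * ‖y - y'‖
  growth : ∀ z, ‖fderiv ℝ Y (y₀ + z)‖ ≤ N * (1 + ‖z‖ ^ (s / 2))
  sub : ∀ z, ‖Y (y₀ + z) - Y y₀‖ ≤ N * ‖z‖

theorem norm_sub_le_half {Y : Space n → Space n} (hd : Differentiable ℝ Y)
    (hh : ∀ y, ‖fderiv ℝ Y y‖ ≤ 1 / 2) (y y' : Space n) : ‖Y y - Y y'‖ ≤ 1 / 2 * ‖y - y'‖ :=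
  convex_univ.norm_image_sub_le_of_norm_fderiv_le (𝕜 := ℝ) (fun x _ => hd x) (fun x _ => hh x)
    (mem_univ _) (mem_univ _)

/-- The identity plus a field with derivative at most `1 / 2` is a homeomorphism. -/
theorem exists_homeomorph_id_add {Y : Space n → Space n} (hd : Differentiable ℝ Y)
    (hh : ∀ y, ‖fderiv ℝ Y y‖ ≤ 1 / 2) : ∃ Θ : Space n ≃ₜ Space n, ∀ y, Θ y = y + Y y := by
  have happ : ApproximatesLinearOn (fun y => y + Y y)
      ((ContinuousLinearEquiv.refl ℝ (Space n) : Space n ≃L[ℝ] Space n) :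
        Space n →L[ℝ] Space n) univ (1 / 2) := by
    intro x _ y _
    have := norm_sub_le_half hd hh x y
    simp only [ContinuousLinearEquiv.coe_refl, ContinuousLinearMap.coe_id', id]
    rw [show x + Y x - (y + Y y) - (x - y) = Y x - Y y by abel]
    simpa using this
  have hc : Subsingleton (Space n) ∨ (1 / 2 : NNReal) <
      ‖((ContinuousLinearEquiv.refl ℝ (Space n)).symm : Space n →L[ℝ] Space n)‖₊⁻¹ := by
    rcases subsingleton_or_nontrivial (Space n) with h | h
    · exact Or.inl h
    · right
      have : ‖((ContinuousLinearEquiv.refl ℝ (Space n)).symm : Space n →L[ℝ] Space n)‖₊ = 1 := by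
        simp
      rw [this, inv_one]
      exact NNReal.coe_lt_coe.1 (by norm_num)
  exact ⟨happ.toHomeomorph _ hc, fun y => rfl⟩

namespace SmallField

variable {s N : ℝ} {Y : Space n → Space n} {y₀ : Space n}

theorem nonneg (h : SmallField s N Y y₀) : 0 ≤ N := by
  have h1 := (norm_nonneg _).trans (h.growth 0)
  have h2 : 0 ≤ ‖(0 : Space n)‖ ^ (s / 2) := by positivity
  by_contra! h3
  nlinarith

theorem sub_linear (h : SmallField s N Y y₀) {z : Space n} (hz : ‖z‖ ≤ 1) :
    ‖Y (y₀ + z) - Y y₀ - fderiv ℝ Y y₀ z‖ ≤ N * ‖z‖ * ‖z‖ := by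
  have := (convex_closedBall y₀ ‖z‖).norm_image_sub_le_of_norm_hasFDerivWithin_le' (𝕜 := ℝ)
    (f := Y) (f' := fderiv ℝ Y) (φ := fderiv ℝ Y y₀) (C := N * ‖z‖) (x := y₀) (y := y₀ + z)
    (fun x _ => (h.diff x).hasFDerivAt.hasFDerivWithinAt)
    (fun x hx => by
      have := h.nonneg
      rw [Metric.mem_closedBall, dist_eq_norm] at hx
      exact (h.lip x y₀ (hx.trans hz) (by simp)).trans (by gcongr)) (by simp) (by simp)
  simpa using this

/-- The displacement `Θ(y₀ + z) - Θ(y₀)` of `Θ = id + Y`. -/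
def disp (Y : Space n → Space n) (y₀ z : Space n) : Space n := z + (Y (y₀ + z) - Y y₀)

theorem norm_disp_sub (h : SmallField s N Y y₀) (z : Space n) : ‖disp Y y₀ z - z‖ ≤ N * ‖z‖ := by
  rw [disp, add_sub_cancel_left]; exact h.sub z

theorem norm_disp_sub_half (h : SmallField s N Y y₀) (z : Space n) :
    ‖disp Y y₀ z - z‖ ≤ ‖z‖ / 2 := by
  have := norm_sub_le_half h.diff h.half (y₀ + z) y₀
  rw [disp, add_sub_cancel_left]
  rw [add_sub_cancel_left] at this
  linarith

theorem half_le_norm_disp (h : SmallField s N Y y₀) (z : Space n) : ‖z‖ / 2 ≤ ‖disp Y y₀ z‖ := by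
  have h1 := h.norm_disp_sub_half z
  have h2 := norm_sub_norm_le z (disp Y y₀ z)
  rw [norm_sub_rev] at h2
  linarith

theorem norm_disp_le (h : SmallField s N Y y₀) (z : Space n) : ‖disp Y y₀ z‖ ≤ 3 / 2 * ‖z‖ := by
  have h1 := h.norm_disp_sub_half z
  have h2 := norm_sub_norm_le (disp Y y₀ z) z
  linarith

theorem norm_disp_add_disp_neg (h : SmallField s N Y y₀) {z : Space n} (hz : ‖z‖ ≤ 1) :
    ‖disp Y y₀ z + disp Y y₀ (-z)‖ ≤ 2 * N * ‖z‖ ^ 2 := by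
  have h1 := h.sub_linear hz
  have h2 := h.sub_linear (z := -z) (by rwa [norm_neg])
  have : disp Y y₀ z + disp Y y₀ (-z) = (Y (y₀ + z) - Y y₀ - fderiv ℝ Y y₀ z) +
      (Y (y₀ + -z) - Y y₀ - fderiv ℝ Y y₀ (-z)) := by
    rw [disp, disp, map_neg]; abel
  rw [this]
  refine (norm_add_le _ _).trans ?_
  rw [norm_neg] at h2
  linarith

end SmallField

/-- The Jacobian of `id + Y`. -/
def jac (Y : Space n → Space n) (y : Space n) : ℝ :=
  |(ContinuousLinearMap.id ℝ (Space n) + fderiv ℝ Y y).det|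

theorem exists_jac_bounds (n : ℕ) : ∃ C : ℝ, 0 ≤ C ∧ ∀ Y : Space n → Space n,
    (∀ y, ‖fderiv ℝ Y y‖ ≤ 1 / 2) → (∀ y, |jac Y y - 1| ≤ C * ‖fderiv ℝ Y y‖) ∧
      ∀ y y', |jac Y y - jac Y y'| ≤ C * ‖fderiv ℝ Y y - fderiv ℝ Y y'‖ := by
  obtain ⟨C, hC0, hC⟩ := exists_abs_det_sub_le n
  have hid : ‖ContinuousLinearMap.id ℝ (Space n)‖ ≤ 1 := ContinuousLinearMap.norm_id_le
  refine ⟨C, hC0, fun Y hY => ?_⟩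
  have hb : ∀ y, ‖ContinuousLinearMap.id ℝ (Space n) + fderiv ℝ Y y‖ ≤ 2 := fun y =>
    (norm_add_le _ _).trans (by linarith [hY y])
  constructor
  · intro y
    have h1 := hC _ (ContinuousLinearMap.id ℝ (Space n)) (hb y) (by linarith)
    rw [add_sub_cancel_left] at h1
    have h2 : (ContinuousLinearMap.id ℝ (Space n)).det = 1 := LinearMap.det_id
    rw [h2] at h1
    have h3 := abs_abs_sub_abs_le (ContinuousLinearMap.id ℝ (Space n) + fderiv ℝ Y y).det 1
    rw [abs_one] at h3
    exact h3.trans h1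
  · intro y y'
    have h1 := hC _ _ (hb y) (hb y')
    rw [add_sub_add_left_eq_sub] at h1
    exact (abs_abs_sub_abs_le _ _).trans h1

/-- The difference between the kernel transported by `id + Y` and the kernel itself. -/
def kernelDiff (s δ : ℝ) (Y : Space n → Space n) (y₀ z : Space n) : ℝ :=
  jac Y (y₀ + z) * regKernel n s δ (SmallField.disp Y y₀ z) - regKernel n s δ z

theorem exists_kernelDiff_bounds (n : ℕ) {s : ℝ} (hs : s ∈ Ioo (0 : ℝ) 1) :
    ∃ C : ℝ, 0 ≤ C ∧ ∀ (N δ : ℝ) (Y : Space n → Space n) (y₀ : Space n), SmallField s N Y y₀ →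
      ∀ z ≠ 0, |kernelDiff s δ Y y₀ z| ≤
          C * N * (1 + ‖z‖ ^ (s / 2)) * ‖z‖ ^ (-((n : ℝ) + s)) ∧
        (‖z‖ ≤ 1 → |kernelDiff s δ Y y₀ (-z) - kernelDiff s δ Y y₀ z| ≤
          C * N * ‖z‖ * ‖z‖ ^ (-((n : ℝ) + s))) := by
  obtain ⟨D, hD0, hD⟩ := exists_jac_bounds n
  set Q : ℝ := (n : ℝ) + s with hQ
  have hQ0 : 0 < Q := by have := hs.1; have : (0 : ℝ) ≤ n := Nat.cast_nonneg n; linarith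
  have h2Q : (0 : ℝ) < 2 ^ Q := by positivity
  set P := 2 * Q * 2 ^ Q with hP
  have hP0 : 0 < P := by positivity
  refine ⟨2 * D * 2 ^ Q + 3 * P + 6 * (1 + D) * P, by positivity, ?_⟩
  intro N δ Y y₀ h z hz
  have hN := h.nonneg
  obtain ⟨hJ1, hJ2⟩ := hD Y h.half
  have hz0 : 0 < ‖z‖ := norm_pos_iff.2 hz
  have hz' : -z ≠ 0 := neg_ne_zero.2 hz
  set k : ℝ := ‖z‖ ^ (-Q) with hk
  have hk0 : 0 < k := by positivity
  set u := SmallField.disp Y y₀ z with hu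
  set v := SmallField.disp Y y₀ (-z) with hv
  have hu1 := h.half_le_norm_disp z
  have hv1 := h.half_le_norm_disp (-z)
  have hu2 := h.norm_disp_le z
  have hv2 := h.norm_disp_le (-z)
  rw [norm_neg] at hv1 hv2
  rw [← hu] at hu1 hu2
  rw [← hv] at hv1 hv2
  have hJz : |jac Y (y₀ + z)| ≤ 1 + D := by
    have h1 := hJ1 (y₀ + z)
    have h2 := h.half (y₀ + z)
    have h3 := abs_sub_abs_le_abs_sub (jac Y (y₀ + z)) 1
    rw [abs_one] at h3
    nlinarith
  constructor
  · have e1 : kernelDiff s δ Y y₀ z = (jac Y (y₀ + z) - 1) * regKernel n s δ u +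
        (regKernel n s δ u - regKernel n s δ z) := by
      rw [kernelDiff, ← hu]; ring
    have b1 : |(jac Y (y₀ + z) - 1) * regKernel n s δ u| ≤
        D * (N * (1 + ‖z‖ ^ (s / 2))) * (2 ^ Q * k) := by
      rw [abs_mul, abs_of_nonneg (regKernel_nonneg s δ u)]
      gcongr
      · exact regKernel_nonneg s δ u
      · exact (hJ1 _).trans (by gcongr; exact h.growth z)
      · exact regKernel_le_of_half_le hs.1 hz hu1
    have b2 : |regKernel n s δ u - regKernel n s δ z| ≤ P * k * (3 * N) := by
      refine (abs_regKernel_sub_le hs.1 hz hu1 (by linarith)).trans ?_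
      have h4 : |‖u‖ ^ 2 - ‖z‖ ^ 2| / ‖z‖ ^ 2 ≤ 3 * N := by
        rw [div_le_iff₀ (by positivity), sq_sub_sq, abs_mul, abs_of_nonneg (by positivity)]
        have h5 : |‖u‖ - ‖z‖| ≤ N * ‖z‖ := (abs_norm_sub_norm_le u z).trans (h.norm_disp_sub z)
        calc (‖u‖ + ‖z‖) * |‖u‖ - ‖z‖| ≤ (3 * ‖z‖) * (N * ‖z‖) := by
              gcongr; linarith
          _ = 3 * N * ‖z‖ ^ 2 := by ring
      gcongr
    rw [e1]
    refine (abs_add_le _ _).trans ((add_le_add b1 b2).trans ?_)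
    have h6 : 0 ≤ ‖z‖ ^ (s / 2) := by positivity
    have h7 : P * k * (3 * N) ≤ P * k * (3 * N) * (1 + ‖z‖ ^ (s / 2)) :=
      le_mul_of_one_le_right (by positivity) (by linarith)
    have h8 : 0 ≤ (D * 2 ^ Q + 6 * (1 + D) * P) * N * (1 + ‖z‖ ^ (s / 2)) * k := by positivity
    nlinarith
  · intro hz1
    have e1 : kernelDiff s δ Y y₀ (-z) - kernelDiff s δ Y y₀ z =
        (jac Y (y₀ + -z) - jac Y (y₀ + z)) * regKernel n s δ v +
          jac Y (y₀ + z) * (regKernel n s δ v - regKernel n s δ u) := by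
      rw [kernelDiff, kernelDiff, regKernel_neg, ← hu, ← hv]; ring
    have b1 : |(jac Y (y₀ + -z) - jac Y (y₀ + z)) * regKernel n s δ v| ≤
        D * (N * (2 * ‖z‖)) * (2 ^ Q * k) := by
      rw [abs_mul, abs_of_nonneg (regKernel_nonneg s δ v)]
      gcongr
      · exact regKernel_nonneg s δ v
      · refine (hJ2 _ _).trans ?_
        gcongr
        refine (h.lip _ _ (by simpa using hz1) (by simpa using hz1)).trans ?_
        rw [show y₀ + -z - (y₀ + z) = (-2 : ℝ) • z by rw [neg_smul, two_smul]; abel, norm_smul]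
        norm_num
      · exact regKernel_le_of_half_le hs.1 hz hv1
    have b2 : |jac Y (y₀ + z) * (regKernel n s δ v - regKernel n s δ u)| ≤
        (1 + D) * (P * k * (6 * N * ‖z‖)) := by
      rw [abs_mul]
      gcongr
      refine (abs_regKernel_sub_le hs.1 hz hv1 hu1).trans ?_
      have h4 : |‖v‖ ^ 2 - ‖u‖ ^ 2| / ‖z‖ ^ 2 ≤ 6 * N * ‖z‖ := by
        rw [div_le_iff₀ (by positivity), sq_sub_sq, abs_mul, abs_of_nonneg (by positivity)]
        have h5 : |‖v‖ - ‖u‖| ≤ 2 * N * ‖z‖ ^ 2 := by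
          have := abs_norm_sub_norm_le v (-u)
          rw [norm_neg, sub_neg_eq_add, add_comm] at this
          exact this.trans (h.norm_disp_add_disp_neg hz1)
        calc (‖v‖ + ‖u‖) * |‖v‖ - ‖u‖| ≤ (3 * ‖z‖) * (2 * N * ‖z‖ ^ 2) := by
              gcongr; linarith
          _ = 6 * N * ‖z‖ * ‖z‖ ^ 2 := by ring
      gcongr
    rw [e1]
    refine (abs_add_le _ _).trans ((add_le_add b1 b2).trans ?_)
    have h8 : 0 ≤ 3 * P * N * ‖z‖ * k := by positivity
    nlinarith

theorem integrableOn_rpow_neg_ball {q : ℝ} (hq : 0 < q) (hqn : q < n) :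
    IntegrableOn (fun z : Space n => ‖z‖ ^ (-q)) (Metric.ball 0 1) := by
  have h := (integrableOn_rpow_neg_of_volume_le (S := (univ : Set (Space n))) MeasurableSet.univ
    (c := (volume (Metric.ball (0 : Space n) 1)).toReal) (p := n) ENNReal.toReal_nonneg hq hqn
    (by
      intro ρ hρ _
      rw [univ_inter, Measure.addHaar_ball_of_pos _ _ hρ, finrank_euclideanSpace_fin,
        ENNReal.ofReal_mul ENNReal.toReal_nonneg, ENNReal.ofReal_toReal measure_ball_lt_top.ne,
        Real.rpow_natCast, mul_comm])).1
  rwa [univ_inter] at h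

theorem hasFDerivAt_id_add {Y : Space n → Space n} (hd : Differentiable ℝ Y) (y : Space n) :
    HasFDerivAt (fun y => y + Y y) (ContinuousLinearMap.id ℝ (Space n) + fderiv ℝ Y y) y :=
  (hasFDerivAt_id y).add (hd y).hasFDerivAt

section ChangeOfVariables

variable {Y : Space n → Space n}

theorem bijective_id_add (hd : Differentiable ℝ Y) (hh : ∀ y, ‖fderiv ℝ Y y‖ ≤ 1 / 2) :
    Function.Bijective fun y => y + Y y := by
  obtain ⟨Θ, hΘ⟩ := exists_homeomorph_id_add hd hh
  have : (fun y => y + Y y) = Θ := funext fun y => (hΘ y).symm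
  rw [this]
  exact Θ.bijective

theorem integral_comp_id_add (hd : Differentiable ℝ Y) (hh : ∀ y, ‖fderiv ℝ Y y‖ ≤ 1 / 2)
    (f : Space n → ℝ) : ∫ x, f x = ∫ y, jac Y y * f (y + Y y) := by
  have := integral_image_eq_integral_abs_det_fderiv_smul volume MeasurableSet.univ
    (fun y _ => (hasFDerivAt_id_add hd y).hasFDerivWithinAt)
    (bijective_id_add hd hh).injective.injOn f
  rw [image_univ, (bijective_id_add hd hh).surjective.range_eq, setIntegral_univ, setIntegral_univ] at this
  exact this

theorem integrable_comp_id_add_iff (hd : Differentiable ℝ Y) (hh : ∀ y, ‖fderiv ℝ Y y‖ ≤ 1 / 2)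
    (f : Space n → ℝ) : Integrable f ↔ Integrable fun y => jac Y y * f (y + Y y) := by
  have := integrableOn_image_iff_integrableOn_abs_det_fderiv_smul volume MeasurableSet.univ
    (fun y _ => (hasFDerivAt_id_add hd y).hasFDerivWithinAt)
    (bijective_id_add hd hh).injective.injOn f
  rw [image_univ, (bijective_id_add hd hh).surjective.range_eq, integrableOn_univ, integrableOn_univ] at this
  exact this

end ChangeOfVariables

theorem integrable_jac_mul_regKernel {s N δ : ℝ} (hs : 0 < s) (hδ : 0 < δ)
    {Y : Space n → Space n} {y₀ : Space n} (h : SmallField s N Y y₀) :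
    Integrable fun z => jac Y (y₀ + z) * regKernel n s δ (SmallField.disp Y y₀ z) := by
  have h1 : Integrable fun x => regKernel n s δ (x - (y₀ + Y y₀)) :=
    (integrable_regKernel hs hδ).comp_sub_right _
  have h2 := ((integrable_comp_id_add_iff h.diff h.half _).1 h1).comp_add_left y₀
  refine h2.congr (ae_of_all _ fun z => ?_)
  simp only [SmallField.disp]
  congr 2
  abel

/-- Transporting the kernel by `id + Y` changes the integral by at most a multiple of the size
of `Y`. -/
theorem exists_abs_integral_kernelDiff_le (n : ℕ) {s : ℝ} (hs : s ∈ Ioo (0 : ℝ) 1) {r K : ℝ}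
    (hr : 0 < r) (hK : 0 ≤ K) : ∃ C : ℝ, 0 ≤ C ∧ ∀ (G : Set (Space n)) (y₀ ν : Space n),
      FlatAt r K G y₀ ν → NullMeasurableSet G → ∀ (N δ : ℝ) (Y : Space n → Space n),
      SmallField s N Y y₀ → 0 < δ →
      |∫ z, signedIndicator G (y₀ + z) * kernelDiff s δ Y y₀ z| ≤ C * N := by
  obtain ⟨D, hD0, hD⟩ := exists_kernelDiff_bounds n hs
  obtain ⟨C₁, hC₁0, hC₁⟩ := exists_integral_abs_symIndicator_le n hs hr hK
  set Q : ℝ := (n : ℝ) + s with hQ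
  set I₂ := ∫ z in Metric.ball (0 : Space n) 1, ‖z‖ ^ (-(Q - 1)) with hI₂
  set I₃ := ∫ z in (Metric.ball (0 : Space n) 1)ᶜ, ‖z‖ ^ (-((n : ℝ) + s / 2)) with hI₃
  have hI₂0 : 0 ≤ I₂ := integral_nonneg fun z => by positivity
  have hI₃0 : 0 ≤ I₃ := integral_nonneg fun z => by positivity
  refine ⟨2⁻¹ * (D * (2 * C₁ + I₂ + 4 * I₃)), by positivity, ?_⟩
  intro G y₀ ν hflat hG N δ Y hY hδ
  have hN := hY.nonneg
  have hn := hflat.pos_dim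
  have hn1 : (1 : ℝ) ≤ n := by exact_mod_cast hn
  have hs0 := hs.1
  have hs1 := hs.2
  obtain ⟨hS1, hS2⟩ := hC₁ G y₀ ν hflat hG
  have hb2 := integrableOn_rpow_neg_ball (n := n) (q := Q - 1) (by linarith) (by linarith)
  have hb3 := integrableOn_rpow_neg_compl_ball (n := n) (q := (n : ℝ) + s / 2) (δ := 1)
    (by linarith) one_pos
  have hW2 := (integrable_indicator_iff measurableSet_ball).2 hb2
  have hW3 := (integrable_indicator_iff measurableSet_ball.compl).2 hb3
  have habs : Integrable (fun z => |symIndicator G y₀ z| * ‖z‖ ^ (-Q)) := by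
    refine hS1.norm.congr (ae_of_all _ fun z => ?_)
    simp only [norm_mul, Real.norm_eq_abs, abs_of_nonneg (by positivity : 0 ≤ ‖z‖ ^ (-Q))]
  set W : Space n → ℝ := fun z => 2 * (|symIndicator G y₀ z| * ‖z‖ ^ (-Q)) +
    (Metric.ball (0 : Space n) 1).indicator (fun z => ‖z‖ ^ (-(Q - 1))) z +
    4 * (Metric.ball (0 : Space n) 1)ᶜ.indicator (fun z => ‖z‖ ^ (-((n : ℝ) + s / 2))) z with hW
  have hWi : Integrable W := ((habs.const_mul 2).add hW2).add (hW3.const_mul 4)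
  have hWint : ∫ z, W z ≤ 2 * C₁ + I₂ + 4 * I₃ := by
    have : ∫ z, W z = 2 * (∫ z, |symIndicator G y₀ z| * ‖z‖ ^ (-Q)) + I₂ + 4 * I₃ := by
      have hsum : Integrable fun z => 2 * (|symIndicator G y₀ z| * ‖z‖ ^ (-Q)) +
          (Metric.ball (0 : Space n) 1).indicator (fun z => ‖z‖ ^ (-(Q - 1))) z :=
        (habs.const_mul 2).add hW2
      simp only [hW]
      rw [integral_add hsum (hW3.const_mul 4),
        integral_add (habs.const_mul 2) hW2, integral_const_mul, integral_const_mul,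
        integral_indicator measurableSet_ball, integral_indicator measurableSet_ball.compl]
    rw [this]; linarith
  have hki : Integrable (fun z => signedIndicator G (y₀ + z) * kernelDiff s δ Y y₀ z) := by
    refine ((integrable_jac_mul_regKernel hs0 hδ hY).sub (integrable_regKernel hs0 hδ)).bdd_mul
      (c := 1) (aestronglyMeasurable_signedIndicator_add hG y₀) (ae_of_all _ fun z => ?_)
    rw [Real.norm_eq_abs, abs_signedIndicator]
  have hki' := hki.comp_neg
  have hpair : ∫ z, signedIndicator G (y₀ + z) * kernelDiff s δ Y y₀ z = 2⁻¹ *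
      ∫ z, (signedIndicator G (y₀ + z) * kernelDiff s δ Y y₀ z +
        signedIndicator G (y₀ + -z) * kernelDiff s δ Y y₀ (-z)) := by
    rw [integral_add hki hki', integral_neg_eq_self
      (fun z => signedIndicator G (y₀ + z) * kernelDiff s δ Y y₀ z)]
    ring
  have hbound : ∀ z ≠ 0, ‖signedIndicator G (y₀ + z) * kernelDiff s δ Y y₀ z +
      signedIndicator G (y₀ + -z) * kernelDiff s δ Y y₀ (-z)‖ ≤ D * N * W z := by
    intro z hz
    have hz0 : 0 < ‖z‖ := norm_pos_iff.2 hz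
    obtain ⟨h1, h2⟩ := hD N δ Y y₀ hY z hz
    obtain ⟨h1', -⟩ := hD N δ Y y₀ hY (-z) (neg_ne_zero.2 hz)
    rw [norm_neg] at h1'
    have hDN : 0 ≤ D * N := by positivity
    have hk0 : 0 ≤ ‖z‖ ^ (-Q) := by positivity
    have hS0 : 0 ≤ |symIndicator G y₀ z| * ‖z‖ ^ (-Q) := by positivity
    rw [Real.norm_eq_abs]
    by_cases hz1 : ‖z‖ < 1
    · have hm1 : z ∈ Metric.ball (0 : Space n) 1 := by rwa [mem_ball_zero_iff]
      have hm2 : z ∉ (Metric.ball (0 : Space n) 1)ᶜ := fun h => h hm1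
      have e1 : ‖z‖ * ‖z‖ ^ (-Q) = ‖z‖ ^ (-(Q - 1)) := by
        rw [show -(Q - 1) = 1 + -Q by ring, Real.rpow_add hz0, Real.rpow_one]
      have e2 : ‖z‖ ^ (s / 2) ≤ 1 := Real.rpow_le_one hz0.le hz1.le (by linarith)
      simp only [hW]
      rw [indicator_of_mem hm1, indicator_of_notMem hm2, mul_zero, add_zero, ← e1]
      have e3 : signedIndicator G (y₀ + z) * kernelDiff s δ Y y₀ z +
          signedIndicator G (y₀ + -z) * kernelDiff s δ Y y₀ (-z) =
          symIndicator G y₀ z * kernelDiff s δ Y y₀ z + signedIndicator G (y₀ + -z) *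
            (kernelDiff s δ Y y₀ (-z) - kernelDiff s δ Y y₀ z) := by
        rw [symIndicator, sub_eq_add_neg y₀ z]; ring
      rw [e3]
      refine (abs_add_le _ _).trans ?_
      rw [abs_mul, abs_mul, abs_signedIndicator, one_mul]
      have e4 : |symIndicator G y₀ z| * |kernelDiff s δ Y y₀ z| ≤
          |symIndicator G y₀ z| * (D * N * 2 * ‖z‖ ^ (-Q)) := by
        gcongr
        exact h1.trans (by gcongr; linarith)
      calc _ ≤ |symIndicator G y₀ z| * (D * N * 2 * ‖z‖ ^ (-Q)) + D * N * ‖z‖ * ‖z‖ ^ (-Q) :=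
            add_le_add e4 (h2 hz1.le)
        _ = _ := by ring
    · have hm1 : z ∉ Metric.ball (0 : Space n) 1 := by rwa [mem_ball_zero_iff]
      have hm2 : z ∈ (Metric.ball (0 : Space n) 1)ᶜ := hm1
      have e1 : ‖z‖ ^ (s / 2) * ‖z‖ ^ (-Q) = ‖z‖ ^ (-((n : ℝ) + s / 2)) := by
        rw [← Real.rpow_add hz0]; congr 1; rw [hQ]; ring
      have e2 : 1 ≤ ‖z‖ ^ (s / 2) := Real.one_le_rpow (not_lt.1 hz1) (by linarith)
      simp only [hW]
      rw [indicator_of_notMem hm1, indicator_of_mem hm2, add_zero, ← e1]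
      refine (abs_add_le _ _).trans ?_
      rw [abs_mul, abs_mul, abs_signedIndicator, abs_signedIndicator, one_mul, one_mul]
      have e5 : D * N * (1 + ‖z‖ ^ (s / 2)) * ‖z‖ ^ (-Q) ≤
          D * N * (2 * ‖z‖ ^ (s / 2)) * ‖z‖ ^ (-Q) := by gcongr; linarith
      have e6 : 0 ≤ D * N * (2 * (|symIndicator G y₀ z| * ‖z‖ ^ (-Q))) := by positivity
      calc _ ≤ D * N * (2 * ‖z‖ ^ (s / 2)) * ‖z‖ ^ (-Q) +
            D * N * (2 * ‖z‖ ^ (s / 2)) * ‖z‖ ^ (-Q) := add_le_add (h1.trans e5) (h1'.trans e5)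
        _ ≤ _ := by linarith
  rw [hpair, abs_mul, abs_of_nonneg (by norm_num : (0 : ℝ) ≤ 2⁻¹)]
  have hfin : |∫ z, (signedIndicator G (y₀ + z) * kernelDiff s δ Y y₀ z +
      signedIndicator G (y₀ + -z) * kernelDiff s δ Y y₀ (-z))| ≤ ∫ z, D * N * W z := by
    rw [← Real.norm_eq_abs]
    refine norm_integral_le_of_norm_le (hWi.const_mul _) ?_
    filter_upwards [ae_ne_zero hn] with z hz using hbound z hz
  rw [integral_const_mul] at hfin
  calc 2⁻¹ * _ ≤ 2⁻¹ * (D * N * (2 * C₁ + I₂ + 4 * I₃)) := by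
        gcongr
        exact hfin.trans (by gcongr)
    _ = _ := by ring

/-- If `A` is contained in the image of `G` under `id + Y`, up to boundary points, and the image of
`y₀` is a boundary point of both, then the curvature of `A` there is at least that of `G` at `y₀`,
up to a multiple of the size of `Y`. -/
theorem exists_fracMeanCurv_le_of_perturbation (n : ℕ) {s : ℝ} (hs : s ∈ Ioo (0 : ℝ) 1) {r K : ℝ}
    (hr : 0 < r) (hK : 0 ≤ K) : ∃ C : ℝ, 0 ≤ C ∧
      ∀ (G A : Set (Space n)) (Y : Space n → Space n) (y₀ ν ν' : Space n) (N : ℝ),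
      FlatAt r K G y₀ ν → FlatAt r K A (y₀ + Y y₀) ν' → volume (frontier G) = 0 →
      volume (frontier A) = 0 → SmallField s N Y y₀ →
      (∀ y ∈ interior Gᶜ, y + Y y ∉ interior A) →
      fracMeanCurv s G y₀ - C * N ≤ fracMeanCurv s A (y₀ + Y y₀) := by
  obtain ⟨C, hC0, hC⟩ := exists_abs_integral_kernelDiff_le n hs hr hK
  refine ⟨C, hC0, ?_⟩
  intro G A Y y₀ ν ν' N hGf hAf hG0 hA0 hY hsub
  have hG := nullMeasurableSet_of_volume_frontier hG0
  have hA := nullMeasurableSet_of_volume_frontier hA0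
  have hN := hY.nonneg
  have hs0 := hs.1
  have hs1 : 0 < 1 - s := by linarith [hs.2]
  rw [fracMeanCurv_eq hs hr hK hGf hG, fracMeanCurv_eq hs hr hK hAf hA]
  have key : symCurv s G y₀ - C * N ≤ symCurv s A (y₀ + Y y₀) := by
    refine le_of_tendsto_of_tendsto
      ((tendsto_regularized hs hr hK hGf hG).sub_const (C * N))
      (tendsto_regularized hs hr hK hAf hA) ?_
    filter_upwards [self_mem_nhdsWithin] with δ hδ
    have hδ' : 0 < δ := hδ
    set x₀ := y₀ + Y y₀ with hx₀
    obtain ⟨Θ, hΘ⟩ := exists_homeomorph_id_add hY.diff hY.half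
    let B : Set (Space n) := (fun y => y + Y y) '' G
    have hBmem : ∀ y, y + Y y ∈ B ↔ y ∈ G := by
      intro y
      constructor
      · rintro ⟨y', hy', heq⟩
        have : y' = y := Θ.injective (by rw [hΘ, hΘ]; exact heq)
        rwa [← this]
      · exact fun hy => ⟨y, hy, rfl⟩
    have hBsI : ∀ y, signedIndicator B (y + Y y) = signedIndicator G y := by
      intro y
      by_cases hy : y ∈ G
      · rw [signedIndicator_of_mem hy, signedIndicator_of_mem ((hBmem y).2 hy)]
      · rw [signedIndicator_of_notMem hy, signedIndicator_of_notMem (mt (hBmem y).1 hy)]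
    have hjint := integrable_jac_mul_regKernel hs0 hδ' hY
    have hGjint : Integrable fun z => signedIndicator G (y₀ + z) *
        (jac Y (y₀ + z) * regKernel n s δ (SmallField.disp Y y₀ z)) := by
      refine hjint.bdd_mul (c := 1) (aestronglyMeasurable_signedIndicator_add hG y₀)
        (ae_of_all _ fun z => ?_)
      rw [Real.norm_eq_abs, abs_signedIndicator]
    have hGint : Integrable fun z => signedIndicator G (y₀ + z) * regKernel n s δ z := by
      refine (integrable_regKernel hs0 hδ').bdd_mul (c := 1)
        (aestronglyMeasurable_signedIndicator_add hG y₀) (ae_of_all _ fun z => ?_)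
      rw [Real.norm_eq_abs, abs_signedIndicator]
    have hAint : Integrable fun x => signedIndicator A x * regKernel n s δ (x - x₀) := by
      refine ((integrable_regKernel hs0 hδ').comp_sub_right x₀).bdd_mul (c := 1)
        (aestronglyMeasurable_signedIndicator hA) (ae_of_all _ fun z => ?_)
      rw [Real.norm_eq_abs, abs_signedIndicator]
    have hpt : ∀ z, jac Y (y₀ + z) * (signedIndicator B (y₀ + z + Y (y₀ + z)) *
        regKernel n s δ (y₀ + z + Y (y₀ + z) - x₀)) = signedIndicator G (y₀ + z) *
        (jac Y (y₀ + z) * regKernel n s δ (SmallField.disp Y y₀ z)) := by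
      intro z
      rw [hBsI, show y₀ + z + Y (y₀ + z) - x₀ = SmallField.disp Y y₀ z by
        rw [SmallField.disp, hx₀]; abel]
      ring
    have hBint : Integrable fun x => signedIndicator B x * regKernel n s δ (x - x₀) := by
      rw [integrable_comp_id_add_iff hY.diff hY.half]
      have h1 : Integrable fun z => jac Y (y₀ + z) * (signedIndicator B (y₀ + z + Y (y₀ + z)) *
          regKernel n s δ (y₀ + z + Y (y₀ + z) - x₀)) := by
        simp only [hpt]; exact hGjint
      have h2 := h1.comp_add_left (-y₀)
      refine h2.congr (ae_of_all _ fun z => ?_)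
      simp only [add_neg_cancel_left]
    have hBeq : ∫ x, signedIndicator B x * regKernel n s δ (x - x₀) =
        ∫ z, signedIndicator G (y₀ + z) *
          (jac Y (y₀ + z) * regKernel n s δ (SmallField.disp Y y₀ z)) := by
      rw [integral_comp_id_add hY.diff hY.half, ← integral_add_left_eq_self _ y₀]
      simp only [hpt]
    have hnull : volume ((fun y => y + Y y) '' frontier G) = 0 :=
      addHaar_image_eq_zero_of_differentiableOn_of_addHaar_eq_zero volume
        (differentiable_id.add hY.diff).differentiableOn hG0
    have hle : ∫ x, signedIndicator B x * regKernel n s δ (x - x₀) ≤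
        ∫ x, signedIndicator A x * regKernel n s δ (x - x₀) := by
      refine integral_mono_ae hBint hAint ?_
      filter_upwards [measure_eq_zero_iff_ae_notMem.1 hnull, measure_eq_zero_iff_ae_notMem.1 hA0]
        with x h1 h2
      refine mul_le_mul_of_nonneg_right ?_ (regKernel_nonneg _ _ _)
      by_cases hxA : x ∈ A
      · have hxi : x ∈ interior A := by
          by_contra hni
          exact h2 ⟨subset_closure hxA, hni⟩
        obtain ⟨y, hy⟩ := Θ.surjective x
        rw [hΘ] at hy
        have hyG : y ∈ G := by
          by_contra hyG
          have hyi : y ∉ interior Gᶜ := fun hyi => hsub y hyi (by rwa [hy])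
          have : y ∈ frontier G := by
            rw [← frontier_compl]
            exact ⟨subset_closure hyG, hyi⟩
          exact h1 ⟨y, this, hy⟩
        rw [signedIndicator_of_mem hxA, ← hy, signedIndicator_of_mem ((hBmem y).2 hyG)]
      · rw [signedIndicator_of_notMem hxA]
        exact (abs_le.1 (abs_signedIndicator B x).le).2
    have hAeq : ∫ z, signedIndicator A (x₀ + z) * regKernel n s δ z =
        ∫ x, signedIndicator A x * regKernel n s δ (x - x₀) := by
      rw [← integral_add_left_eq_self (fun x => signedIndicator A x * regKernel n s δ (x - x₀)) x₀]
      simp only [add_sub_cancel_left]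
    have hdiff : ∫ z, signedIndicator G (y₀ + z) * kernelDiff s δ Y y₀ z =
        (∫ z, signedIndicator G (y₀ + z) *
          (jac Y (y₀ + z) * regKernel n s δ (SmallField.disp Y y₀ z))) -
        ∫ z, signedIndicator G (y₀ + z) * regKernel n s δ z := by
      rw [← integral_sub hGjint hGint]
      simp only [kernelDiff, mul_sub]
    have hfin := (abs_le.1 (hC G y₀ ν hGf hG N δ Y hY hδ')).1
    show (∫ z, signedIndicator G (y₀ + z) * regKernel n s δ z) - C * N ≤
      ∫ z, signedIndicator A (x₀ + z) * regKernel n s δ z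
    rw [hAeq]
    linarith
  have hss : 0 < s * (1 - s) := by positivity
  have hss1 : s * (1 - s) ≤ 1 := by nlinarith
  have hCN : 0 ≤ C * N := by positivity
  nlinarith

section Smoothing

variable {F : Type*} [NormedAddCommGroup F] [NormedSpace ℝ F]
  {k : Space n → F} {A : Set (Space n)}

theorem hasFDerivAt_setIntegral_comp_sub (hk : ContDiff ℝ 1 k) (hkc : HasCompactSupport k)
    (hA : MeasurableSet A) (x : Space n) :
    HasFDerivAt (fun x => ∫ y in A, k (x - y)) (∫ y in A, fderiv ℝ k (x - y)) x := by
  let f : Space n → ℝ := A.indicator fun _ => 1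
  have hf : LocallyIntegrable f volume := (locallyIntegrable_const 1).indicator hA
  have h := hkc.hasFDerivAt_convolution_right (ContinuousLinearMap.lsmul ℝ ℝ) hf hk x
  have e1 : (convolution f k (ContinuousLinearMap.lsmul ℝ ℝ) volume) =
      fun x => ∫ y in A, k (x - y) := by
    ext x
    rw [convolution_def, ← integral_indicator hA]
    congr 1
    ext y
    by_cases hy : y ∈ A <;> simp [f, hy]
  have e2 : (convolution f (fderiv ℝ k)
      ((ContinuousLinearMap.lsmul ℝ ℝ).precompR (Space n)) volume) x =
      ∫ y in A, fderiv ℝ k (x - y) := by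
    rw [convolution_def, ← integral_indicator hA]
    congr 1
    ext y v
    by_cases hy : y ∈ A <;> simp [f, hy]
  rw [e1, e2] at h
  exact h

theorem norm_setIntegral_comp_sub_le (hk : Continuous k) (hkc : HasCompactSupport k)
    (x : Space n) : ‖∫ y in A, k (x - y)‖ ≤ ∫ y, ‖k y‖ := by
  have hi : Integrable fun y => ‖k (x - y)‖ :=
    ((hk.integrable_of_hasCompactSupport hkc).comp_sub_left x).norm
  refine (norm_integral_le_integral_norm _).trans ?_
  refine (setIntegral_le_integral hi (ae_of_all _ fun y => norm_nonneg _)).trans (le_of_eq ?_)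
  exact integral_sub_left_eq_self (fun y => ‖k y‖) volume x

theorem norm_setIntegral_comp_sub_sub_le (hk : ContDiff ℝ 1 k) (hkc : HasCompactSupport k)
    (hA : MeasurableSet A) (x x' : Space n) :
    ‖(∫ y in A, k (x - y)) - ∫ y in A, k (x' - y)‖ ≤ (∫ y, ‖fderiv ℝ k y‖) * ‖x - x'‖ := by
  refine convex_univ.norm_image_sub_le_of_norm_hasFDerivWithin_le (𝕜 := ℝ)
    (f := fun x => ∫ y in A, k (x - y)) (f' := fun x => ∫ y in A, fderiv ℝ k (x - y))
    (fun x _ => (hasFDerivAt_setIntegral_comp_sub hk hkc hA x).hasFDerivWithinAt)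
    (fun x _ => ?_) (mem_univ x') (mem_univ x)
  exact norm_setIntegral_comp_sub_le (hk.continuous_fderiv (by norm_num)) (hkc.fderiv (𝕜 := ℝ)) x

end Smoothing

/-- A smooth cutoff, equal to `1` on the ball of radius `ρ / 2` and supported in that of
radius `ρ`. -/
def cutoff (n : ℕ) (ρ : ℝ) (hρ : 0 < ρ) : ContDiffBump (0 : Space n) where
  rIn := ρ / 2
  rOut := ρ
  rIn_pos := by positivity
  rIn_lt_rOut := by linarith

/-- A smooth field pointing out of `A` near its boundary: the mean of `x - y` over `y ∈ A`
near `x`. -/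
def outField (ρ : ℝ) (hρ : 0 < ρ) (A : Set (Space n)) (x : Space n) : Space n :=
  ∫ y in A, cutoff n ρ hρ (x - y) • (x - y)

theorem exists_outField_bounds (n : ℕ) {ρ : ℝ} (hρ : 0 < ρ) : ∃ M : ℝ, 1 ≤ M ∧
    ∀ A : Set (Space n), MeasurableSet A → Differentiable ℝ (outField ρ hρ A) ∧
      (∀ x, ‖outField ρ hρ A x‖ ≤ M) ∧ (∀ x, ‖fderiv ℝ (outField ρ hρ A) x‖ ≤ M) ∧
      ∀ x x', ‖fderiv ℝ (outField ρ hρ A) x - fderiv ℝ (outField ρ hρ A) x'‖ ≤ M * ‖x - x'‖ := by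
  let k : Space n → Space n := fun z => cutoff n ρ hρ z • z
  have hk : ContDiff ℝ 2 k := (cutoff n ρ hρ).contDiff.smul contDiff_id
  have hkc : HasCompactSupport k := (cutoff n ρ hρ).hasCompactSupport.smul_right
  have hk1 : ContDiff ℝ 1 k := hk.of_le (by norm_num)
  have hdk : ContDiff ℝ 1 (fderiv ℝ k) := hk.fderiv_right (by norm_num)
  have hdkc : HasCompactSupport (fderiv ℝ k) := hkc.fderiv (𝕜 := ℝ)
  set M₀ := ∫ y, ‖k y‖
  set M₁ := ∫ y, ‖fderiv ℝ k y‖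
  set M₂ := ∫ y, ‖fderiv ℝ (fderiv ℝ k) y‖
  have hM₀ : 0 ≤ M₀ := integral_nonneg fun y => norm_nonneg _
  have hM₁ : 0 ≤ M₁ := integral_nonneg fun y => norm_nonneg _
  have hM₂ : 0 ≤ M₂ := integral_nonneg fun y => by positivity
  refine ⟨1 + M₀ + M₁ + M₂, by linarith, fun A hA => ?_⟩
  have h1 : ∀ x, HasFDerivAt (outField ρ hρ A) (∫ y in A, fderiv ℝ k (x - y)) x :=
    fun x => hasFDerivAt_setIntegral_comp_sub hk1 hkc hA x
  refine ⟨fun x => (h1 x).differentiableAt, fun x => ?_, fun x => ?_, fun x x' => ?_⟩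
  · exact (norm_setIntegral_comp_sub_le hk.continuous hkc x).trans (by linarith)
  · rw [(h1 x).fderiv]
    exact (norm_setIntegral_comp_sub_le hdk.continuous hdkc x).trans (by linarith)
  · rw [(h1 x).fderiv, (h1 x').fderiv]
    refine (norm_setIntegral_comp_sub_sub_le hdk hdkc hA x x').trans ?_
    exact mul_le_mul_of_nonneg_right (by linarith) (norm_nonneg _)

theorem le_inner_outField {ρ : ℝ} (hρ : 0 < ρ) {A : Set (Space n)} (hA : MeasurableSet A)
    {p ν : Space n} (hν : ‖ν‖ = 1) {δ : ℝ} (hδ0 : 0 ≤ δ) (hδ : δ < ρ / 8)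
    (h1 : ∀ y, ‖y - p‖ < ρ → inner ℝ (y - p) ν < -δ → y ∈ A)
    (h2 : ∀ y, ‖y - p‖ < ρ → δ < inner ℝ (y - p) ν → y ∉ A) :
    ρ / 8 * volume.real (Metric.ball (0 : Space n) (ρ / 8)) -
      δ * volume.real (Metric.ball (0 : Space n) ρ) ≤ inner ℝ (outField ρ hρ A p) ν := by
  set φ := cutoff n ρ hρ with hφ
  let k : Space n → Space n := fun z => φ z • z
  have hk : Continuous k := φ.continuous.smul continuous_id
  have hkc : HasCompactSupport k := φ.hasCompactSupport.smul_right
  have hki : Integrable fun y => k (p - y) :=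
    (hk.integrable_of_hasCompactSupport hkc).comp_sub_left p
  have e1 : inner ℝ (outField ρ hρ A p) ν =
      ∫ y, A.indicator (fun y => φ (p - y) * inner ℝ (p - y) ν) y := by
    rw [integral_indicator hA, real_inner_comm]
    have := (innerSL ℝ ν).integral_comp_comm (μ := volume.restrict A) hki.integrableOn
    rw [innerSL_apply_apply] at this
    rw [outField, ← this]
    congr 1
    ext y
    rw [innerSL_apply_apply, inner_smul_right, real_inner_comm]
  set c : Space n := p - (ρ / 4) • ν with hc
  have hi : Integrable (A.indicator (fun y => φ (p - y) * inner ℝ (p - y) ν)) := by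
    rw [integrable_indicator_iff hA]
    have := ((innerSL ℝ ν).integrable_comp hki).integrableOn (s := A)
    refine this.congr (ae_of_all _ fun y => ?_)
    simp only [innerSL_apply_apply, k, inner_smul_right, real_inner_comm]
  have hl1 : Integrable ((Metric.ball c (ρ / 8)).indicator fun _ : Space n => ρ / 8) :=
    (integrable_indicator_iff measurableSet_ball).2 (integrableOn_const measure_ball_lt_top.ne)
  have hl2 : Integrable ((Metric.ball p ρ).indicator fun _ : Space n => δ) :=
    (integrable_indicator_iff measurableSet_ball).2 (integrableOn_const measure_ball_lt_top.ne)
  have hνν : inner ℝ ν ν = (1 : ℝ) := by rw [real_inner_self_eq_norm_sq, hν]; norm_num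
  have hpt : ∀ y, (Metric.ball c (ρ / 8)).indicator (fun _ : Space n => ρ / 8) y -
      (Metric.ball p ρ).indicator (fun _ : Space n => δ) y ≤
      A.indicator (fun y => φ (p - y) * inner ℝ (p - y) ν) y := by
    intro y
    have hφ0 : 0 ≤ φ (p - y) := φ.nonneg
    have hφ1 : φ (p - y) ≤ 1 := φ.le_one
    have hinn : inner ℝ (p - y) ν = -(inner ℝ (y - p) ν : ℝ) := by
      rw [← neg_sub, inner_neg_left]
    have hδi : 0 ≤ (Metric.ball p ρ).indicator (fun _ : Space n => δ) y :=
      indicator_nonneg (fun _ _ => hδ0) y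
    by_cases hyc : y ∈ Metric.ball c (ρ / 8)
    · rw [indicator_of_mem hyc]
      rw [Metric.mem_ball, dist_eq_norm] at hyc
      have e2 : y - p = (y - c) - (ρ / 4) • ν := by rw [hc]; abel
      have hnu : ‖(ρ / 4) • ν‖ = ρ / 4 := by
        rw [norm_smul, hν, mul_one, Real.norm_of_nonneg (by positivity)]
      have h3 : ‖y - p‖ ≤ 3 * ρ / 8 := by
        rw [e2]
        refine (norm_sub_le _ _).trans ?_
        rw [hnu]; linarith
      have h4 : inner ℝ (y - p) ν ≤ -(ρ / 8) := by
        rw [e2, inner_sub_left, inner_smul_left, hνν]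
        have := (abs_le.1 (abs_real_inner_le_norm (y - c) ν)).2
        rw [hν, mul_one] at this
        simp only [RCLike.conj_to_real]
        linarith
      have hyA : y ∈ A := h1 y (by linarith) (by linarith)
      have hφy : φ (p - y) = 1 := φ.one_of_mem_closedBall (by
        rw [mem_closedBall_zero_iff, norm_sub_rev]
        show ‖y - p‖ ≤ ρ / 2
        linarith)
      rw [indicator_of_mem hyA, hφy, hinn]
      linarith
    · rw [indicator_of_notMem hyc]
      by_cases hyA : y ∈ A
      · rw [indicator_of_mem hyA]
        by_cases hyp : ‖y - p‖ < ρ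
        · have h5 : inner ℝ (y - p) ν ≤ δ := by
            by_contra! h; exact h2 y hyp h hyA
          rw [indicator_of_mem (by rwa [Metric.mem_ball, dist_eq_norm]), hinn]
          nlinarith
        · have : φ (p - y) = 0 := φ.zero_of_le_dist (by
            rw [dist_zero_right, norm_sub_rev]; exact not_lt.1 hyp)
          rw [this, zero_mul]; linarith
      · rw [indicator_of_notMem hyA]; linarith
  have := integral_mono (hl1.sub hl2) hi hpt
  rw [e1]
  refine le_trans (le_of_eq ?_) this
  simp only [Pi.sub_apply]
  rw [integral_sub hl1 hl2, integral_indicator measurableSet_ball,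
    integral_indicator measurableSet_ball, setIntegral_const, setIntegral_const, smul_eq_mul,
    smul_eq_mul, Measure.real, Measure.real, Measure.real, Measure.real,
    Measure.addHaar_ball_center volume c, Measure.addHaar_ball_center volume p]
  ring

theorem tendsto_prodMk_right_nhdsWithin {I : Set ℝ} {t : ℝ} (ht : t ∈ I) (x : Space n) :
    Tendsto (fun y => (y, t)) (𝓝 x) (𝓝[univ ×ˢ I] (x, t)) :=
  tendsto_nhdsWithin_iff.2 ⟨(Continuous.prodMk_left t).tendsto x,
    Eventually.of_forall fun _ => ⟨mem_univ _, ht⟩⟩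

theorem nhdsLT_le_nhdsWithin_Icc {c t : ℝ} (ht : t ∈ Ioc 0 c) : 𝓝[<] t ≤ 𝓝[Icc 0 c] t := by
  rw [← nhdsWithin_Ioo_eq_nhdsLT ht.1]
  exact nhdsWithin_mono _ fun τ hτ => ⟨hτ.1.le, hτ.2.le.trans ht.2⟩

theorem deriv_nonpos_of_nonneg_left {f : ℝ → ℝ} {f' c t : ℝ} (ht : t ∈ Ioc 0 c)
    (hf : HasDerivWithinAt f f' (Icc 0 c) t) (h0 : f t = 0) (h : ∀ᶠ τ in 𝓝[<] t, 0 ≤ f τ) :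
    f' ≤ 0 := by
  have h1 : HasDerivWithinAt f f' (Ioo 0 t) t :=
    hf.mono fun τ hτ => ⟨hτ.1.le, hτ.2.le.trans ht.2⟩
  rw [hasDerivWithinAt_iff_tendsto_slope' (by simp), nhdsWithin_Ioo_eq_nhdsLT ht.1] at h1
  refine le_of_tendsto h1 ?_
  filter_upwards [h, self_mem_nhdsWithin] with τ h2 h3
  rw [slope_def_field, h0, sub_zero]
  exact div_nonpos_of_nonneg_of_nonpos h2 (sub_nonpos.2 (le_of_lt h3))

section C1Family

variable {c : ℝ} {E : ℝ → Set (Space n)}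

theorem IsC1Family.compl (h : IsC1Family c E) : IsC1Family c fun t => (E t)ᶜ := by
  intro t₀ ht₀ x₀
  obtain ⟨u, hu, hne, hev⟩ := h t₀ ht₀ x₀
  refine ⟨fun p => -u p, hu.neg, fun h0 => ?_, ?_⟩
  · have := hne (neg_eq_zero.1 h0)
    rw [show (fun x => -u (x, t₀)) = -fun x => u (x, t₀) from rfl, fderiv_neg]
    exact neg_ne_zero.2 this
  · filter_upwards [hev] with p hp
    exact ⟨fun h => hp.2 (by linarith), fun h => not_not.2 (hp.1 (by linarith))⟩

theorem IsC1Family.exists_sign (h : IsC1Family c E) {t₀ : ℝ} (ht₀ : t₀ ∈ Icc 0 c) (x₀ : Space n) :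
    ∃ u : Space n × ℝ → ℝ, ContDiff ℝ 1 u ∧
      (u (x₀, t₀) = 0 → fderiv ℝ (fun x => u (x, t₀)) x₀ ≠ 0) ∧
      ∀ᶠ p in 𝓝[univ ×ˢ Icc 0 c] (x₀, t₀),
        (u p < 0 → p.1 ∈ interior (E p.2)) ∧ (0 < u p → p.1 ∈ interior (E p.2)ᶜ) := by
  obtain ⟨u, hu, hne, hev⟩ := h t₀ ht₀ x₀
  refine ⟨u, hu, hne, ?_⟩
  filter_upwards [eventually_eventually_nhdsWithin.2 hev, self_mem_nhdsWithin] with p hp hpS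
  have hsl := (tendsto_prodMk_right_nhdsWithin hpS.2 p.1).eventually hp
  have hcont : Continuous fun y => u (y, p.2) := hu.continuous.comp (by fun_prop)
  constructor
  · intro hup
    rw [mem_interior_iff_mem_nhds]
    filter_upwards [hsl, (isOpen_lt hcont continuous_const).mem_nhds (show u (p.1, p.2) < 0 from hup)]
      with y h1 h2
    exact h1.1 h2
  · intro hup
    rw [mem_interior_iff_mem_nhds]
    filter_upwards [hsl, (isOpen_lt continuous_const hcont).mem_nhds (show 0 < u (p.1, p.2) from hup)]
      with y h1 h2
    exact h1.2 h2

theorem notMem_interior_of_mem_closure_compl {A : Set (Space n)} {x : Space n}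
    (h : x ∈ closure Aᶜ) : x ∉ interior A := by
  rwa [closure_compl] at h

theorem notMem_interior_compl_of_mem_closure {A : Set (Space n)} {x : Space n}
    (h : x ∈ closure A) : x ∉ interior Aᶜ := by
  rw [interior_compl]; exact not_not.2 h

theorem mem_frontier_of_notMem_interior {A : Set (Space n)} {x : Space n}
    (h : x ∉ interior A) (h' : x ∉ interior Aᶜ) : x ∈ frontier A := by
  rw [interior_compl] at h'
  exact ⟨not_not.1 h', h⟩

theorem mem_closure_interior_of_sign {A : Set (Space n)} {f : Space n → ℝ} {x : Space n}
    (hf : Differentiable ℝ f) (hne : f x = 0 → fderiv ℝ f x ≠ 0)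
    (hev : ∀ᶠ y in 𝓝 x, f y < 0 → y ∈ interior A) (hle : f x ≤ 0) : x ∈ closure (interior A) := by
  rcases hle.lt_or_eq with hlt | heq
  · exact subset_closure (hev.self_of_nhds hlt)
  · have hl := hne heq
    obtain ⟨d, hd⟩ : ∃ d, fderiv ℝ f x d < 0 := by
      by_contra! hall
      apply hl
      ext d
      have h1 := hall d
      have h2 := hall (-d)
      rw [map_neg] at h2
      exact le_antisymm (neg_nonneg.1 h2) h1
    have hline : HasDerivAt (fun ε : ℝ => f (x + ε • d)) (fderiv ℝ f x d) 0 := by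
      have h1 : HasDerivAt (fun ε : ℝ => x + ε • d) d 0 := by
        simpa using ((hasDerivAt_id (0 : ℝ)).smul_const d).const_add x
      have h2 : HasFDerivAt f (fderiv ℝ f x) (x + (0 : ℝ) • d) := by simpa using (hf x).hasFDerivAt
      exact h2.comp_hasDerivAt (0 : ℝ) h1
    have hneg : ∀ᶠ ε : ℝ in 𝓝[>] 0, f (x + ε • d) < 0 := by
      have h1 := hline.hasDerivWithinAt (s := Ioi 0)
      rw [hasDerivWithinAt_iff_tendsto_slope' (by simp)] at h1
      filter_upwards [h1.eventually (gt_mem_nhds hd), self_mem_nhdsWithin] with ε h2 h3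
      have h3' : 0 < ε := h3
      rw [slope_def_field, zero_smul, add_zero, heq, sub_zero, sub_zero, div_lt_iff₀ h3'] at h2
      simpa using h2
    have hlim : Tendsto (fun ε : ℝ => x + ε • d) (𝓝[>] 0) (𝓝 x) := by
      simpa using tendsto_const_nhds.add (tendsto_id_nhdsGT_zero.smul_const d)
    refine mem_closure_of_tendsto hlim ?_
    filter_upwards [hneg, hlim.eventually hev] with ε h1 h2
    exact h2 h1

theorem IsC1Family.closure_subset_closure_interior (h : IsC1Family c E) {t : ℝ}
    (ht : t ∈ Icc 0 c) : closure (E t) ⊆ closure (interior (E t)) := by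
  intro x hx
  obtain ⟨u, hu, hne, hev⟩ := h.exists_sign ht x
  have h0 := hev.self_of_nhdsWithin (show (x, t) ∈ univ ×ˢ Icc 0 c from ⟨mem_univ _, ht⟩)
  refine mem_closure_interior_of_sign (f := fun y => u (y, t))
    ((hu.differentiable (by norm_num)).comp (by fun_prop)) hne ?_ ?_
  · filter_upwards [(tendsto_prodMk_right_nhdsWithin ht x).eventually hev] with y hy using hy.1
  · by_contra! hlt
    exact notMem_interior_compl_of_mem_closure hx (h0.2 hlt)

theorem IsC1Family.closure_compl_subset (h : IsC1Family c E) {t : ℝ}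
    (ht : t ∈ Icc 0 c) : closure (E t)ᶜ ⊆ closure (interior (E t)ᶜ) :=
  h.compl.closure_subset_closure_interior ht

theorem IsC1Family.eventually_mem_interior (h : IsC1Family c E) {t : ℝ} (ht : t ∈ Icc 0 c)
    {x : Space n} (hx : x ∈ interior (E t)) :
    ∀ᶠ p in 𝓝[univ ×ˢ Icc 0 c] (x, t), p.1 ∈ interior (E p.2) := by
  obtain ⟨u, hu, hne, hev⟩ := h.exists_sign ht x
  have hlt : u (x, t) < 0 := by
    by_contra! hle
    have hxc : x ∈ closure (interior (E t)ᶜ) := by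
      refine mem_closure_interior_of_sign (f := -fun y => u (y, t))
        ((hu.differentiable (by norm_num)).comp (by fun_prop)).neg (fun h0 => ?_) ?_ ?_
      · rw [fderiv_neg]
        exact neg_ne_zero.2 (hne (neg_eq_zero.1 h0))
      · filter_upwards [(tendsto_prodMk_right_nhdsWithin ht x).eventually hev] with y hy h1
        exact hy.2 (neg_lt_zero.1 h1)
      · exact neg_nonpos.2 hle
    exact notMem_interior_of_mem_closure_compl (closure_mono interior_subset hxc) hx
  filter_upwards [hev, mem_nhdsWithin_of_mem_nhds
    ((isOpen_lt hu.continuous continuous_const).mem_nhds hlt)] with p h1 h2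
  exact h1.1 h2

theorem IsC1Family.isClosed_closure_track (h : IsC1Family c E) :
    IsClosed {p : Space n × ℝ | p.2 ∈ Icc 0 c ∧ p.1 ∈ closure (E p.2)} := by
  rw [← isOpen_compl_iff, isOpen_iff_mem_nhds]
  rintro ⟨x, t⟩ hp
  by_cases ht : t ∈ Icc 0 c
  · have hx : x ∈ interior (E t)ᶜ := by
      rw [interior_compl]
      exact fun hx => hp ⟨ht, hx⟩
    have := h.compl.eventually_mem_interior ht hx
    rw [eventually_nhdsWithin_iff] at this
    filter_upwards [this] with p h1 h2
    exact notMem_interior_compl_of_mem_closure h2.2 (h1 ⟨mem_univ _, h2.1⟩)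
  · filter_upwards [(isClosed_Icc.isOpen_compl.preimage continuous_snd).mem_nhds
      (show (x, t) ∈ Prod.snd ⁻¹' (Icc 0 c)ᶜ from ht)] with p h1 h2
    exact h1 h2.1

theorem IsC1Family.eventually_left_mem_interior (h : IsC1Family c E) {t : ℝ} (ht : t ∈ Ioc 0 c)
    {x : Space n} (hx : x ∈ interior (E t)) {γ : ℝ → Space n} (hγ : Tendsto γ (𝓝[<] t) (𝓝 x)) :
    ∀ᶠ τ in 𝓝[<] t, γ τ ∈ interior (E τ) := by
  have h1 := h.eventually_mem_interior (Ioc_subset_Icc_self ht) hx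
  have h2 : Tendsto (fun τ => (γ τ, τ)) (𝓝[<] t) (𝓝[univ ×ˢ Icc 0 c] (x, t)) := by
    refine tendsto_nhdsWithin_iff.2 ⟨hγ.prodMk_nhds (tendsto_id.mono_left nhdsWithin_le_nhds), ?_⟩
    filter_upwards [nhdsLT_le_nhdsWithin_Icc ht self_mem_nhdsWithin] with τ hτ
    exact ⟨mem_univ _, hτ⟩
  exact h2.eventually h1

end C1Family

/-- A family of sets whose boundaries move in a `C¹` way with normal velocity `V`. -/
structure MovingFamily (c : ℝ) (E : ℝ → Set (Space n)) (V : ℝ → Space n → ℝ) : Prop where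
  isC1Family : IsC1Family c E
  motion : ∀ t ∈ Icc 0 c, ∀ x ∈ frontier (E t), ∃ (ν : Space n) (γ : ℝ → Space n) (v : Space n),
    IsOuterNormal (E t) x ν ∧ γ t = x ∧ (∀ᶠ τ in 𝓝[Icc 0 c] t, γ τ ∈ frontier (E τ)) ∧
    HasDerivWithinAt γ v (Icc 0 c) t ∧ inner ℝ v ν = V t x

theorem MovingFamily.compl {c : ℝ} {E : ℝ → Set (Space n)} {V : ℝ → Space n → ℝ}
    (h : MovingFamily c E V) : MovingFamily c (fun t => (E t)ᶜ) fun t x => -V t x := by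
  refine ⟨h.isC1Family.compl, fun t ht x hx => ?_⟩
  rw [frontier_compl] at hx
  obtain ⟨ν, γ, v, h1, h2, h3, h4, h5⟩ := h.motion t ht x hx
  refine ⟨-ν, γ, v, h1.compl, h2, ?_, h4, by rw [inner_neg_right, h5]⟩
  simpa only [frontier_compl] using h3

theorem isOuterNormal_eq_of_ball {A : Set (Space n)} {p x ν : Space n} {R : ℝ} (hR : 0 < R)
    (hp : ‖p - x‖ = R) (hν : IsOuterNormal A p ν) (h : ∀ y ∈ interior A, R ≤ ‖y - x‖) :
    ν = R⁻¹ • (x - p) := by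
  by_contra hne
  have he : ‖R⁻¹ • (x - p)‖ = 1 := by
    rw [norm_smul, norm_sub_rev, hp, norm_inv, Real.norm_of_nonneg hR.le, inv_mul_cancel₀ hR.ne']
  obtain ⟨h1, h2⟩ := inner_sub_pos_of_ne he hν.1 (Ne.symm hne)
  set d := R⁻¹ • (x - p) - ν with hd
  have h3 := hν.eventually_ray h2
  rw [inner_smul_right] at h1
  have h1' : 0 < inner ℝ d (x - p) := (pos_iff_pos_of_mul_pos h1).1 (by positivity)
  have h4 : ∀ᶠ ε : ℝ in 𝓝[>] 0, ε * ‖d‖ ^ 2 < 2 * inner ℝ d (x - p) := by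
    have : Tendsto (fun ε : ℝ => ε * ‖d‖ ^ 2) (𝓝[>] 0) (𝓝 (0 * ‖d‖ ^ 2)) :=
      tendsto_id_nhdsGT_zero.mul_const _
    rw [zero_mul] at this
    exact this.eventually (gt_mem_nhds (by linarith))
  obtain ⟨ε, h5, h6, h7⟩ := (h3.and (h4.and self_mem_nhdsWithin)).exists
  have h7' : 0 < ε := h7
  have h8 := h _ h5
  have h9 : ‖p + ε • d - x‖ ^ 2 = R ^ 2 - ε * (2 * inner ℝ d (x - p) - ε * ‖d‖ ^ 2) := by
    rw [show p + ε • d - x = ε • d - (x - p) by abel, norm_sub_sq_real, inner_smul_left, norm_smul,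
      norm_sub_rev x p, hp, Real.norm_of_nonneg h7'.le]
    simp only [RCLike.conj_to_real]
    ring
  have h10 : R ^ 2 ≤ ‖p + ε • d - x‖ ^ 2 := by gcongr
  nlinarith [mul_pos h7' (sub_pos.2 h6)]

theorem MovingFamily.notMem_closure_of_ball {c : ℝ} {E : ℝ → Set (Space n)}
    {V : ℝ → Space n → ℝ} (h : MovingFamily c E V) {C₀ : ℝ} (hC₀ : 0 ≤ C₀)
    (hV : ∀ t ∈ Icc 0 c, ∀ x ∈ frontier (E t), V t x ≤ C₀) {t₁ t₂ ρ : ℝ} (ht₁ : 0 ≤ t₁)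
    (ht₂ : t₂ ≤ c) {x : Space n} (h12 : t₁ ≤ t₂) (hρ : (C₀ + 1) * (t₂ - t₁) < ρ)
    (hball : ∀ y ∈ closure (E t₁), ρ < ‖y - x‖) : x ∉ closure (E t₂) := by
  intro hx
  set w := C₀ + 1 with hw
  have hw0 : 0 < w := by linarith
  let R : ℝ → ℝ := fun t => ρ - w * (t - t₁)
  let K : Set (Space n × ℝ) := {p | p.2 ∈ Icc 0 c ∧ p.1 ∈ closure (E p.2)} ∩
    {p | p.2 ∈ Icc t₁ t₂ ∧ ‖p.1 - x‖ ≤ R p.2}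
  have hKc : IsCompact K := by
    have hsub : K ⊆ Metric.closedBall x ρ ×ˢ Icc t₁ t₂ := by
      rintro ⟨p, t⟩ ⟨-, ht, hp⟩
      refine ⟨?_, ht⟩
      rw [Metric.mem_closedBall, dist_eq_norm]
      refine le_trans hp ?_
      have := mul_nonneg hw0.le (sub_nonneg.2 ht.1)
      simp only [R]; linarith
    refine ((isCompact_closedBall x ρ).prod isCompact_Icc).of_isClosed_subset ?_ hsub
    refine h.isC1Family.isClosed_closure_track.inter ?_
    have e1 : IsClosed {p : Space n × ℝ | p.2 ∈ Icc t₁ t₂} := isClosed_Icc.preimage continuous_snd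
    have e2 : IsClosed {p : Space n × ℝ | ‖p.1 - x‖ ≤ R p.2} :=
      isClosed_le (by fun_prop) (by fun_prop)
    exact e1.inter e2
  have hKne : K.Nonempty := by
    refine ⟨(x, t₂), ⟨⟨ht₁.trans h12, ht₂⟩, hx⟩, ⟨h12, le_rfl⟩, ?_⟩
    simp only [R, sub_self, norm_zero]; linarith
  obtain ⟨⟨p, t⟩, ⟨⟨htI, hpE⟩, htJ, hpR⟩, hmin⟩ := hKc.exists_isMinOn hKne continuous_snd.continuousOn
  simp only at htI hpE htJ hpR
  have hR0 : 0 < R t := by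
    have : w * (t - t₁) ≤ w * (t₂ - t₁) := mul_le_mul_of_nonneg_left (sub_le_sub_right htJ.2 _) hw0.le
    simp only [R]; linarith
  have htne : t₁ < t := by
    refine lt_of_le_of_ne htJ.1 fun heq => ?_
    subst heq
    have h1 := hball p hpE
    simp only [R, sub_self, mul_zero, sub_zero] at hpR
    linarith
  have ht : t ∈ Ioc 0 c := ⟨ht₁.trans_lt htne, htI.2⟩
  have hearly : ∀ᶠ τ in 𝓝[<] t, ∀ y ∈ closure (E τ), R τ < ‖y - x‖ := by
    filter_upwards [Ioo_mem_nhdsLT htne] with τ hτ y hy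
    by_contra! hle
    have : t ≤ τ := hmin (show (y, τ) ∈ K from
      ⟨⟨⟨ht₁.trans hτ.1.le, hτ.2.le.trans htI.2⟩, hy⟩, ⟨hτ.1.le, hτ.2.le.trans htJ.2⟩, hle⟩)
    exact absurd hτ.2 this.not_gt
  have hint : ∀ y ∈ interior (E t), R t ≤ ‖y - x‖ := by
    intro y hy
    by_contra! hlt
    obtain ⟨τ, h1, h2, h3⟩ := ((h.isC1Family.eventually_left_mem_interior ht hy
      tendsto_const_nhds).and (hearly.and self_mem_nhdsWithin)).exists
    have h4 := h2 y (subset_closure (interior_subset h1))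
    have h5 : R t ≤ R τ := by
      have : w * (τ - t₁) ≤ w * (t - t₁) := 
        mul_le_mul_of_nonneg_left (sub_le_sub_right (le_of_lt h3) _) hw0.le
      simp only [R]; linarith
    linarith
  have hclos : ∀ y ∈ closure (E t), R t ≤ ‖y - x‖ := by
    intro y hy
    have hcl : IsClosed {y : Space n | R t ≤ ‖y - x‖} := isClosed_le (by fun_prop) (by fun_prop)
    exact closure_minimal hint hcl (h.isC1Family.closure_subset_closure_interior htI hy)
  have hpeq : ‖p - x‖ = R t := le_antisymm hpR (hclos p hpE)
  have hpi : p ∉ interior (E t) := by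
    intro hpi
    have hlim : Tendsto (fun ε : ℝ => p + ε • (x - p)) (𝓝[>] 0) (𝓝 p) := by
      simpa using tendsto_const_nhds.add (tendsto_id_nhdsGT_zero.smul_const (x - p))
    obtain ⟨ε, h1, h2⟩ := ((hlim.eventually (isOpen_interior.mem_nhds hpi)).and
      (Ioo_mem_nhdsGT one_pos)).exists
    have h3 := hint _ h1
    rw [show p + ε • (x - p) - x = (1 - ε) • (p - x) by module, norm_smul, hpeq,
      Real.norm_of_nonneg (by linarith [h2.2])] at h3
    nlinarith [h2.1]
  have hpf : p ∈ frontier (E t) := ⟨hpE, hpi⟩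
  obtain ⟨ν, γ, v, hν, hγt, hγ, hγ', hvν⟩ := h.motion t htI p hpf
  have hνeq := isOuterNormal_eq_of_ball hR0 hpeq hν hint
  have hder : HasDerivWithinAt (fun τ => ‖γ τ - x‖ ^ 2 - R τ ^ 2)
      (2 * inner ℝ (γ t - x) v - 2 * R t * (-w)) (Icc 0 c) t := by
    have h1 : HasDerivWithinAt (fun τ => ‖γ τ - x‖ ^ 2) (2 * inner ℝ (γ t - x) v) (Icc 0 c) t :=
      (hγ'.sub_const x).norm_sq
    have h2 : HasDerivAt R (-w) t := by
      have := (((hasDerivAt_id t).sub_const t₁).const_mul w).const_sub ρ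
      simpa using this
    have h3 := (h2.hasDerivWithinAt (s := Icc 0 c)).pow 2
    exact (h1.sub h3).congr_deriv (by simp)
  have hle := deriv_nonpos_of_nonneg_left ht hder (by simp only [hγt, hpeq, sub_self]) (by
    filter_upwards [hearly, nhdsLT_le_nhdsWithin_Icc ht hγ, self_mem_nhdsWithin] with τ h1 h2 h3
    have h4 := h1 _ (frontier_subset_closure h2)
    have h5 : R t ≤ R τ := by
      have : w * (τ - t₁) ≤ w * (t - t₁) := 
        mul_le_mul_of_nonneg_left (sub_le_sub_right (le_of_lt h3) _) hw0.le
      simp only [R]; linarith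
    nlinarith)
  have hinn : inner ℝ (γ t - x) v = -(R t * V t p) := by
    rw [← hvν, hνeq, inner_smul_right, hγt, ← mul_assoc, mul_inv_cancel₀ hR0.ne', one_mul,
      ← inner_neg_right, neg_sub, real_inner_comm]
  rw [hinn] at hle
  have := hV t htI p hpf
  nlinarith

/-- Points of `E t₂` are close to points of `E t₁` for `t₁ ≤ t₂`. -/
theorem MovingFamily.exists_mem_closure {c : ℝ} {E : ℝ → Set (Space n)}
    {V : ℝ → Space n → ℝ} (h : MovingFamily c E V) {C₀ : ℝ} (hC₀ : 0 ≤ C₀)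
    (hV : ∀ t ∈ Icc 0 c, ∀ x ∈ frontier (E t), V t x ≤ C₀) {t₁ t₂ : ℝ} (ht₁ : 0 ≤ t₁)
    (ht₂ : t₂ ≤ c) (h12 : t₁ ≤ t₂) {x : Space n} (hx : x ∈ closure (E t₂)) :
    ∃ y ∈ closure (E t₁), ‖y - x‖ ≤ (C₀ + 2) * (t₂ - t₁) := by
  rcases h12.eq_or_lt with rfl | hlt
  · exact ⟨x, hx, by simp⟩
  · by_contra! hall
    exact h.notMem_closure_of_ball hC₀ hV ht₁ ht₂ h12 (by nlinarith [sub_pos.2 hlt]) hall hx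

/-- At the first contact of the complement of `G`, moved by `id + A + t B`, with `E`, the normal
velocities are ordered. -/
theorem exists_first_contact {c : ℝ} {E G : ℝ → Set (Space n)} {V W : ℝ → Space n → ℝ}
    (hE : MovingFamily c E V) (hG : MovingFamily c G W) {A B : Space n → Space n}
    (hA : Differentiable ℝ A) (hB : Differentiable ℝ B)
    (hhalf : ∀ t ∈ Icc 0 c, ∀ y, ‖fderiv ℝ (fun y => A y + t • B y) y‖ ≤ 1 / 2)
    (h0 : ∀ y ∈ closure (G 0)ᶜ, y + A y ∉ closure (E 0))
    {ρ : ℝ} (hρ : ∀ t ∈ Icc 0 c, ∀ y ∈ closure (G t)ᶜ, y + (A y + t • B y) ∈ closure (E t) →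
      ‖y‖ ≤ ρ)
    (hc : ∃ t ∈ Icc 0 c, ∃ y ∈ closure (G t)ᶜ, y + (A y + t • B y) ∈ closure (E t)) :
    ∃ t ∈ Ioc 0 c, ∃ y ∈ frontier (G t), y + (A y + t • B y) ∈ frontier (E t) ∧
      (∀ z ∈ interior (G t)ᶜ, z + (A z + t • B z) ∉ interior (E t)) ∧
      ∃ ν ν' : Space n, IsOuterNormal (G t) y ν ∧
        IsOuterNormal (E t) (y + (A y + t • B y)) ν' ∧ ∃ μ : ℝ, 0 ≤ μ ∧
        (∀ d, inner ℝ (d + fderiv ℝ (fun y => A y + t • B y) y d) ν' = μ * inner ℝ d ν) ∧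
        μ * W t y + inner ℝ (B y) ν' ≤ V t (y + (A y + t • B y)) := by
  let K : Set (Space n × ℝ) := {p | p.2 ∈ Icc 0 c ∧ p.1 ∈ closure (G p.2)ᶜ} ∩
    (fun p => (p.1 + (A p.1 + p.2 • B p.1), p.2)) ⁻¹' {p | p.2 ∈ Icc 0 c ∧ p.1 ∈ closure (E p.2)}
  have hAc := hA.continuous
  have hBc := hB.continuous
  have hKc : IsCompact K := by
    have hsub : K ⊆ Metric.closedBall 0 ρ ×ˢ Icc 0 c := by
      rintro ⟨y, t⟩ ⟨⟨ht, hy⟩, -, hy'⟩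
      exact ⟨by rw [mem_closedBall_zero_iff]; exact hρ t ht y hy hy', ht⟩
    refine ((isCompact_closedBall 0 ρ).prod isCompact_Icc).of_isClosed_subset ?_ hsub
    exact hG.isC1Family.compl.isClosed_closure_track.inter
      (hE.isC1Family.isClosed_closure_track.preimage (by fun_prop))
  have hKne : K.Nonempty := by
    obtain ⟨t, ht, y, hy, hy'⟩ := hc
    exact ⟨(y, t), ⟨ht, hy⟩, ht, hy'⟩
  obtain ⟨⟨y, t⟩, ⟨⟨htI, hyG⟩, -, hyE⟩, hmin⟩ := hKc.exists_isMinOn hKne continuous_snd.continuousOn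
  simp only at htI hyG hyE
  have ht0 : 0 < t := by
    refine lt_of_le_of_ne htI.1 fun heq => ?_
    subst heq
    exact h0 y hyG (by simpa using hyE)
  have ht : t ∈ Ioc 0 c := ⟨ht0, htI.2⟩
  have hearly : ∀ᶠ τ in 𝓝[<] t, ∀ z ∈ closure (G τ)ᶜ, z + (A z + τ • B z) ∉ closure (E τ) := by
    filter_upwards [Ioo_mem_nhdsLT ht0] with τ hτ z hz hz'
    have hτI : τ ∈ Icc 0 c := ⟨hτ.1.le, hτ.2.le.trans htI.2⟩
    have : t ≤ τ := hmin (show (z, τ) ∈ K from ⟨⟨hτI, hz⟩, hτI, hz'⟩)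
    exact absurd hτ.2 this.not_gt
  have hsep : ∀ z ∈ interior (G t)ᶜ, z + (A z + t • B z) ∉ interior (E t) := by
    intro z hz hz'
    have h1 : Tendsto (fun τ : ℝ => z + (A z + τ • B z)) (𝓝[<] t) (𝓝 (z + (A z + t • B z))) :=
      ((by fun_prop : Continuous fun τ : ℝ => z + (A z + τ • B z)).tendsto t).mono_left
        nhdsWithin_le_nhds
    obtain ⟨τ, h2, h3, h4⟩ := ((hE.isC1Family.eventually_left_mem_interior ht hz' h1).and
      ((hG.isC1Family.compl.eventually_left_mem_interior ht hz tendsto_const_nhds).and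
        hearly)).exists
    exact h4 z (subset_closure (interior_subset h3)) (subset_closure (interior_subset h2))
  set Y : Space n → Space n := fun y => A y + t • B y with hY
  have hYd : Differentiable ℝ Y := hA.add (hB.const_smul t)
  obtain ⟨Θ, hΘ⟩ := exists_homeomorph_id_add hYd (hhalf t htI)
  set x := y + Y y with hx
  have hyi : y ∉ interior (G t)ᶜ := by
    intro hyi
    have h1 : Θ '' interior (G t)ᶜ ∈ 𝓝 x := by
      have := (Θ.isOpenMap _ isOpen_interior).mem_nhds (mem_image_of_mem Θ hyi)
      rwa [hΘ] at this
    have h2 : x ∈ closure (interior (E t)) :=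
      hE.isC1Family.closure_subset_closure_interior htI hyE
    obtain ⟨_, ⟨z, hz, rfl⟩, hz'⟩ := mem_closure_iff_nhds.1 h2 _ h1
    rw [hΘ] at hz'
    exact hsep z hz hz'
  have hyf : y ∈ frontier (G t) :=
    mem_frontier_of_notMem_interior (notMem_interior_of_mem_closure_compl hyG) hyi
  have hxi : x ∉ interior (E t) := by
    intro hxi
    have h1 : Θ ⁻¹' interior (E t) ∈ 𝓝 y := by
      refine (isOpen_interior.preimage Θ.continuous).mem_nhds ?_
      show Θ y ∈ interior (E t)
      rwa [hΘ]
    have h2 : y ∈ closure (interior (G t)ᶜ) := hG.isC1Family.closure_compl_subset htI hyG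
    obtain ⟨z, hz, hz'⟩ := mem_closure_iff_nhds.1 h2 _ h1
    have hz2 : Θ z ∈ interior (E t) := hz
    rw [hΘ] at hz2
    exact hsep z hz' hz2
  have hxf : x ∈ frontier (E t) := ⟨hyE, hxi⟩
  refine ⟨t, ht, y, hyf, hxf, hsep, ?_⟩
  obtain ⟨ν, γ, v, hν, hγt, hγ, hγ', hvν⟩ := hG.motion t htI y hyf
  obtain ⟨ν', σ, v', hν', hσt, hσ, hσ', hvν'⟩ := hE.motion t htI x hxf
  set D := fderiv ℝ Y y with hD
  have hYy : HasFDerivAt Y D y := (hYd y).hasFDerivAt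
  -- the tangent planes correspond under the derivative of the deformation
  have hside : ∀ d, 0 < inner ℝ d ν → 0 ≤ inner ℝ (d + D d) ν' := by
    intro d hd
    by_contra! hneg
    have h1 := hν.eventually_ray_compl hd
    have h2 : Tendsto (fun ε : ℝ => d + ε⁻¹ • (Y (y + ε • d) - Y y)) (𝓝[>] 0) (𝓝 (d + D d)) := by
      have hline : HasDerivAt (fun ε : ℝ => Y (y + ε • d)) (D d) 0 := by
        have h1 : HasDerivAt (fun ε : ℝ => y + ε • d) d 0 := by
          simpa using ((hasDerivAt_id (0 : ℝ)).smul_const d).const_add y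
        have h2 : HasFDerivAt Y D (y + (0 : ℝ) • d) := by simpa using hYy
        exact h2.comp_hasDerivAt (0 : ℝ) h1
      have h3 := hline.hasDerivWithinAt (s := Ioi 0)
      rw [hasDerivWithinAt_iff_tendsto_slope' (by simp)] at h3
      refine tendsto_const_nhds.add (h3.congr fun ε => ?_)
      rw [slope_def_module]; simp
    have h3 := hν'.eventually_mem_interior eventually_mem_nhdsWithin tendsto_id_nhdsGT_zero h2 hneg
    obtain ⟨ε, h4, h5, h6⟩ := (h1.and (h3.and self_mem_nhdsWithin)).exists
    have h6' : ε ≠ 0 := ne_of_gt h6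
    refine hsep _ h4 ?_
    rw [smul_add, smul_smul, mul_inv_cancel₀ h6', one_smul] at h5
    have : y + ε • d + (A (y + ε • d) + t • B (y + ε • d)) =
        x + (ε • d + (Y (y + ε • d) - Y y)) := by
      rw [hx]; simp only [hY]; abel
    rw [this]
    exact h5
  let l : Space n →L[ℝ] ℝ := (innerSL ℝ ν').comp (ContinuousLinearMap.id ℝ (Space n) + D)
  have hl : ∀ d, l d = inner ℝ (d + D d) ν' := by
    intro d
    simp only [l, ContinuousLinearMap.comp_apply, innerSL_apply_apply, add_apply,
      ContinuousLinearMap.id_apply]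
    exact real_inner_comm _ _
  have hlμ := eq_mul_inner_of_nonneg_on_halfspace hν.1 l (fun d hd => by rw [hl]; exact hside d hd)
  have hνν : inner ℝ ν ν = (1 : ℝ) := by rw [real_inner_self_eq_norm_sq, hν.1]; norm_num
  have hμ0 : 0 ≤ l ν := by
    rw [hl]; exact hside ν (by rw [hνν]; norm_num)
  refine ⟨ν, ν', hν, hν', l ν, hμ0, fun d => by rw [← hl, hlμ d], ?_⟩
  -- a defining function of `E` near the contact point
  obtain ⟨u, hu, hne, hev⟩ := hE.isC1Family.exists_sign htI x
  have hud : HasFDerivAt u (fderiv ℝ u (x, t)) (x, t) :=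
    (hu.differentiable (by norm_num) (x, t)).hasFDerivAt
  have hev0 := hev.self_of_nhdsWithin (show (x, t) ∈ univ ×ˢ Icc 0 c from ⟨mem_univ _, htI⟩)
  have hu0 : u (x, t) = 0 := by
    apply le_antisymm
    · by_contra! hlt
      exact notMem_interior_compl_of_mem_closure hyE (hev0.2 hlt)
    · by_contra! hlt
      exact hxi (hev0.1 hlt)
  let m : Space n →L[ℝ] ℝ := (fderiv ℝ u (x, t)).comp (ContinuousLinearMap.inl ℝ (Space n) ℝ)
  have hm : HasFDerivAt (fun z => u (z, t)) m x := by
    have h1 : HasFDerivAt (fun z : Space n => (z, t)) (ContinuousLinearMap.inl ℝ (Space n) ℝ) x :=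
      hasFDerivAt_prodMk_left x t
    exact hud.comp x h1
  have hmne : m ≠ 0 := by
    have := hne hu0
    rwa [hm.fderiv] at this
  have hmside : ∀ d, 0 < inner ℝ d ν' → 0 ≤ m d := by
    intro d hd
    have hline : HasDerivAt (fun ε : ℝ => u (x + ε • d, t)) (m d) 0 := by
      have h1 : HasDerivAt (fun ε : ℝ => x + ε • d) d 0 := by
        simpa using ((hasDerivAt_id (0 : ℝ)).smul_const d).const_add x
      have h2 : HasFDerivAt (fun z => u (z, t)) m (x + (0 : ℝ) • d) := by simpa using hm
      have h3 := h2.comp_hasDerivAt (0 : ℝ) h1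
      exact h3
    have h3 := hline.hasDerivWithinAt (s := Ioi 0)
    rw [hasDerivWithinAt_iff_tendsto_slope' (by simp)] at h3
    refine ge_of_tendsto h3 ?_
    have hlim : Tendsto (fun ε : ℝ => x + ε • d) (𝓝[>] 0) (𝓝 x) := by
      simpa using tendsto_const_nhds.add (tendsto_id_nhdsGT_zero.smul_const d)
    filter_upwards [hν'.eventually_ray_compl hd, self_mem_nhdsWithin,
      hlim.eventually ((tendsto_prodMk_right_nhdsWithin htI x).eventually hev)] with ε h4 h5 h6
    have h5' : 0 < ε := h5
    have h7 : 0 ≤ u (x + ε • d, t) := by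
      by_contra! hlt
      exact interior_subset h4 (interior_subset (h6.1 hlt))
    rw [slope_def_field, zero_smul, add_zero, hu0, sub_zero, sub_zero]
    positivity
  have hmeq := eq_mul_inner_of_nonneg_on_halfspace hν'.1 m hmside
  have hν'ν' : inner ℝ ν' ν' = (1 : ℝ) := by rw [real_inner_self_eq_norm_sq, hν'.1]; norm_num
  have hmpos : 0 < m ν' := by
    refine lt_of_le_of_ne (hmside ν' (by rw [hν'ν']; norm_num)) fun h => hmne ?_
    ext d
    rw [hmeq d, ← h, zero_mul]; rfl
  have hsplit : ∀ (w : Space n), fderiv ℝ u (x, t) (w, 1) = m w + fderiv ℝ u (x, t) (0, 1) := by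
    intro w
    rw [show m w = fderiv ℝ u (x, t) (w, 0) from rfl, ← map_add]
    simp
  have hcomp : ∀ (f : ℝ → Space n) (w : Space n), f t = x → HasDerivWithinAt f w (Icc 0 c) t →
      HasDerivWithinAt (fun τ => u (f τ, τ)) (fderiv ℝ u (x, t) (w, 1)) (Icc 0 c) t := by
    intro f w hf hfd
    have h1 : HasDerivWithinAt (fun τ => (f τ, τ)) (w, 1) (Icc 0 c) t :=
      hfd.prodMk (hasDerivWithinAt_id t _)
    have h2 : HasFDerivAt u (fderiv ℝ u (x, t)) (f t, t) := by rw [hf]; exact hud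
    have h3 := HasFDerivAt.comp_hasDerivWithinAt (f := fun τ => (f τ, τ)) t h2 h1
    exact h3
  have hnear : ∀ f : ℝ → Space n, f t = x → ContinuousWithinAt f (Icc 0 c) t →
      ∀ᶠ τ in 𝓝[<] t, (u (f τ, τ) < 0 → f τ ∈ interior (E τ)) ∧
        (0 < u (f τ, τ) → f τ ∈ interior (E τ)ᶜ) := by
    intro f hf hfc
    have h1 : Tendsto (fun τ => (f τ, τ)) (𝓝[Icc 0 c] t) (𝓝[univ ×ˢ Icc 0 c] (x, t)) := by
      refine tendsto_nhdsWithin_iff.2 ⟨?_, ?_⟩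
      · rw [← hf]
        exact Tendsto.prodMk_nhds hfc (tendsto_id.mono_left nhdsWithin_le_nhds)
      · filter_upwards [self_mem_nhdsWithin] with τ hτ using ⟨mem_univ _, hτ⟩
    exact nhdsLT_le_nhdsWithin_Icc ht (h1.eventually hev)
  have hσu : fderiv ℝ u (x, t) (v', 1) = 0 := by
    have hd1 := hcomp σ v' hσt hσ'
    have hz : ∀ᶠ τ in 𝓝[<] t, u (σ τ, τ) = 0 := by
      filter_upwards [hnear σ hσt hσ'.continuousWithinAt, nhdsLT_le_nhdsWithin_Icc ht hσ]
        with τ h1 h2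
      apply le_antisymm
      · by_contra! hlt
        exact notMem_interior_compl_of_mem_closure (frontier_subset_closure h2) (h1.2 hlt)
      · by_contra! hlt
        exact h2.2 (h1.1 hlt)
    have h1 := deriv_nonpos_of_nonneg_left ht hd1 (by simp only [hσt, hu0])
      (hz.mono fun τ hτ => hτ.ge)
    have h2 := deriv_nonpos_of_nonneg_left ht hd1.neg (by simp [hσt, hu0])
      (hz.mono fun τ hτ => by simp [hτ])
    linarith
  have hγc := hγ'.continuousWithinAt
  have hfd : HasDerivWithinAt (fun τ => γ τ + (A (γ τ) + τ • B (γ τ))) (v + (D v + B y))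
      (Icc 0 c) t := by
    have hAy : HasFDerivAt A (fderiv ℝ A y) (γ t) := by rw [hγt]; exact (hA y).hasFDerivAt
    have hBy : HasFDerivAt B (fderiv ℝ B y) (γ t) := by rw [hγt]; exact (hB y).hasFDerivAt
    have h1 := hAy.comp_hasDerivWithinAt t hγ'
    have h2 := hBy.comp_hasDerivWithinAt t hγ'
    have h3 := (hasDerivWithinAt_id t (Icc 0 c)).smul h2
    have hDv : D v = fderiv ℝ A y v + t • fderiv ℝ B y v := by
      have : D = fderiv ℝ A y + t • fderiv ℝ B y :=
        ((hA y).hasFDerivAt.add ((hB y).hasFDerivAt.const_smul t)).fderiv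
      rw [this]; rfl
    refine (hγ'.add (h1.add h3)).congr_deriv ?_
    rw [hDv]
    simp [hγt, add_assoc]
  have hfu : fderiv ℝ u (x, t) (v + (D v + B y), 1) ≤ 0 := by
    have hf0 : γ t + (A (γ t) + t • B (γ t)) = x := by rw [hγt]
    refine deriv_nonpos_of_nonneg_left ht
      (hcomp (fun τ => γ τ + (A (γ τ) + τ • B (γ τ))) _ hf0 hfd) (by rw [hf0, hu0]) ?_
    filter_upwards [hnear _ hf0 hfd.continuousWithinAt, hearly, nhdsLT_le_nhdsWithin_Icc ht hγ]
      with τ h1 h2 h3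
    by_contra! hlt
    have h4 : γ τ ∈ closure (G τ)ᶜ := by
      rw [← frontier_compl] at h3
      exact frontier_subset_closure h3
    exact h2 _ h4 (subset_closure (interior_subset (h1.1 hlt)))
  rw [hsplit] at hfu hσu
  have hfin : m (v + (D v + B y)) ≤ m v' := by linarith
  rw [hmeq (v + (D v + B y)), hmeq v'] at hfin
  have hfin' := le_of_mul_le_mul_left hfin hmpos
  rw [hvν', ← add_assoc, inner_add_left, ← hl, hlμ, hvν] at hfin'
  exact hfin'

/-- The function `(1 + (q ‖y - p‖)²)⁻¹`. -/
def bump (q : ℝ) (p y : Space n) : ℝ := (1 + (q * ‖y - p‖) ^ 2)⁻¹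

theorem bump_pos (q : ℝ) (p y : Space n) : 0 < bump q p y := by
  unfold bump; positivity

theorem bump_le_one (q : ℝ) (p y : Space n) : bump q p y ≤ 1 :=
  inv_le_one_of_one_le₀ (by nlinarith [sq_nonneg (q * ‖y - p‖)])

theorem bump_mul (q : ℝ) (p y : Space n) : bump q p y * (1 + (q * ‖y - p‖) ^ 2) = 1 :=
  inv_mul_cancel₀ (by positivity)

theorem mul_bump_le (q : ℝ) (p y : Space n) : q * ‖y - p‖ * bump q p y ≤ 1 / 2 := by
  have h := bump_mul q p y
  have h0 := bump_pos q p y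
  nlinarith [sq_nonneg (q * ‖y - p‖ - 1)]

theorem sq_mul_bump_le (q : ℝ) (p y : Space n) : (q * ‖y - p‖) ^ 2 * bump q p y ≤ 1 := by
  have h := bump_mul q p y
  have h0 := bump_pos q p y
  nlinarith

theorem hasFDerivAt_bump (q : ℝ) (p y : Space n) :
    HasFDerivAt (bump q p) ((-(2 * q ^ 2) * bump q p y ^ 2) • innerSL ℝ (y - p)) y := by
  have h1 : HasFDerivAt (fun y => ‖y - p‖ ^ 2) (2 • innerSL ℝ (y - p)) y := by
    have := ((hasFDerivAt_id y).sub_const p).norm_sq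
    simpa using this
  have h2 : HasFDerivAt (fun y => 1 + (q * ‖y - p‖) ^ 2) (q ^ 2 • (2 • innerSL ℝ (y - p))) y := by
    have := (h1.const_mul (q ^ 2)).const_add 1
    simpa only [mul_pow] using this
  have hne : 1 + (q * ‖y - p‖) ^ 2 ≠ 0 := by positivity
  have h3 := (hasDerivAt_inv hne).comp_hasFDerivAt y h2
  refine h3.congr_fderiv ?_
  ext v
  simp only [bump, smul_apply, smul_eq_mul, nsmul_eq_mul]
  push_cast
  field_simp

theorem norm_fderiv_bump_le {q : ℝ} (hq : 0 ≤ q) (p y : Space n) :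
    ‖fderiv ℝ (bump q p) y‖ ≤ q := by
  rw [(hasFDerivAt_bump q p y).fderiv, norm_smul, innerSL_apply_norm, norm_mul, norm_neg,
    Real.norm_of_nonneg (by positivity), Real.norm_of_nonneg (by positivity)]
  have h1 := mul_bump_le q p y
  have h2 := bump_le_one q p y
  have h3 := bump_pos q p y
  have h4 : 0 ≤ q * ‖y - p‖ * bump q p y := by positivity
  calc 2 * q ^ 2 * bump q p y ^ 2 * ‖y - p‖ = 2 * q * (q * ‖y - p‖ * bump q p y) * bump q p y := by
        ring
    _ ≤ 2 * q * (1 / 2) * 1 := by gcongr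
    _ = q := by ring

theorem abs_bump_sub_le_mul {q : ℝ} (hq : 0 ≤ q) (p y y' : Space n) :
    |bump q p y - bump q p y'| ≤ q * ‖y - y'‖ :=
  convex_univ.norm_image_sub_le_of_norm_fderiv_le (𝕜 := ℝ)
    (fun x _ => (hasFDerivAt_bump q p x).differentiableAt) (fun x _ => norm_fderiv_bump_le hq p x)
    (mem_univ y') (mem_univ y)

theorem abs_bump_sub_le_rpow {q s : ℝ} (hq : 0 ≤ q) (hs : s ∈ Ioo (0 : ℝ) 1) (p y y' : Space n) :
    |bump q p y - bump q p y'| ≤ q ^ (s / 2) * ‖y - y'‖ ^ (s / 2) := by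
  rw [← Real.mul_rpow hq (norm_nonneg _)]
  have hs0 := hs.1
  have hs1 := hs.2
  rcases le_total (q * ‖y - y'‖) 1 with h | h
  · refine (abs_bump_sub_le_mul hq p y y').trans ?_
    have := Real.rpow_le_rpow_of_exponent_ge' (by positivity) h (by linarith : 0 ≤ s / 2)
      (by linarith : s / 2 ≤ 1)
    rwa [Real.rpow_one] at this
  · refine le_trans ?_ (Real.one_le_rpow h (by linarith))
    rw [abs_le]
    constructor <;> linarith [bump_pos q p y, bump_pos q p y', bump_le_one q p y,
      bump_le_one q p y']

theorem norm_fderiv_bump_sub_le {q : ℝ} (hq : 0 ≤ q) (p y y' : Space n) :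
    ‖fderiv ℝ (bump q p) y - fderiv ℝ (bump q p) y'‖ ≤ 10 * q ^ 2 * ‖y - y'‖ := by
  set b := bump q p y with hb
  set b' := bump q p y' with hb'
  have hb0 := bump_pos q p y
  have hb1 := bump_le_one q p y
  have hb0' := bump_pos q p y'
  have hb1' := bump_le_one q p y'
  rw [← hb] at hb0 hb1
  rw [← hb'] at hb0' hb1'
  have e1 : fderiv ℝ (bump q p) y - fderiv ℝ (bump q p) y' =
      (-(2 * q ^ 2)) • (innerSL ℝ (b ^ 2 • (y - y') + (b ^ 2 - b' ^ 2) • (y' - p))) := by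
    rw [(hasFDerivAt_bump q p y).fderiv, (hasFDerivAt_bump q p y').fderiv]
    ext v
    simp only [sub_apply, smul_apply, innerSL_apply_apply, inner_add_left,
      inner_smul_left, RCLike.conj_to_real, smul_eq_mul, ← hb, ← hb', inner_sub_left]
    ring
  rw [e1, norm_smul, innerSL_apply_norm, norm_neg, Real.norm_of_nonneg (by positivity)]
  have hr : |‖y' - p‖ - ‖y - p‖| ≤ ‖y - y'‖ := by
    have := abs_norm_sub_norm_le (y' - p) (y - p)
    rwa [sub_sub_sub_cancel_right, norm_sub_rev y' y] at this
  have h1 : (b - b') * ‖y' - p‖ = (‖y' - p‖ - ‖y - p‖) *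
      ((q * ‖y' - p‖) ^ 2 * b' * b + (q * ‖y - p‖ * b) * (q * ‖y' - p‖ * b')) := by
    have h2 := bump_mul q p y
    have h3 := bump_mul q p y'
    rw [← hb] at h2
    rw [← hb'] at h3
    have h4 : b - b' = b * b' * ((q * ‖y' - p‖) ^ 2 - (q * ‖y - p‖) ^ 2) := by
      linear_combination b' * h2 - b * h3
    rw [h4]; ring
  have h2 : |b - b'| * ‖y' - p‖ ≤ 2 * ‖y - y'‖ := by
    rw [← abs_of_nonneg (norm_nonneg (y' - p)), ← abs_mul, h1, abs_mul, mul_comm]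
    have h3 := sq_mul_bump_le q p y'
    have h4 := mul_bump_le q p y
    have h5 := mul_bump_le q p y'
    rw [← hb'] at h3 h5
    rw [← hb] at h4
    have h6 : 0 ≤ q * ‖y - p‖ * b := by positivity
    have h7 : 0 ≤ q * ‖y' - p‖ * b' := by positivity
    have h8 : 0 ≤ (q * ‖y' - p‖) ^ 2 * b' := by positivity
    rw [abs_of_nonneg (by positivity)]
    gcongr
    nlinarith
  have h3 : |b ^ 2 - b' ^ 2| * ‖y' - p‖ ≤ 4 * ‖y - y'‖ := by
    rw [sq_sub_sq, abs_mul, mul_assoc]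
    have : |b + b'| ≤ 2 := by rw [abs_of_nonneg (by positivity)]; linarith
    calc _ ≤ 2 * (2 * ‖y - y'‖) := by gcongr
      _ = _ := by ring
  have h4 : ‖b ^ 2 • (y - y') + (b ^ 2 - b' ^ 2) • (y' - p)‖ ≤ 5 * ‖y - y'‖ := by
    refine (norm_add_le _ _).trans ?_
    rw [norm_smul, norm_smul, Real.norm_of_nonneg (by positivity), Real.norm_eq_abs]
    have : b ^ 2 * ‖y - y'‖ ≤ 1 * ‖y - y'‖ := by
      gcongr
      exact pow_le_one₀ hb0.le hb1
    linarith
  calc 2 * q ^ 2 * _ ≤ 2 * q ^ 2 * (5 * ‖y - y'‖) := by gcongr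
    _ = _ := by ring

/-- A field with bounded derivatives. -/
structure BoundedField (M : ℝ) (X : Space n → Space n) : Prop where
  diff : Differentiable ℝ X
  norm_le : ∀ x, ‖X x‖ ≤ M
  fderiv_le : ∀ x, ‖fderiv ℝ X x‖ ≤ M
  lip : ∀ x x', ‖fderiv ℝ X x - fderiv ℝ X x'‖ ≤ M * ‖x - x'‖

theorem BoundedField.sub_le {M : ℝ} {X : Space n → Space n} (h : BoundedField M X)
    (x x' : Space n) : ‖X x - X x'‖ ≤ M * ‖x - x'‖ :=
  convex_univ.norm_image_sub_le_of_norm_fderiv_le (𝕜 := ℝ) (fun x _ => h.diff x)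
    (fun x _ => h.fderiv_le x) (mem_univ _) (mem_univ _)

/-- A function which is small, together with its derivatives, as seen from `y₀`. -/
structure SmallFun (s N : ℝ) (θ : Space n → ℝ) (y₀ : Space n) : Prop where
  diff : Differentiable ℝ θ
  fderiv_le : ∀ y, ‖fderiv ℝ θ y‖ ≤ N
  lip : ∀ y y', ‖fderiv ℝ θ y - fderiv ℝ θ y'‖ ≤ N * ‖y - y'‖
  growth : ∀ z, |θ (y₀ + z)| ≤ N * (1 + ‖z‖ ^ (s / 2))

theorem norm_fderiv_smul_le {M N b : ℝ} {θ : Space n → ℝ} {X : Space n → Space n}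
    (hX : BoundedField M X) (hθ : Differentiable ℝ θ) {y : Space n} (hN : ‖fderiv ℝ θ y‖ ≤ N)
    (hb : |θ y| ≤ b) : ‖fderiv ℝ (fun y => θ y • X y) y‖ ≤ M * (N + b) := by
  have hM : 0 ≤ M := (norm_nonneg _).trans (hX.norm_le 0)
  have hfd : fderiv ℝ (fun y => θ y • X y) y = θ y • fderiv ℝ X y +
      (fderiv ℝ θ y).smulRight (X y) := ((hθ y).hasFDerivAt.smul (hX.diff y).hasFDerivAt).fderiv
  rw [hfd]
  refine (norm_add_le _ _).trans ?_
  rw [norm_smul, ContinuousLinearMap.norm_smulRight_apply, Real.norm_eq_abs]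
  have h1 : |θ y| * ‖fderiv ℝ X y‖ ≤ b * M :=
    mul_le_mul hb (hX.fderiv_le y) (norm_nonneg _) ((abs_nonneg _).trans hb)
  have h2 : ‖fderiv ℝ θ y‖ * ‖X y‖ ≤ N * M :=
    mul_le_mul hN (hX.norm_le y) (norm_nonneg _) ((norm_nonneg _).trans hN)
  linarith

theorem SmallFun.smallField {s M N b : ℝ} {θ : Space n → ℝ} {X : Space n → Space n} {y₀ : Space n}
    (hs : 0 < s) (hX : BoundedField M X) (hθ : SmallFun s N θ y₀) (hb : ∀ y, |θ y| ≤ b)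
    (hsmall : M * (N + b) ≤ 1 / 2) : SmallField s (5 * M * N) (fun y => θ y • X y) y₀ := by
  have hM : 0 ≤ M := (norm_nonneg _).trans (hX.norm_le 0)
  have hN : 0 ≤ N := (norm_nonneg _).trans (hθ.fderiv_le 0)
  have hMN : 0 ≤ M * N := by positivity
  have hθL : ∀ y y', |θ y - θ y'| ≤ N * ‖y - y'‖ := fun y y' =>
    convex_univ.norm_image_sub_le_of_norm_fderiv_le (𝕜 := ℝ) (fun x _ => hθ.diff x)
      (fun x _ => hθ.fderiv_le x) (mem_univ _) (mem_univ _)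
  have hfd : ∀ y, fderiv ℝ (fun y => θ y • X y) y =
      θ y • fderiv ℝ X y + (fderiv ℝ θ y).smulRight (X y) := fun y =>
    ((hθ.diff y).hasFDerivAt.smul (hX.diff y).hasFDerivAt).fderiv
  have hs2 : s / 2 ≠ 0 := by positivity
  refine ⟨hθ.diff.smul hX.diff, fun y => ?_, fun y y' hy hy' => ?_, fun z => ?_, fun z => ?_⟩
  · exact (norm_fderiv_smul_le hX hθ.diff (hθ.fderiv_le y) (hb y)).trans hsmall
  · have h1 : |θ y'| ≤ 2 * N := by
      have h2 := hθ.growth (y' - y₀)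
      rw [add_sub_cancel] at h2
      have h3 : ‖y' - y₀‖ ^ (s / 2) ≤ 1 := Real.rpow_le_one (norm_nonneg _) hy' (by linarith)
      nlinarith
    have e : fderiv ℝ (fun y => θ y • X y) y - fderiv ℝ (fun y => θ y • X y) y' =
        ((θ y - θ y') • fderiv ℝ X y + θ y' • (fderiv ℝ X y - fderiv ℝ X y')) +
        ((fderiv ℝ θ y - fderiv ℝ θ y').smulRight (X y) +
          (fderiv ℝ θ y').smulRight (X y - X y')) := by
      rw [hfd, hfd]
      ext v : 1
      simp only [sub_apply, add_apply, smul_apply, ContinuousLinearMap.smulRight_apply]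
      module
    rw [e]
    have b1 : ‖(θ y - θ y') • fderiv ℝ X y‖ ≤ N * ‖y - y'‖ * M := by
      rw [norm_smul, Real.norm_eq_abs]
      exact mul_le_mul (hθL y y') (hX.fderiv_le y) (norm_nonneg _) (by positivity)
    have b2 : ‖θ y' • (fderiv ℝ X y - fderiv ℝ X y')‖ ≤ 2 * N * (M * ‖y - y'‖) := by
      rw [norm_smul, Real.norm_eq_abs]
      exact mul_le_mul h1 (hX.lip y y') (norm_nonneg _) (by positivity)
    have b3 : ‖(fderiv ℝ θ y - fderiv ℝ θ y').smulRight (X y)‖ ≤ N * ‖y - y'‖ * M := by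
      rw [ContinuousLinearMap.norm_smulRight_apply]
      exact mul_le_mul (hθ.lip y y') (hX.norm_le y) (norm_nonneg _) (by positivity)
    have b4 : ‖(fderiv ℝ θ y').smulRight (X y - X y')‖ ≤ N * (M * ‖y - y'‖) := by
      rw [ContinuousLinearMap.norm_smulRight_apply]
      exact mul_le_mul (hθ.fderiv_le y') (hX.sub_le y y') (norm_nonneg _) hN
    refine (norm_add_le _ _).trans ?_
    have := add_le_add ((norm_add_le _ _).trans (add_le_add b1 b2))
      ((norm_add_le _ _).trans (add_le_add b3 b4))
    refine this.trans (le_of_eq ?_)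
    ring
  · have h1 := norm_fderiv_smul_le hX hθ.diff (hθ.fderiv_le (y₀ + z)) (hθ.growth z)
    refine h1.trans ?_
    have h2 : 0 ≤ ‖z‖ ^ (s / 2) := by positivity
    nlinarith [mul_nonneg hMN h2]
  · have e : θ (y₀ + z) • X (y₀ + z) - θ y₀ • X y₀ =
        (θ (y₀ + z) - θ y₀) • X (y₀ + z) + θ y₀ • (X (y₀ + z) - X y₀) := by module
    rw [e]
    have h0 : |θ y₀| ≤ N := by
      have := hθ.growth 0
      rwa [add_zero, norm_zero, Real.zero_rpow hs2, add_zero, mul_one] at this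
    have b1 : ‖(θ (y₀ + z) - θ y₀) • X (y₀ + z)‖ ≤ N * ‖z‖ * M := by
      rw [norm_smul, Real.norm_eq_abs]
      refine mul_le_mul ?_ (hX.norm_le _) (norm_nonneg _) (by positivity)
      simpa using hθL (y₀ + z) y₀
    have b2 : ‖θ y₀ • (X (y₀ + z) - X y₀)‖ ≤ N * (M * ‖z‖) := by
      rw [norm_smul, Real.norm_eq_abs]
      refine mul_le_mul h0 ?_ (norm_nonneg _) hN
      simpa using hX.sub_le (y₀ + z) y₀
    refine (norm_add_le _ _).trans ((add_le_add b1 b2).trans ?_)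
    nlinarith [mul_nonneg hMN (norm_nonneg z)]

/-- Flatness at all boundary points, with the same constants. -/
def UnifFlat (r K : ℝ) (A : Set (Space n)) : Prop := ∀ p ∈ frontier A, ∃ ν, FlatAt r K A p ν

/-- The field `X` points outwards along the boundary of `A`, uniformly. -/
def Transversal (κ : ℝ) (X : Space n → Space n) (A : Set (Space n)) : Prop :=
  ∀ p ∈ frontier A, ∀ ν, IsOuterNormal A p ν → κ ≤ inner ℝ (X p) ν

theorem exists_mem_segment_frontier {A : Set (Space n)} {x y : Space n} (hx : x ∈ closure A)
    (hy : y ∈ closure Aᶜ) : ∃ p ∈ segment ℝ y x, p ∈ frontier A := by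
  by_contra! hno
  have hsub : segment ℝ y x ⊆ interior A ∪ interior Aᶜ := by
    intro p hp
    by_contra hp'
    rw [mem_union, not_or] at hp'
    exact hno p hp (mem_frontier_of_notMem_interior hp'.1 hp'.2)
  obtain ⟨p, -, hp1, hp2⟩ := (convex_segment y x).isPreconnected _ _ isOpen_interior isOpen_interior
    hsub ⟨x, right_mem_segment ℝ y x, (hsub (right_mem_segment ℝ y x)).resolve_right
      (notMem_interior_compl_of_mem_closure hx)⟩
    ⟨y, left_mem_segment ℝ y x, (hsub (left_mem_segment ℝ y x)).resolve_left
      (notMem_interior_of_mem_closure_compl hy)⟩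
  exact interior_subset hp2 (interior_subset hp1)

/-- Moving from outside of `A` along a transversal field does not lead back to `A`. -/
theorem false_of_transversal {r K κ M l D D' : ℝ} {A : Set (Space n)} {X : Space n → Space n}
    (hr : 0 < r) (hK : 0 ≤ K) (hA : UnifFlat r K A) (hX : BoundedField M X)
    (htr : Transversal κ X A) {x y y' : Space n} (hx : x ∈ closure A) (hy' : y' ∈ closure Aᶜ)
    (hl : 0 ≤ l) (hxy : ‖x - y' - l • X y‖ ≤ D) (hyy : ‖y - y'‖ ≤ D') (hlr : D + l * M < r)
    (hlt : D + 2 * K * (D + l * M) ^ 2 < l * (κ - M * (D + l * M + D'))) : False := by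
  have hM : 0 ≤ M := (norm_nonneg _).trans (hX.norm_le 0)
  have hD : 0 ≤ D := (norm_nonneg _).trans hxy
  obtain ⟨p, hp, hpA⟩ := exists_mem_segment_frontier hx hy'
  have hl1 : ‖x - y'‖ ≤ D + l * M := by
    have h1 := norm_add_le (x - y' - l • X y) (l • X y)
    rw [sub_add_cancel, norm_smul, Real.norm_of_nonneg hl] at h1
    have h2 := mul_le_mul_of_nonneg_left (hX.norm_le y) hl
    linarith
  obtain ⟨τ, hτ, rfl⟩ := (segment_eq_image' ℝ y' x).subset hp
  simp only at hpA
  set p := y' + τ • (x - y') with hpdef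
  have hxp : ‖x - p‖ ≤ D + l * M := by
    have e : x - p = (1 - τ) • (x - y') := by rw [hpdef]; module
    rw [e, norm_smul, Real.norm_of_nonneg (by linarith [hτ.2])]
    nlinarith [norm_nonneg (x - y'), hτ.1]
  have hyp : ‖y' - p‖ ≤ D + l * M := by
    have e : y' - p = (-τ) • (x - y') := by rw [hpdef]; module
    rw [e, norm_smul, norm_neg, Real.norm_of_nonneg hτ.1]
    nlinarith [norm_nonneg (x - y'), hτ.2]
  obtain ⟨ν, hν⟩ := hA p hpA
  have h1 := hν.inner_le_of_mem_closure hx (hxp.trans_lt hlr)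
  have h2 := hν.le_inner_of_mem_closure_compl hy' (hyp.trans_lt hlr)
  have h3 : K * ‖x - p‖ ^ 2 ≤ K * (D + l * M) ^ 2 := by gcongr
  have h4 : K * ‖y' - p‖ ^ 2 ≤ K * (D + l * M) ^ 2 := by gcongr
  have h5 : inner ℝ (x - y') ν = inner ℝ (x - p) ν - inner ℝ (y' - p) ν := by
    rw [← inner_sub_left]; congr 1; module
  have h6 := htr p hpA ν (hν.isOuterNormal hr)
  have h7 : inner ℝ (x - y') ν = inner ℝ (x - y' - l • X y) ν + l * inner ℝ (X p) ν +
      l * inner ℝ (X y - X p) ν := by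
    simp only [inner_sub_left, inner_smul_left, RCLike.conj_to_real]; ring
  have h8 : -D ≤ inner ℝ (x - y' - l • X y) ν := by
    have := (abs_le.1 (abs_real_inner_le_norm (x - y' - l • X y) ν)).1
    rw [hν.1, mul_one] at this
    linarith
  have h9 : -(M * (D + l * M + D')) ≤ inner ℝ (X y - X p) ν := by
    have e := (abs_le.1 (abs_real_inner_le_norm (X y - X p) ν)).1
    rw [hν.1, mul_one] at e
    have h10 : ‖y - p‖ ≤ D + l * M + D' := by
      have := norm_add_le (y - y') (y' - p)
      rw [sub_add_sub_cancel] at this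
      linarith
    have := (hX.sub_le y p).trans (mul_le_mul_of_nonneg_left h10 hM)
    linarith
  have h10 := mul_le_mul_of_nonneg_left h6 hl
  have h11 := mul_le_mul_of_nonneg_left h9 hl
  nlinarith

/-- Perturbing a set by a field of size `N` lowers the curvature by at most `C * N`. -/
def IsPerturbationConst (n : ℕ) (s r K C : ℝ) : Prop :=
  ∀ (G A : Set (Space n)) (Y : Space n → Space n) (y₀ ν ν' : Space n) (N : ℝ),
    FlatAt r K G y₀ ν → FlatAt r K A (y₀ + Y y₀) ν' → volume (frontier G) = 0 →
    volume (frontier A) = 0 → SmallField s N Y y₀ →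
    (∀ y ∈ interior Gᶜ, y + Y y ∉ interior A) →
    fracMeanCurv s G y₀ - C * N ≤ fracMeanCurv s A (y₀ + Y y₀)

/-- Comparison of a family `E` moving by curvature with a family `G` moved along a field. -/
theorem notMem_closure_of_barrier {s r K C₀ C κ M N₁ b c : ℝ} {E G : ℝ → Set (Space n)}
    {W : ℝ → Space n → ℝ} {X : Space n → Space n} {θ₀ θ₁ : Space n → ℝ}
    (hs : s ∈ Ioo (0 : ℝ) 1) (hr : 0 < r) (hK : 0 ≤ K) (hC₀ : 0 ≤ C₀)
    (hCP : IsPerturbationConst n s r K C)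
    (hE : MovingFamily c E fun t x => -fracMeanCurv s (E t) x) (hG : MovingFamily c G W)
    (hEf : ∀ t ∈ Icc 0 c, UnifFlat r K (E t)) (hGf : ∀ t ∈ Icc 0 c, UnifFlat r K (G t))
    (hW : ∀ t ∈ Icc 0 c, ∀ y ∈ frontier (G t), |W t y| ≤ C₀) (hX : BoundedField M X)
    (htr : ∀ t ∈ Icc 0 c, Transversal κ X (G t)) (hθ₀ : Differentiable ℝ θ₀)
    (hθ₁ : Differentiable ℝ θ₁) (hκ : 0 < κ) (hN₁ : M * (N₁ + b) ≤ 1 / 2)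
    (hN₁κ : M * (N₁ + b) * (κ + M) ≤ κ / 2)
    (hb : ∀ t ∈ Icc 0 c, ∀ y, |θ₀ y + t * θ₁ y| ≤ b)
    (hfd : ∀ t ∈ Icc 0 c, ∀ y, ‖fderiv ℝ (fun y => θ₀ y + t * θ₁ y) y‖ ≤ N₁)
    (hθ : ∀ t ∈ Icc 0 c, ∀ y₀ ∈ frontier (G t), ∃ N ≤ N₁,
      SmallFun s N (fun y => θ₀ y + t * θ₁ y) y₀ ∧
      ∀ k ∈ Icc (κ / 2) M, 5 * M * N * (C₀ + C) <
        θ₁ y₀ * k + (W t y₀ + fracMeanCurv s (G t) y₀))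
    (h0 : ∀ y ∈ closure (G 0)ᶜ, y + θ₀ y • X y ∉ closure (E 0)) {ρ : ℝ}
    (hρ : ∀ t ∈ Icc 0 c, ∀ y ∈ closure (G t)ᶜ, y + (θ₀ y + t * θ₁ y) • X y ∈ closure (E t) →
      ‖y‖ ≤ ρ) {t : ℝ} (ht : t ∈ Icc 0 c) {y : Space n} (hy : y ∈ closure (G t)ᶜ) :
    y + (θ₀ y + t * θ₁ y) • X y ∉ closure (E t) := by
  have hM : 0 ≤ M := (norm_nonneg _).trans (hX.norm_le 0)
  have hYeq : ∀ t : ℝ, (fun y => θ₀ y • X y + t • θ₁ y • X y) =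
      fun y => (θ₀ y + t * θ₁ y) • X y := by
    intro t; funext y; module
  have hYy : ∀ (t : ℝ) y, θ₀ y • X y + t • θ₁ y • X y = (θ₀ y + t * θ₁ y) • X y :=
    fun t y => congrFun (hYeq t) y
  have hθd : ∀ t : ℝ, Differentiable ℝ fun y => θ₀ y + t * θ₁ y := fun t =>
    hθ₀.add (hθ₁.const_mul t)
  have hfY : ∀ t ∈ Icc 0 c, ∀ y, ‖fderiv ℝ (fun y => (θ₀ y + t * θ₁ y) • X y) y‖ ≤
      M * (N₁ + b) := fun t ht y => norm_fderiv_smul_le hX (hθd t) (hfd t ht y) (hb t ht y)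
  intro hcon
  obtain ⟨t, ht, y, hyG, hyE, hsep, ν, ν', hν, hν', μ, hμ0, hμ, hvel⟩ :=
    exists_first_contact (A := fun y => θ₀ y • X y) (B := fun y => θ₁ y • X y) hE hG
      (hθ₀.smul hX.diff) (hθ₁.smul hX.diff)
      (fun t ht y => by rw [hYeq]; exact (hfY t ht y).trans hN₁) h0 (ρ := ρ)
      (fun t ht y hy hy' => hρ t ht y hy (by rwa [← hYy]))
      ⟨t, ht, y, hy, by rwa [hYy]⟩
  have htI : t ∈ Icc 0 c := ⟨ht.1.le, ht.2⟩
  rw [hYeq] at hμ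
  simp only [hYy] at hyE hsep hν' hvel
  set Y : Space n → Space n := fun y => (θ₀ y + t * θ₁ y) • X y with hY
  obtain ⟨N, hNN₁, hNs, hNk⟩ := hθ t htI y hyG
  have hN0 : 0 ≤ N := (norm_nonneg _).trans (hNs.fderiv_le 0)
  have hsf : SmallField s (5 * M * N) Y y := hNs.smallField hs.1 hX (hb t htI)
    (le_trans (by gcongr) hN₁)
  set d := ‖fderiv ℝ Y y‖ with hd
  have hdN : d ≤ 5 * M * N := by
    have := hsf.growth 0
    rwa [add_zero, norm_zero, Real.zero_rpow (by linarith [hs.1]), add_zero, mul_one] at this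
  have hd1 : d ≤ M * (N₁ + b) := hfY t htI y
  have hDY : ∀ v, |inner ℝ (fderiv ℝ Y y v) ν'| ≤ d * ‖v‖ := fun v => by
    have h1 := abs_real_inner_le_norm (fderiv ℝ Y y v) ν'
    rw [hν'.1, mul_one] at h1
    exact h1.trans ((fderiv ℝ Y y).le_opNorm v)
  have hnn : inner ℝ ν ν' ≤ 1 := by
    have := real_inner_le_norm ν ν'
    rwa [hν.1, hν'.1, mul_one] at this
  have hμle : μ ≤ 1 + d := by
    have h1 := hμ ν
    rw [real_inner_self_eq_norm_sq, hν.1, inner_add_left] at h1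
    have h2 := (abs_le.1 (hDY ν)).2
    rw [hν.1] at h2
    linarith
  have hμge : 1 - d ≤ μ := by
    have h1 := hμ ν'
    rw [inner_add_left, real_inner_self_eq_norm_sq, hν'.1, real_inner_comm ν ν'] at h1
    have h2 := (abs_le.1 (hDY ν')).1
    rw [hν'.1] at h2
    nlinarith
  obtain ⟨νG, hνG⟩ := hGf t htI y hyG
  obtain ⟨νE, hνE⟩ := hEf t htI _ hyE
  have hcurv := hCP (G t) (E t) Y y νG νE (5 * M * N) hνG hνE
    (volume_frontier_eq_zero hr hK (hGf t htI)) (volume_frontier_eq_zero hr hK (hEf t htI)) hsf hsep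
  have hXν := htr t htI y hyG ν hν
  have hXle : inner ℝ (X y) ν' ≤ M := by
    have := real_inner_le_norm (X y) ν'
    rw [hν'.1, mul_one] at this
    exact this.trans (hX.norm_le y)
  have hd0 : 0 ≤ d := norm_nonneg _
  have hXge : κ / 2 ≤ inner ℝ (X y) ν' := by
    have h1 := hμ (X y)
    rw [inner_add_left] at h1
    have h2 := (abs_le.1 (hDY (X y))).2
    have h3 : d * ‖X y‖ ≤ d * M := mul_le_mul_of_nonneg_left (hX.norm_le y) hd0
    have h4 : (1 - d) * κ ≤ μ * inner ℝ (X y) ν := by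
      refine (mul_le_mul_of_nonneg_right hμge hκ.le).trans (mul_le_mul_of_nonneg_left hXν hμ0)
    have h5 : d * (κ + M) ≤ κ / 2 :=
      (mul_le_mul_of_nonneg_right hd1 (by positivity)).trans hN₁κ
    linarith
  have hkey := hNk _ ⟨hXge, hXle⟩
  rw [inner_smul_left, RCLike.conj_to_real] at hvel
  have hWy := hW t htI y hyG
  have h6 : -(d * C₀) ≤ (μ - 1) * W t y := by
    have h7 : |(μ - 1) * W t y| ≤ d * C₀ := by
      rw [abs_mul]
      exact mul_le_mul (abs_le.2 ⟨by linarith, by linarith⟩) hWy (abs_nonneg _) hd0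
    exact (abs_le.1 h7).1
  have h7 : d * C₀ ≤ 5 * M * N * C₀ := mul_le_mul_of_nonneg_right hdN hC₀
  have h8 : Y y = (θ₀ y + t * θ₁ y) • X y := rfl
  rw [h8] at hcurv
  nlinarith

/-- A function with values between `a * ρ` and `a`, equal to `a * ρ` at `p` and close to `a` far
away, which varies slowly when `ρ` is small. -/
def profile (s a ρ : ℝ) (p y : Space n) : ℝ := a * (1 - (1 - ρ) * bump (ρ ^ (2 / s)) p y)

/-- A function equal to `1` at `p` and negative away from `p`. -/
def tent (p y : Space n) : ℝ := 2 * bump 1 p y - 1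

theorem abs_tent_le (p y : Space n) : |tent p y| ≤ 1 := by
  unfold tent
  rw [abs_le]
  constructor <;> linarith [bump_pos 1 p y, bump_le_one 1 p y]

theorem tent_self (p : Space n) : tent p p = 1 := by
  simp [tent, bump]; norm_num

theorem differentiable_bump (q : ℝ) (p : Space n) : Differentiable ℝ (bump q p) := fun y =>
  (hasFDerivAt_bump q p y).differentiableAt

theorem differentiable_tent (p : Space n) : Differentiable ℝ (tent p) :=
  ((differentiable_bump 1 p).const_mul 2).sub_const 1

theorem differentiable_profile (s a ρ : ℝ) (p : Space n) : Differentiable ℝ (profile s a ρ p) :=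
  (((differentiable_bump _ p).const_mul _).const_sub 1).const_mul a

theorem le_profile {s a ρ : ℝ} (ha : 0 ≤ a) (hρ1 : ρ ≤ 1) (p y : Space n) :
    a * ρ ≤ profile s a ρ p y := by
  unfold profile
  gcongr
  nlinarith [bump_le_one (ρ ^ (2 / s)) p y]

theorem profile_le {s a ρ : ℝ} (ha : 0 ≤ a) (hρ1 : ρ ≤ 1) (p y : Space n) :
    profile s a ρ p y ≤ a := by
  unfold profile
  have : 0 ≤ (1 - ρ) * bump (ρ ^ (2 / s)) p y :=
    mul_nonneg (by linarith) (bump_pos _ _ _).le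
  nlinarith

theorem tendsto_profile {s a : ℝ} (hs : 0 < s) (p y : Space n) :
    Tendsto (fun ρ => profile s a ρ p y) (𝓝[>] 0) (𝓝 0) := by
  have h1 : Tendsto (fun ρ : ℝ => ρ ^ (2 / s)) (𝓝[>] 0) (𝓝 0) := by
    have := (Real.continuousAt_rpow_const 0 (2 / s) (Or.inr (by positivity))).tendsto
    rw [Real.zero_rpow (by positivity)] at this
    exact this.mono_left nhdsWithin_le_nhds
  have h2 : Tendsto (fun ρ : ℝ => bump (ρ ^ (2 / s)) p y) (𝓝[>] 0) (𝓝 1) := by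
    have : Continuous fun q : ℝ => bump q p y :=
      Continuous.inv₀ (by fun_prop) fun q => by positivity
    have := (this.tendsto 0).comp h1
    simpa [bump, Function.comp_def] using this
  have h3 := (((tendsto_id_nhdsGT_zero.const_sub 1).mul h2).const_sub 1).const_mul a
  simpa [profile] using h3

theorem smallFun_barrier {s a ρ e A e₁ e₂ : ℝ} (hs : s ∈ Ioo (0 : ℝ) 1) (ha : 0 ≤ a)
    (hρ : ρ ∈ Ioc (0 : ℝ) 1) (hA0 : 0 ≤ A) (hA2 : A ≤ 2) (he₁ : |e₁| ≤ e) (he₂ : |e₂| ≤ e)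
    (p y₀ : Space n) :
    SmallFun s (20 * (profile s a ρ p y₀ + e))
      (fun y => A * profile s a ρ p y + e₁ * tent p y + e₂) y₀ := by
  have hs0 := hs.1
  have hs1 := hs.2
  have he : 0 ≤ e := (abs_nonneg _).trans he₁
  set q := ρ ^ (2 / s) with hq
  have hq0 : 0 ≤ q := Real.rpow_nonneg hρ.1.le _
  have hqs : q ^ (s / 2) = ρ := by
    rw [hq, ← Real.rpow_mul hρ.1.le, show 2 / s * (s / 2) = 1 by field_simp, Real.rpow_one]
  have hqρ : q ≤ ρ := by
    have := Real.rpow_le_rpow_of_exponent_ge hρ.1 hρ.2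
      (show (1 : ℝ) ≤ 2 / s by rw [le_div_iff₀ hs0]; linarith)
    rwa [Real.rpow_one] at this
  have hq1 : q ≤ 1 := hqρ.trans hρ.2
  set P := profile s a ρ p y₀ with hP
  have haρ : a * ρ ≤ P := le_profile ha hρ.2 p y₀
  have haq : a * q ≤ P := (mul_le_mul_of_nonneg_left hqρ ha).trans haρ
  have haq2 : a * q ^ 2 ≤ P := by nlinarith [mul_le_mul_of_nonneg_left hq1 (mul_nonneg ha hq0)]
  have hP0 : 0 ≤ P := (mul_nonneg ha hρ.1.le).trans haρ
  have hfd : ∀ y, fderiv ℝ (fun y => A * profile s a ρ p y + e₁ * tent p y + e₂) y =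
      (-(A * a * (1 - ρ))) • fderiv ℝ (bump q p) y + (2 * e₁) • fderiv ℝ (bump 1 p) y := by
    intro y
    have h1 := ((((differentiable_bump q p y).hasFDerivAt.const_mul (1 - ρ)).const_sub
      1).const_mul a).const_mul A
    have h2 := (((differentiable_bump 1 p y).hasFDerivAt.const_mul 2).sub_const 1).const_mul e₁
    refine (((h1.add h2).add_const e₂).congr_fderiv ?_).fderiv
    module
  have hco1 : |-(A * a * (1 - ρ))| ≤ 2 * a := by
    rw [abs_neg, abs_of_nonneg (mul_nonneg (mul_nonneg hA0 ha) (by linarith [hρ.2]))]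
    have : A * a ≤ 2 * a := mul_le_mul_of_nonneg_right hA2 ha
    nlinarith [hρ.1, hρ.2, mul_nonneg hA0 ha]
  have hco2 : |2 * e₁| ≤ 2 * e := by
    rw [abs_mul, abs_of_pos (by norm_num : (0 : ℝ) < 2)]; linarith
  refine ⟨?_, fun y => ?_, fun y y' => ?_, fun z => ?_⟩
  · exact (((differentiable_profile s a ρ p).const_mul A).add
      ((differentiable_tent p).const_mul e₁)).add_const e₂
  · rw [hfd]
    refine (norm_add_le _ _).trans ?_
    rw [norm_smul, norm_smul, Real.norm_eq_abs, Real.norm_eq_abs]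
    have h1 := mul_le_mul hco1 (norm_fderiv_bump_le hq0 p y) (norm_nonneg _) (by positivity)
    have h2 := mul_le_mul hco2 (norm_fderiv_bump_le zero_le_one p y) (norm_nonneg _) (by positivity)
    linarith
  · rw [hfd, hfd, add_sub_add_comm, ← smul_sub, ← smul_sub]
    refine (norm_add_le _ _).trans ?_
    rw [norm_smul, norm_smul, Real.norm_eq_abs, Real.norm_eq_abs]
    have h1 := mul_le_mul hco1 (norm_fderiv_bump_sub_le hq0 p y y') (norm_nonneg _) (by positivity)
    have h2 := mul_le_mul hco2 (norm_fderiv_bump_sub_le zero_le_one p y y') (norm_nonneg _)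
      (by positivity)
    have h3 := mul_le_mul_of_nonneg_right haq2 (norm_nonneg (y - y'))
    nlinarith
  · have h1 := abs_bump_sub_le_rpow hq0 hs p y₀ (y₀ + z)
    rw [hqs, sub_add_cancel_left, norm_neg] at h1
    set w := ‖z‖ ^ (s / 2) with hw
    have hw0 : 0 ≤ w := by positivity
    have h2 : profile s a ρ p (y₀ + z) ≤ P + P * w := by
      have e : profile s a ρ p (y₀ + z) = P + a * (1 - ρ) * (bump q p y₀ - bump q p (y₀ + z)) := by
        rw [hP]; unfold profile; ring
      rw [e]
      have h3 : a * (1 - ρ) * (bump q p y₀ - bump q p (y₀ + z)) ≤ a * (1 - ρ) * (ρ * w) :=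
        mul_le_mul_of_nonneg_left ((le_abs_self _).trans h1)
          (mul_nonneg ha (by linarith [hρ.2]))
      have h4 : a * ρ * w ≤ P * w := mul_le_mul_of_nonneg_right haρ hw0
      have h5 : 0 ≤ a * ρ * ρ * w :=
        mul_nonneg (mul_nonneg (mul_nonneg ha hρ.1.le) hρ.1.le) hw0
      nlinarith
    have h3 : 0 ≤ profile s a ρ p (y₀ + z) :=
      (mul_nonneg ha hρ.1.le).trans (le_profile ha hρ.2 p _)
    have h4 : |e₁ * tent p (y₀ + z)| ≤ e * 1 := by
      rw [abs_mul]
      exact mul_le_mul he₁ (abs_tent_le _ _) (abs_nonneg _) he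
    have h5 : |A * profile s a ρ p (y₀ + z)| ≤ 2 * (P + P * w) := by
      rw [abs_of_nonneg (mul_nonneg hA0 h3)]
      exact mul_le_mul hA2 h2 h3 (by norm_num)
    refine (abs_add_three _ _ _).trans ?_
    nlinarith [mul_nonneg hP0 hw0, mul_nonneg he hw0]

/-- Admissible choices of the constants in the barrier argument. -/
structure BarrierConsts (r K C₀ C κ M a L c : ℝ) : Prop where
  one_le : 1 ≤ M
  κ_pos : 0 < κ
  a_pos : 0 < a
  c_le : c ≤ 1
  L_nonneg : 0 ≤ L
  le_L : 100 * M * (C₀ + C) + 1 ≤ L * (κ / 2)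
  L_mul_c : L * c ≤ 1 / 2
  a_half : M * (28 * a) ≤ 1 / 2
  a_κ : M * (28 * a) * (κ + M) ≤ κ / 2
  a_r : 4 * a * M < r
  a_K : 32 * K * (a * M ^ 2) ≤ κ / 16
  a_M : 4 * a * M ^ 2 ≤ κ / 4
  c_κ : (C₀ + 2) * c ≤ a * κ / 16
  c_M : (C₀ + 2) * c ≤ a * M

/-- No contact is possible where the barrier is not small. -/
theorem BarrierConsts.notMem_closure {r K C₀ C κ M a L c l : ℝ}
    (h : BarrierConsts r K C₀ C κ M a L c) (hr : 0 < r) (hK : 0 ≤ K) {A B : Set (Space n)} {X : Space n → Space n} (hA : UnifFlat r K A)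
    (hX : BoundedField M X) (htr : Transversal κ X A)
    (hnear : ∀ x ∈ closure B, ∃ x' ∈ closure A, ‖x' - x‖ ≤ (C₀ + 2) * c)
    (hl : a / 2 ≤ l) (hl' : l ≤ 3 * a) {y : Space n} (hy : y ∈ closure Aᶜ) :
    y + l • X y ∉ closure B := by
  intro hx
  obtain ⟨x, hxA, hxx⟩ := hnear _ hx
  have ha := h.a_pos
  have hM := h.one_le
  have hκ := h.κ_pos
  set D := (C₀ + 2) * c with hD
  have hD0 : 0 ≤ D := (norm_nonneg _).trans hxx
  have h1 := h.c_κ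
  have h2 := h.c_M
  have h3 : D + l * M ≤ 4 * a * M := by
    have := mul_le_mul_of_nonneg_right hl' (by linarith : 0 ≤ M)
    linarith
  have hl0 : 0 ≤ l := by linarith
  have h0 : 0 ≤ D + l * M := by positivity
  refine false_of_transversal hr hK hA hX htr hxA hy (l := l) (y := y) (D := D) (D' := 0)
    (by linarith) (by rwa [sub_sub]) (by simp) (h3.trans_lt h.a_r) ?_
  have h4 : K * (D + l * M) ^ 2 ≤ K * (4 * a * M) ^ 2 := by gcongr
  have h5 : 2 * (K * (4 * a * M) ^ 2) ≤ a * κ / 16 := by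
    have := mul_le_mul_of_nonneg_left h.a_K ha.le
    nlinarith
  have h6 : M * (D + l * M + 0) ≤ κ / 4 := by
    have := mul_le_mul_of_nonneg_left h3 (by linarith : 0 ≤ M)
    have := h.a_M
    nlinarith
  have h7 : a / 2 * (κ - κ / 4) ≤ l * (κ - M * (D + l * M + 0)) :=
    mul_le_mul hl (by linarith) (by linarith) (by linarith)
  nlinarith [mul_pos ha hκ]

/-- No contact is possible initially. -/
theorem BarrierConsts.notMem_closure_of_near {r K C₀ C κ M a L c l : ℝ}
    (h : BarrierConsts r K C₀ C κ M a L c) (hr : 0 < r) (hK : 0 ≤ K) {A : Set (Space n)}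
    {X : Space n → Space n} (hA : UnifFlat r K A)
    (hX : BoundedField M X) (htr : Transversal κ X A) (hl : 0 < l) (hl' : l ≤ a) {y y' : Space n}
    (hy : y' ∈ closure Aᶜ) (hyy : ‖y - y'‖ ≤ a * M) : y' + l • X y ∉ closure A := by
  intro hx
  have ha := h.a_pos
  have hM := h.one_le
  have hκ := h.κ_pos
  have h3 : l * M ≤ a * M := mul_le_mul_of_nonneg_right hl' (by linarith)
  have haM : 0 < a * M := by positivity
  have hlM : 0 < l * M := by positivity
  refine false_of_transversal hr hK hA hX htr hx hy (l := l) (y := y) (D := 0) (D' := a * M)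
    hl.le (by simp) hyy (by linarith [h.a_r]) ?_
  have h4 : K * (l * M) ^ 2 ≤ l * (K * (a * M ^ 2)) := by
    have : l * (K * (l * M ^ 2)) ≤ l * (K * (a * M ^ 2)) := by gcongr
    nlinarith
  have h5 := h.a_K
  have h6 := h.a_M
  have h7 : M * (0 + l * M + a * M) ≤ κ / 4 := by nlinarith
  have h8 : l * (3 / 4 * κ) ≤ l * (κ - M * (0 + l * M + a * M)) :=
    mul_le_mul_of_nonneg_left (by linarith) hl.le
  have h9 := mul_le_mul_of_nonneg_left h5 hl.le
  have h10 := mul_pos hl hκ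
  rw [zero_add, zero_add]
  rw [zero_add] at h8
  nlinarith

theorem bump_le_of_le {q R : ℝ} (hq : 0 < q) {p y : Space n} (hR : 3 / q + ‖p‖ ≤ R)
    (hy : R < ‖y‖) : bump q p y ≤ 1 / 8 := by
  have h1 : 3 / q ≤ ‖y - p‖ := by linarith [norm_sub_norm_le y p]
  rw [div_le_iff₀ hq] at h1
  have h2 : (8 : ℝ) ≤ 1 + (q * ‖y - p‖) ^ 2 := by nlinarith
  unfold bump
  rw [← one_div]
  exact one_div_le_one_div_of_le (by norm_num) h2

/-- A family moved along `X` by the limit of the barriers does not enter `E`. -/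
theorem notMem_interior_of_strict {s r K C₀ C κ M a L c c' e α₁ α₂ α₃ : ℝ}
    {E G : ℝ → Set (Space n)} {W : ℝ → Space n → ℝ} {X : Space n → Space n}
    (h : BarrierConsts r K C₀ C κ M a L c)
    (hs : s ∈ Ioo (0 : ℝ) 1) (hr : 0 < r) (hK : 0 ≤ K) (hC₀ : 0 ≤ C₀)
    (hCP : IsPerturbationConst n s r K C)
    (hE : MovingFamily c' E fun t x => -fracMeanCurv s (E t) x) (hG : MovingFamily c' G W)
    (hEf : ∀ t ∈ Icc 0 c', UnifFlat r K (E t)) (hGf : ∀ t ∈ Icc 0 c', UnifFlat r K (G t))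
    (hW : ∀ t ∈ Icc 0 c', ∀ y ∈ frontier (G t), |W t y| ≤ C₀) (hX : BoundedField M X)
    (htr : ∀ t ∈ Icc 0 c', Transversal κ X (G t)) (hc' : c' ≤ c)
    (hnear : ∀ t ∈ Icc 0 c', ∀ x ∈ closure (E t), ∃ x' ∈ closure (G t), ‖x' - x‖ ≤ (C₀ + 2) * c)
    (he : e ≤ a / 8) (he₁ : ∀ t ∈ Icc 0 c', |α₁ + t * α₂| ≤ e) (he₂ : ∀ t ∈ Icc 0 c', |t * α₃| ≤ e)
    (p : Space n)
    (hstrict : ∀ t ∈ Icc 0 c', ∀ y ∈ frontier (G t), ∀ k ∈ Icc (κ / 2) M,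
      100 * M * (C₀ + C) * e ≤ (α₂ * tent p y + α₃) * k + (W t y + fracMeanCurv s (G t) y))
    (h0 : ∀ ρ ∈ Ioc (0 : ℝ) 1, ∀ y ∈ closure (G 0)ᶜ,
      y + (profile s a ρ p y + α₁ * tent p y) • X y ∉ closure (E 0))
    {t : ℝ} (ht : t ∈ Icc 0 c') {y : Space n} (hy : y ∈ closure (G t)ᶜ) :
    y + ((α₁ + t * α₂) * tent p y + t * α₃) • X y ∉ interior (E t) := by
  have ha := h.a_pos
  have hM := h.one_le
  have hκ := h.κ_pos
  have hLt : ∀ t ∈ Icc 0 c', 0 ≤ L * t ∧ L * t ≤ 1 / 2 := fun t ht =>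
    ⟨mul_nonneg h.L_nonneg ht.1,
      (mul_le_mul_of_nonneg_left (ht.2.trans hc') h.L_nonneg).trans h.L_mul_c⟩
  have key : ∀ ρ ∈ Ioc (0 : ℝ) 1, y + ((1 + L * t) * profile s a ρ p y +
      (α₁ + t * α₂) * tent p y + t * α₃) • X y ∉ closure (E t) := by
    intro ρ hρ
    set P := profile s a ρ p with hP
    have hPa : ∀ y, P y ≤ a := profile_le ha.le hρ.2 p
    have hPρ : ∀ y, a * ρ ≤ P y := le_profile ha.le hρ.2 p
    have hP0 : ∀ y, 0 < P y := fun y => (mul_pos ha hρ.1).trans_le (hPρ y)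
    have hθ : ∀ (t : ℝ) y, (P y + α₁ * tent p y) + t * (L * P y + α₂ * tent p y + α₃) =
        (1 + L * t) * P y + (α₁ + t * α₂) * tent p y + t * α₃ := fun t y => by ring
    have hsmall : ∀ t ∈ Icc 0 c', ∀ y₀, SmallFun s (20 * (P y₀ + e))
        (fun y => (1 + L * t) * P y + (α₁ + t * α₂) * tent p y + t * α₃) y₀ := fun t ht y₀ =>
      smallFun_barrier hs ha.le hρ (by linarith [(hLt t ht).1]) (by linarith [(hLt t ht).2])
        (he₁ t ht) (he₂ t ht) p y₀
    have hrest : ∀ t ∈ Icc 0 c', ∀ y, |(α₁ + t * α₂) * tent p y| ≤ e := fun t ht y => by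
      rw [abs_mul]
      refine (mul_le_mul (he₁ t ht) (abs_tent_le p y) (abs_nonneg _)
        ((abs_nonneg _).trans (he₁ t ht))).trans (by linarith)
    rw [← hθ]
    refine notMem_closure_of_barrier (N₁ := 25 * a) (b := 3 * a) (κ := κ)
      (θ₀ := fun y => P y + α₁ * tent p y) (θ₁ := fun y => L * P y + α₂ * tent p y + α₃)
      (ρ := 3 / ρ ^ (2 / s) + ‖p‖) hs hr hK hC₀ hCP hE hG hEf hGf hW hX htr ?_ ?_ hκ ?_ ?_ ?_ ?_ ?_
      (h0 ρ hρ) ?_ ht hy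
    · exact (differentiable_profile s a ρ p).add ((differentiable_tent p).const_mul _)
    · exact (((differentiable_profile s a ρ p).const_mul _).add
        ((differentiable_tent p).const_mul _)).add_const _
    · rw [← add_mul]; norm_num1; exact h.a_half
    · rw [← add_mul]; norm_num1; exact h.a_κ
    · intro t ht y
      rw [hθ]
      refine (abs_add_three _ _ _).trans ?_
      have h1 := hrest t ht y
      have h2 := he₂ t ht
      rw [abs_of_nonneg (mul_nonneg (by linarith [(hLt t ht).1]) (hP0 y).le)]
      have h3 : (1 + L * t) * P y ≤ (3 / 2) * a :=
        mul_le_mul (by linarith [(hLt t ht).2]) (hPa y) (hP0 y).le (by norm_num)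
      linarith
    · intro t ht y
      simp only [hθ]
      have h1 := (hsmall t ht y).fderiv_le y
      have h2 := hPa y
      linarith
    · intro t ht y₀ hy₀
      simp only [hθ]
      refine ⟨20 * (P y₀ + e), by linarith [hPa y₀], hsmall t ht y₀, fun k hk => ?_⟩
      have h1 := hstrict t ht y₀ hy₀ k hk
      have h2 : L * (κ / 2) * P y₀ ≤ L * k * P y₀ :=
        mul_le_mul_of_nonneg_right (mul_le_mul_of_nonneg_left hk.1 h.L_nonneg) (hP0 y₀).le
      have h3 := mul_le_mul_of_nonneg_right h.le_L (hP0 y₀).le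
      have h4 := hP0 y₀
      nlinarith
    · intro t ht y hy hcon
      by_contra! hfar
      rw [hθ] at hcon
      have hb := bump_le_of_le (Real.rpow_pos_of_pos hρ.1 _) le_rfl hfar
      have h1 := hrest t ht y
      have h2 := he₂ t ht
      have h3 : a * (7 / 8) ≤ P y := by
        rw [hP]; unfold profile
        gcongr
        nlinarith [bump_pos (ρ ^ (2 / s)) p y, hρ.1, hρ.2]
      have h4 : (1 + L * t) * P y ≤ (3 / 2) * a :=
        mul_le_mul (by linarith [(hLt t ht).2]) (hPa y) (hP0 y).le (by norm_num)
      have h5 : P y ≤ (1 + L * t) * P y := by nlinarith [(hLt t ht).1, hP0 y]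
      rw [abs_le] at h1 h2
      exact h.notMem_closure hr hK (hGf t ht) hX (htr t ht) (hnear t ht) (by linarith)
        (by linarith) hy hcon
  intro hcon
  have hlim : Tendsto (fun ρ => y + ((1 + L * t) * profile s a ρ p y +
      (α₁ + t * α₂) * tent p y + t * α₃) • X y) (𝓝[>] 0)
      (𝓝 (y + ((α₁ + t * α₂) * tent p y + t * α₃) • X y)) := by
    have h1 := ((((tendsto_profile (a := a) hs.1 p y).const_mul (1 + L * t)).add_const
      ((α₁ + t * α₂) * tent p y)).add_const (t * α₃)).smul_const (X y)
    simpa only [mul_zero, zero_add] using h1.const_add y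
  obtain ⟨ρ, h1, h2⟩ := ((hlim.eventually (isOpen_interior.mem_nhds hcon)).and
    (Ioc_mem_nhdsGT zero_lt_one)).exists
  exact key ρ h2 (subset_closure (interior_subset h1))

theorem MovingFamily.shift {T b c : ℝ} {E : ℝ → Set (Space n)} {V : ℝ → Space n → ℝ}
    (h : MovingFamily T E V) (hb : 0 ≤ b) (hc : b + c ≤ T) :
    MovingFamily c (fun t => E (b + t)) fun t => V (b + t) := by
  have hmaps : MapsTo (fun t => b + t) (Icc 0 c) (Icc 0 T) := fun t ht =>
    ⟨add_nonneg hb ht.1, by linarith [ht.2]⟩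
  refine ⟨fun t ht x => ?_, fun t ht x hx => ?_⟩
  · obtain ⟨u, hu, hg, hev⟩ := h.isC1Family (b + t) (hmaps ht) x
    refine ⟨fun p => u (p.1, b + p.2), hu.comp (by fun_prop), hg, ?_⟩
    have hlim : Tendsto (fun p : Space n × ℝ => (p.1, b + p.2)) (𝓝[univ ×ˢ Icc 0 c] (x, t))
        (𝓝[univ ×ˢ Icc 0 T] (x, b + t)) :=
      ((by fun_prop : Continuous fun p : Space n × ℝ => (p.1, b + p.2)).continuousWithinAt
        ).tendsto_nhdsWithin fun p hp => ⟨mem_univ _, hmaps hp.2⟩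
    exact hlim.eventually hev
  · obtain ⟨ν, γ, v, h1, h2, h3, h4, h5⟩ := h.motion (b + t) (hmaps ht) x hx
    refine ⟨ν, fun τ => γ (b + τ), v, h1, h2, ?_, ?_, h5⟩
    · have hlim : Tendsto (fun τ : ℝ => b + τ) (𝓝[Icc 0 c] t) (𝓝[Icc 0 T] (b + t)) :=
        ((by fun_prop : Continuous fun τ : ℝ => b + τ).continuousWithinAt
          ).tendsto_nhdsWithin hmaps
      exact hlim.eventually h3
    · have h6 : HasDerivWithinAt (fun τ : ℝ => b + τ) 1 (Icc 0 c) t :=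
        ((hasDerivAt_id t).const_add b).hasDerivWithinAt
      have := HasDerivWithinAt.scomp (h := fun τ : ℝ => b + τ) t h4 h6 hmaps
      simpa [Function.comp_def] using this

theorem MovingFamily.const {T t : ℝ} {E : ℝ → Set (Space n)} {V : ℝ → Space n → ℝ}
    (h : MovingFamily T E V) (ht : t ∈ Icc 0 T) (c : ℝ) :
    MovingFamily c (fun _ => E t) fun _ _ => 0 := by
  refine ⟨fun τ _ x => ?_, fun τ _ x hx => ?_⟩
  · obtain ⟨u, hu, hg, hev⟩ := h.isC1Family t ht x
    refine ⟨fun p => u (p.1, t), hu.comp (by fun_prop), hg, ?_⟩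
    have hlim : Tendsto (fun p : Space n × ℝ => (p.1, t)) (𝓝[univ ×ˢ Icc 0 c] (x, τ))
        (𝓝[univ ×ˢ Icc 0 T] (x, t)) :=
      ((by fun_prop : Continuous fun p : Space n × ℝ => (p.1, t)).continuousWithinAt
        ).tendsto_nhdsWithin fun p _ => ⟨mem_univ _, ht⟩
    exact hlim.eventually hev
  · obtain ⟨ν, γ, v, h1, -, -, -, -⟩ := h.motion t ht x hx
    exact ⟨ν, fun _ => x, 0, h1, rfl, Eventually.of_forall fun _ => hx,
      hasDerivWithinAt_const _ _ _, inner_zero_left _⟩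

theorem norm_sub_le_two_of_tent {p y : Space n} (h : -(1 / 2) ≤ tent p y) : ‖y - p‖ ≤ 2 := by
  by_contra! h2
  have h3 := bump_mul 1 p y
  have h4 : 1 / 4 ≤ bump 1 p y := by unfold tent at h; linarith
  have h5 : 4 < (1 * ‖y - p‖) ^ 2 := by nlinarith
  nlinarith

theorem exists_pos_le_near {A : Set (Space n)} {f : Space n → ℝ} (hf : ContinuousOn f (frontier A))
    (hpos : ∀ y ∈ frontier A, 0 < f y) (p : Space n) :
    ∃ m > 0, ∀ y ∈ frontier A, -(1 / 2) ≤ tent p y → m ≤ f y := by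
  have hc : IsCompact (frontier A ∩ Metric.closedBall p 2) :=
    (isCompact_closedBall p 2).inter_left isClosed_frontier
  rcases (frontier A ∩ Metric.closedBall p 2).eq_empty_or_nonempty with hem | hne
  · refine ⟨1, one_pos, fun y hy hty => absurd (show y ∈ frontier A ∩ Metric.closedBall p 2 from
      ⟨hy, ?_⟩) (hem ▸ notMem_empty y)⟩
    rw [mem_closedBall_iff_norm]
    exact norm_sub_le_two_of_tent hty
  · obtain ⟨z, hz, hmin⟩ := hc.exists_isMinOn hne (hf.mono inter_subset_left)
    refine ⟨f z, hpos z hz.1, fun y hy hty => hmin ⟨hy, ?_⟩⟩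
    rw [mem_closedBall_iff_norm]
    exact norm_sub_le_two_of_tent hty

theorem zero_le_inner_of_notMem_interior {τ : ℝ} {F : Set (Space n)} {γ z : ℝ → Space n}
    {ν v w : Space n} (hτ : 0 < τ) (hν : IsOuterNormal F (γ τ) ν)
    (hγ : HasDerivWithinAt γ v (Icc 0 τ) τ) (hz : Tendsto z (𝓝[>] 0) (𝓝 w))
    (hno : ∀ᶠ h in 𝓝[>] 0, γ (τ - h) + h • z h ∉ interior F) : 0 ≤ inner ℝ (w - v) ν := by
  by_contra! hneg
  have hshift : Tendsto (fun h : ℝ => τ - h) (𝓝[>] 0) (𝓝[Icc 0 τ \ {τ}] τ) := by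
    rw [tendsto_nhdsWithin_iff]
    refine ⟨by simpa using tendsto_id_nhdsGT_zero.const_sub τ, ?_⟩
    filter_upwards [Ioo_mem_nhdsGT hτ] with h hh
    refine ⟨⟨by linarith [hh.2], by linarith [hh.1]⟩, ?_⟩
    rw [mem_singleton_iff]; linarith [hh.1]
  have hslope := (hasDerivWithinAt_iff_tendsto_slope.1 hγ).comp hshift
  have hd : Tendsto (fun h : ℝ => z h - slope γ τ (τ - h)) (𝓝[>] 0) (𝓝 (w - v)) := hz.sub hslope
  have := hν.eventually_mem_interior (l := 𝓝[>] (0 : ℝ)) (ε := fun h : ℝ => h)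
    eventually_mem_nhdsWithin tendsto_id_nhdsGT_zero hd hneg
  obtain ⟨h, h1, h2, h3⟩ := (this.and (hno.and (Ioo_mem_nhdsGT hτ))).exists
  refine h2 ?_
  convert h1 using 1
  have hh : h ≠ 0 := h3.1.ne'
  rw [slope_def_module, sub_sub_cancel_left, smul_sub, smul_smul, inv_neg, mul_neg,
    mul_inv_cancel₀ hh]
  module

/-- Positivity of the curvature persists for a short time. -/
theorem fracMeanCurv_pos_of_initial {s r K C₀ C κ M a L c τ : ℝ} {F : ℝ → Set (Space n)}
    {X : Space n → Space n} (hc : BarrierConsts r K C₀ C κ M a L c)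
    (hs : s ∈ Ioo (0 : ℝ) 1) (hr : 0 < r) (hK : 0 ≤ K) (hC₀ : 0 ≤ C₀) (hC : 0 ≤ C)
    (hCP : IsPerturbationConst n s r K C) (hτ0 : 0 < τ) (hτ : τ ≤ c)
    (hF : MovingFamily τ F fun t x => -fracMeanCurv s (F t) x)
    (hFf : ∀ t ∈ Icc 0 τ, UnifFlat r K (F t))
    (hH : ∀ t ∈ Icc 0 τ, ∀ y ∈ frontier (F t), |fracMeanCurv s (F t) y| ≤ C₀)
    (hX : BoundedField M X) (htr : ∀ t ∈ Icc 0 τ, Transversal κ X (F t))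
    (hcont : ContinuousOn (fracMeanCurv s (F 0)) (frontier (F 0)))
    (hpos : ∀ y ∈ frontier (F 0), 0 < fracMeanCurv s (F 0) y)
    {p : Space n} (hp : p ∈ frontier (F τ)) : 0 < fracMeanCurv s (F τ) p := by
  have ha := hc.a_pos
  have hM := hc.one_le
  have hκ := hc.κ_pos
  have hL := hc.L_nonneg
  have hc1 := hc.c_le
  obtain ⟨m, hm, hmle⟩ := exists_pos_le_near hcont hpos p
  set C' := 100 * M * (C₀ + C) with hC'
  have hC'0 : 0 ≤ C' := by positivity
  obtain ⟨ε, hε0, hεm, hεa⟩ : ∃ ε > 0, ε * (M + C') ≤ m ∧ ε ≤ a / 16 := by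
    refine ⟨min (m / (M + C')) (a / 16), by positivity, ?_, min_le_right _ _⟩
    rw [← le_div_iff₀ (by positivity)]
    exact min_le_left _ _
  have hτI : τ ∈ Icc 0 τ := ⟨hτ0.le, le_rfl⟩
  have h0I : (0 : ℝ) ∈ Icc 0 τ := ⟨le_rfl, hτ0.le⟩
  have hback : ∀ t₁ t₂, 0 ≤ t₁ → t₂ ≤ τ → t₁ ≤ t₂ → ∀ x ∈ closure (F t₂),
      ∃ x' ∈ closure (F t₁), ‖x' - x‖ ≤ (C₀ + 2) * c := by
    intro t₁ t₂ h1 h2 h12 x hx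
    obtain ⟨x', hx', hd⟩ := hF.exists_mem_closure hC₀
      (fun t ht y hy => by linarith [(abs_le.1 (hH t ht y hy)).1]) h1 h2 h12 hx
    exact ⟨x', hx', hd.trans (mul_le_mul_of_nonneg_left (by linarith) (by linarith))⟩
  have hinit : ∀ h, 0 < h → h < τ → h * C' ≤ κ / 4 → ∀ y ∈ closure (F 0)ᶜ,
      y + (-(h * ε) * tent p y) • X y ∉ interior (F h) := by
    intro h h0 hhτ hhC y hy
    have hsub : ∀ t ∈ Icc 0 h, t ∈ Icc 0 τ := fun t ht => ⟨ht.1, ht.2.trans hhτ.le⟩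
    have hFh : MovingFamily h F fun t x => -fracMeanCurv s (F t) x := by
      simpa using hF.shift le_rfl (show 0 + h ≤ τ by linarith)
    have he : ∀ t ∈ Icc 0 h, |0 + t * -ε| ≤ h * ε := by
      intro t ht
      rw [zero_add, mul_neg, abs_neg, abs_of_nonneg (mul_nonneg ht.1 hε0.le)]
      exact mul_le_mul_of_nonneg_right ht.2 hε0.le
    have := notMem_interior_of_strict (c' := h) (e := h * ε) (α₁ := 0) (α₂ := -ε) (α₃ := 0)
      (E := F) (G := fun _ => F 0) (W := fun _ _ => 0) hc hs hr hK hC₀ hCP hFh (hF.const h0I h)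
      (fun t ht => hFf t (hsub t ht)) (fun _ _ => hFf 0 h0I) (fun _ _ _ _ => by simpa using hC₀) hX
      (fun _ _ => htr 0 h0I) (hhτ.le.trans hτ)
      (fun t ht => hback 0 t le_rfl (hsub t ht).2 ht.1) (by nlinarith) he
      (fun t ht => by rw [mul_zero, abs_zero]; positivity) p ?_ ?_ (right_mem_Icc.2 h0.le) hy
    · convert this using 4
      ring
    · intro t ht y hy k hk
      have hk0 : 0 < k := by linarith [hk.1]
      have hty := abs_le.1 (abs_tent_le p y)
      rw [add_zero, zero_add]
      rcases le_total (-(1 / 2)) (tent p y) with h1 | h1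
      · have h2 := hmle y hy h1
        have h3 : h * (C' * ε) ≤ 1 * (C' * ε) := by gcongr; linarith
        have h4 : tent p y * k ≤ 1 * M := mul_le_mul hty.2 hk.2 hk0.le zero_le_one
        have h5 := mul_le_mul_of_nonneg_left h4 hε0.le
        nlinarith
      · have h2 := hpos y hy
        have h3 : 1 / 2 * (κ / 2) ≤ -tent p y * k :=
          mul_le_mul (by linarith) hk.1 (by linarith) (by linarith)
        have h4 := mul_le_mul_of_nonneg_left h3 hε0.le
        have h5 := mul_le_mul_of_nonneg_right hhC hε0.le
        nlinarith
    · intro ρ hρ y hy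
      rw [zero_mul, add_zero]
      exact hc.notMem_closure_of_near hr hK (hFf 0 h0I) hX (htr 0 h0I)
        ((mul_pos ha hρ.1).trans_le (le_profile ha.le hρ.2 p y)) (profile_le ha.le hρ.2 p y) hy
        (by rw [sub_self, norm_zero]; positivity)
  have hlate : ∀ h, 0 < h → h < τ → h * C' ≤ κ / 4 → ∀ y ∈ closure (F (τ - h))ᶜ,
      y + (-(h * ε) * tent p y + (τ - h) * (h * ε * L)) • X y ∉ interior (F τ) := by
    intro h h0 hhτ hhC y hy
    have hsub : ∀ t ∈ Icc 0 (τ - h), t ∈ Icc 0 τ := fun t ht => ⟨ht.1, by linarith [ht.2]⟩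
    have hsub' : ∀ t ∈ Icc 0 (τ - h), h + t ∈ Icc 0 τ := fun t ht =>
      ⟨by linarith [ht.1], by linarith [ht.2]⟩
    have hhε : 0 < h * ε := mul_pos h0 hε0
    have hFG : MovingFamily (τ - h) F fun t x => -fracMeanCurv s (F t) x := by
      simpa using hF.shift le_rfl (show 0 + (τ - h) ≤ τ by linarith)
    have hFE : MovingFamily (τ - h) (fun t => F (h + t)) fun t x => -fracMeanCurv s (F (h + t)) x :=
      hF.shift h0.le (show h + (τ - h) ≤ τ by linarith)
    have := notMem_interior_of_strict (c' := τ - h) (e := h * ε) (α₁ := -(h * ε)) (α₂ := 0)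
      (α₃ := h * ε * L) hc hs hr hK hC₀ hCP hFE hFG
      (fun t ht => hFf _ (hsub' t ht)) (fun t ht => hFf t (hsub t ht))
      (fun t ht y hy => by rw [abs_neg]; exact hH t (hsub t ht) y hy) hX
      (fun t ht => htr t (hsub t ht)) (by linarith)
      (fun t ht => hback t (h + t) ht.1 (hsub' t ht).2 (by linarith)) (by nlinarith)
      (fun t ht => by rw [mul_zero, add_zero, abs_neg, abs_of_pos hhε]) (fun t ht => ?_) p ?_ ?_
      (right_mem_Icc.2 (by linarith : 0 ≤ τ - h)) hy
    · simpa only [mul_zero, add_zero, add_sub_cancel] using this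
    · rw [abs_of_nonneg (mul_nonneg ht.1 (by positivity))]
      have h1 : L * t ≤ L * c := mul_le_mul_of_nonneg_left (by linarith [ht.2]) hL
      have h2 := hc.L_mul_c
      nlinarith
    · intro t ht y hy k hk
      rw [zero_mul, zero_add, neg_add_cancel, add_zero]
      have h1 := hc.le_L
      have h2 := mul_le_mul_of_nonneg_left hk.1 hL
      have h3 : C' * (h * ε) ≤ L * k * (h * ε) :=
        mul_le_mul_of_nonneg_right (by linarith) hhε.le
      linarith
    · intro ρ hρ y hy
      rw [add_zero]
      set y' := y + (-(h * ε) * tent p y) • X y with hy'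
      have e : y + (profile s a ρ p y + -(h * ε) * tent p y) • X y =
          y' + profile s a ρ p y • X y := by rw [hy']; module
      rw [e]
      refine hc.notMem_closure_of_near hr hK (hFf h ⟨h0.le, hhτ.le⟩) hX (htr h ⟨h0.le, hhτ.le⟩)
        ((mul_pos ha hρ.1).trans_le (le_profile ha.le hρ.2 p y)) (profile_le ha.le hρ.2 p y) ?_ ?_
      · rw [closure_compl]
        exact hinit h h0 hhτ hhC y hy
      · rw [hy', sub_add_cancel_left, norm_neg, norm_smul, norm_mul, norm_neg,
          Real.norm_of_nonneg hhε.le, Real.norm_eq_abs]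
        have h1 : h * ε ≤ a := by nlinarith
        have h2 : h * ε * |tent p y| ≤ a * 1 :=
          mul_le_mul h1 (abs_tent_le p y) (abs_nonneg _) ha.le
        exact mul_le_mul (by linarith) (hX.norm_le y) (norm_nonneg _) ha.le
  obtain ⟨ν, γ, v, hν, hγτ, hγ, hγd, hvν⟩ := hF.motion τ hτI p hp
  have hshift : Tendsto (fun h : ℝ => τ - h) (𝓝[>] 0) (𝓝[Icc 0 τ] τ) := by
    rw [tendsto_nhdsWithin_iff]
    refine ⟨by simpa using tendsto_id_nhdsGT_zero.const_sub τ, ?_⟩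
    filter_upwards [Ioo_mem_nhdsGT hτ0] with h hh
    exact ⟨by linarith [hh.2], by linarith [hh.1]⟩
  have hγlim : Tendsto (fun h : ℝ => γ (τ - h)) (𝓝[>] 0) (𝓝 p) := by
    have := hγd.continuousWithinAt.tendsto.comp hshift
    rwa [hγτ] at this
  have htent : Tendsto (fun h : ℝ => tent p (γ (τ - h))) (𝓝[>] 0) (𝓝 1) := by
    have := ((differentiable_tent p).continuous.tendsto p).comp hγlim
    rwa [tent_self] at this
  have hXlim : Tendsto (fun h : ℝ => X (γ (τ - h))) (𝓝[>] 0) (𝓝 (X p)) :=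
    (hX.diff.continuous.tendsto p).comp hγlim
  have hz : Tendsto (fun h : ℝ => (ε * (-tent p (γ (τ - h)) + (τ - h) * L)) • X (γ (τ - h)))
      (𝓝[>] 0) (𝓝 ((ε * (-1 + τ * L)) • X p)) := by
    have h1 : Tendsto (fun h : ℝ => τ - h) (𝓝[>] 0) (𝓝 τ) :=
      hshift.mono_right nhdsWithin_le_nhds
    exact ((htent.neg.add (h1.mul_const L)).const_mul ε).smul hXlim
  rw [← hγτ] at hν
  have hfin := zero_le_inner_of_notMem_interior hτ0 hν hγd hz (by
    have hsmall : ∀ᶠ h : ℝ in 𝓝[>] 0, h * C' ≤ κ / 4 := by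
      have h1 : Tendsto (fun h : ℝ => h * C') (𝓝[>] 0) (𝓝 0) := by
        simpa using tendsto_id_nhdsGT_zero.mul_const C'
      exact (h1.eventually (gt_mem_nhds (by positivity : 0 < κ / 4))).mono fun h hh => hh.le
    filter_upwards [hsmall, Ioo_mem_nhdsGT hτ0, hshift.eventually hγ] with h h1 h2 h3
    have h4 := hlate h h2.1 h2.2 h1 (γ (τ - h)) (by
      rw [closure_compl]; exact h3.2)
    convert h4 using 3
    rw [smul_smul]
    congr 1
    ring)
  rw [hγτ] at hν
  rw [inner_sub_left, hvν, inner_smul_left, RCLike.conj_to_real] at hfin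
  have h1 := htr τ hτI p hp ν hν
  have h2 : L * τ ≤ 1 / 2 := (mul_le_mul_of_nonneg_left hτ hL).trans hc.L_mul_c
  have h3 : 1 / 2 * κ ≤ (1 - τ * L) * inner ℝ (X p) ν :=
    mul_le_mul (by linarith) h1 hκ.le (by linarith)
  have h4 := mul_le_mul_of_nonneg_left h3 hε0.le
  have h5 := mul_pos hε0 hκ
  nlinarith

theorem volume_real_ball_eq_mul (n : ℕ) {ρ : ℝ} (hρ : 0 < ρ) :
    volume.real (Metric.ball (0 : Space n) ρ) =
      8 ^ n * volume.real (Metric.ball (0 : Space n) (ρ / 8)) := by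
  have h : ∀ R : ℝ, 0 < R → volume.real (Metric.ball (0 : Space n) R) =
      R ^ n * volume.real (Metric.ball (0 : Space n) 1) := fun R hR => by
    rw [measureReal_def, Measure.addHaar_ball_of_pos volume 0 hR, finrank_euclideanSpace_fin,
      ENNReal.toReal_mul, ENNReal.toReal_ofReal (by positivity), measureReal_def]
  rw [h ρ hρ, h (ρ / 8) (by positivity), div_pow]
  field_simp

/-- The field `outField` built from the last set of a short family is transversal to all sets of
the family. -/
theorem MovingFamily.transversal_outField {r K C₀ ρ τ : ℝ} {F : ℝ → Set (Space n)}
    {V : ℝ → Space n → ℝ} (hF : MovingFamily τ F V) (hr : 0 < r) (hK : 0 ≤ K) (hC₀ : 0 ≤ C₀)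
    (hFf : ∀ t ∈ Icc 0 τ, UnifFlat r K (F t))
    (hV : ∀ t ∈ Icc 0 τ, ∀ x ∈ frontier (F t), |V t x| ≤ C₀) (hρ : 0 < ρ) (hρr : 2 * ρ < r)
    (hρK : 4 * K * ρ ^ 2 ≤ (1 / 8) ^ n / 32 * ρ / 2)
    (hτ : (C₀ + 2) * τ ≤ (1 / 8) ^ n / 32 * ρ / 2) {t : ℝ} (ht : t ∈ Icc 0 τ) :
    Transversal (ρ / 16 * volume.real (Metric.ball (0 : Space n) (ρ / 8)))
      (outField ρ hρ (interior (F τ))) (F t) := by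
  intro p hp ν hν
  obtain ⟨ν', hν'⟩ := hFf t ht p hp
  obtain rfl : ν = ν' := hν.unique (hν'.isOuterNormal hr)
  set q : ℝ := (1 / 8) ^ n / 32 with hq
  have hq0 : 0 < q := by positivity
  have hq1 : q ≤ 1 / 32 := by
    rw [hq]
    have : ((1 : ℝ) / 8) ^ n ≤ 1 := pow_le_one₀ (by norm_num) (by norm_num)
    linarith
  set D := (C₀ + 2) * τ with hD
  have hDt : (C₀ + 2) * (τ - t) ≤ D := mul_le_mul_of_nonneg_left (by linarith [ht.1]) (by linarith)
  have hqρ : q * ρ ≤ ρ / 32 := by nlinarith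
  have hnear : ∀ y y' : Space n, ‖y - p‖ < ρ → ‖y' - y‖ ≤ (C₀ + 2) * (τ - t) →
      ‖y' - p‖ < r ∧ K * ‖y' - p‖ ^ 2 + D ≤ q * ρ ∧
      |inner ℝ (y - p) ν - inner ℝ (y' - p) ν| ≤ D := by
    intro y y' h1 h2
    have h3 : ‖y' - p‖ ≤ 2 * ρ := by
      have := norm_add_le (y' - y) (y - p)
      rw [sub_add_sub_cancel] at this
      linarith
    refine ⟨h3.trans_lt hρr, ?_, ?_⟩
    · have h4 : K * ‖y' - p‖ ^ 2 ≤ K * (2 * ρ) ^ 2 := by gcongr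
      nlinarith
    · rw [← inner_sub_left, sub_sub_sub_cancel_right]
      have h4 := abs_real_inner_le_norm (y - y') ν
      rw [hν.1, mul_one, norm_sub_rev] at h4
      linarith
  have h1 : ∀ y, ‖y - p‖ < ρ → inner ℝ (y - p) ν < -(q * ρ) → y ∈ interior (F τ) := by
    intro y hy hlt
    by_contra hcon
    obtain ⟨y', hy', hd⟩ := hF.compl.exists_mem_closure hC₀
      (fun t ht x hx => by
        rw [frontier_compl] at hx
        linarith [(abs_le.1 (hV t ht x hx)).1]) ht.1 le_rfl ht.2
      (show y ∈ closure (F τ)ᶜ by rwa [closure_compl])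
    obtain ⟨h2, h3, h4⟩ := hnear y y' hy hd
    have h5 := hν'.le_inner_of_mem_closure_compl hy' h2
    linarith [(abs_le.1 h4).1]
  have h2 : ∀ y, ‖y - p‖ < ρ → q * ρ < inner ℝ (y - p) ν → y ∉ interior (F τ) := by
    intro y hy hlt hcon
    obtain ⟨y', hy', hd⟩ := hF.exists_mem_closure hC₀
      (fun t ht x hx => (abs_le.1 (hV t ht x hx)).2) ht.1 le_rfl ht.2
      (subset_closure (interior_subset hcon))
    obtain ⟨h2, h3, h4⟩ := hnear y y' hy hd
    have h5 := hν'.inner_le_of_mem_closure hy' h2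
    linarith [(abs_le.1 h4).2]
  have h3 := le_inner_outField hρ isOpen_interior.measurableSet hν.1 (by positivity)
    (by linarith) h1 h2
  refine le_trans ?_ h3
  rw [volume_real_ball_eq_mul n hρ]
  set w := volume.real (Metric.ball (0 : Space n) (ρ / 8)) with hw
  have hw0 : 0 ≤ w := measureReal_nonneg
  have e : q * ρ * (8 ^ n * w) = ρ * w / 32 := by
    rw [hq, one_div, inv_pow]; field_simp
  rw [e]
  nlinarith [mul_nonneg hρ.le hw0]

theorem eventually_mul_le (k : ℝ) {b : ℝ} (hb : 0 < b) : ∀ᶠ x : ℝ in 𝓝[>] 0, k * x < b := by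
  have h : Tendsto (fun x : ℝ => k * x) (𝓝[>] 0) (𝓝 0) := by
    simpa using tendsto_id_nhdsGT_zero.const_mul k
  exact h.eventually (gt_mem_nhds hb)

theorem exists_barrierConsts {r K C₀ C κ M d : ℝ} (hr : 0 < r) (hC₀ : 0 ≤ C₀) (hC : 0 ≤ C)
    (hκ : 0 < κ) (hM : 1 ≤ M) (hd : 0 < d) : ∃ a L c : ℝ, 0 < c ∧ (C₀ + 2) * c ≤ d ∧
      BarrierConsts r K C₀ C κ M a L c := by
  have hM0 : 0 < M := by linarith
  obtain ⟨a, h1, h2, h3, h4, h5, ha⟩ := ((eventually_mul_le (28 * M) (one_half_pos (α := ℝ))).and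
    ((eventually_mul_le (28 * M * (κ + M)) (half_pos hκ)).and
    ((eventually_mul_le (4 * M) hr).and
    ((eventually_mul_le (32 * K * M ^ 2) (by positivity : 0 < κ / 16)).and
    ((eventually_mul_le (4 * M ^ 2) (by positivity : 0 < κ / 4)).and
    eventually_mem_nhdsWithin))))).exists
  rw [mem_Ioi] at ha
  set L := (100 * M * (C₀ + C) + 1) / (κ / 2) with hL
  obtain ⟨c, h6, h7, h8, h9, h10, hc⟩ := ((eventually_mul_le 1 one_pos).and
    ((eventually_mul_le L (one_half_pos (α := ℝ))).and
    ((eventually_mul_le (C₀ + 2) (by positivity : 0 < a * κ / 16)).and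
    ((eventually_mul_le (C₀ + 2) (by positivity : 0 < a * M)).and
    ((eventually_mul_le (C₀ + 2) hd).and eventually_mem_nhdsWithin))))).exists
  refine ⟨a, L, c, hc, h10.le, hM, hκ, ha, by linarith, by positivity, ?_, h7.le, by linarith,
    by linarith, by linarith, by linarith, by linarith, h8.le, h9.le⟩
  rw [hL, div_mul_cancel₀ _ (by positivity)]

theorem fracMeanCurv_pos {s T r K : ℝ} (hs : s ∈ Ioo (0 : ℝ) 1) (hr : 0 < r) (hK : 0 ≤ K)
    {E : ℝ → Set (Space n)} (hE : MovingFamily T E fun t x => -fracMeanCurv s (E t) x)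
    (hf : ∀ t ∈ Icc 0 T, UnifFlat r K (E t))
    (hcont : ∀ t ∈ Icc 0 T, ContinuousOn (fracMeanCurv s (E t)) (frontier (E t)))
    (hpos : ∀ x ∈ frontier (E 0), 0 < fracMeanCurv s (E 0) x) {t : ℝ} (ht : t ∈ Icc 0 T) :
    ∀ x ∈ frontier (E t), 0 < fracMeanCurv s (E t) x := by
  obtain ⟨C₀, hC₀, hbound⟩ := exists_abs_fracMeanCurv_le n hs hr hK
  obtain ⟨C, hC, hCP⟩ := exists_fracMeanCurv_le_of_perturbation n hs hr hK
  have hH : ∀ t ∈ Icc 0 T, ∀ x ∈ frontier (E t), |fracMeanCurv s (E t) x| ≤ C₀ := by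
    intro t ht x hx
    obtain ⟨ν, hν⟩ := hf t ht x hx
    exact hbound _ _ ν hν
      (nullMeasurableSet_of_volume_frontier (volume_frontier_eq_zero hr hK (hf t ht)))
  set q : ℝ := (1 / 8) ^ n / 32 with hq
  have hq0 : 0 < q := by positivity
  obtain ⟨ρ, h1, h2, hρ⟩ := ((eventually_mul_le 2 hr).and
    ((eventually_mul_le (8 * K) hq0).and eventually_mem_nhdsWithin)).exists
  rw [mem_Ioi] at hρ
  obtain ⟨M, hM, hMX⟩ := exists_outField_bounds n hρ
  set κ := ρ / 16 * volume.real (Metric.ball (0 : Space n) (ρ / 8)) with hκdef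
  have hκ : 0 < κ := mul_pos (by positivity)
    (ENNReal.toReal_pos (Metric.measure_ball_pos volume 0 (by positivity)).ne'
      measure_ball_lt_top.ne)
  obtain ⟨a, L, c, hc, hcd, hB⟩ := exists_barrierConsts (K := K) hr hC₀ hC hκ hM
    (show 0 < q * ρ / 2 by positivity)
  have hstep : ∀ t₀ τ, 0 ≤ t₀ → 0 < τ → τ ≤ c → t₀ + τ ≤ T →
      (∀ x ∈ frontier (E t₀), 0 < fracMeanCurv s (E t₀) x) →
      ∀ x ∈ frontier (E (t₀ + τ)), 0 < fracMeanCurv s (E (t₀ + τ)) x := by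
    intro t₀ τ ht₀ hτ hτc hτT hp x hx
    have hsub : ∀ t ∈ Icc 0 τ, t₀ + t ∈ Icc 0 T := fun t ht =>
      ⟨add_nonneg ht₀ ht.1, by linarith [ht.2]⟩
    have hF := hE.shift ht₀ hτT
    obtain ⟨hX1, hX2, hX3, hX4⟩ := hMX (interior (E (t₀ + τ))) isOpen_interior.measurableSet
    refine fracMeanCurv_pos_of_initial (F := fun t => E (t₀ + t))
      (X := outField ρ hρ (interior (E (t₀ + τ)))) hB hs hr hK hC₀ hC hCP hτ hτc hF
      (fun t ht => hf _ (hsub t ht)) (fun t ht => hH _ (hsub t ht)) ⟨hX1, hX2, hX3, hX4⟩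
      (fun t ht => hF.transversal_outField hr hK hC₀ (fun t ht => hf _ (hsub t ht))
        (fun t ht x hx => by rw [abs_neg]; exact hH _ (hsub t ht) x hx) hρ h1 ?_ ?_ ht) ?_ ?_ hx
    · nlinarith
    · exact (mul_le_mul_of_nonneg_left hτc (by linarith)).trans hcd
    · simp only [add_zero]
      exact hcont t₀ ⟨ht₀, by linarith⟩
    · simpa only [add_zero] using hp
  have hiter : ∀ k : ℕ, ∀ t ∈ Icc 0 T, t ≤ k * c →
      ∀ x ∈ frontier (E t), 0 < fracMeanCurv s (E t) x := by
    intro k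
    induction k with
    | zero =>
      intro t ht htk
      obtain rfl : t = 0 := le_antisymm (by simpa using htk) ht.1
      exact hpos
    | succ k ih =>
      intro t ht htk
      rcases ht.1.eq_or_lt with rfl | ht0
      · exact hpos
      push_cast at htk
      have hkc : 0 ≤ (k : ℝ) * c := by positivity
      have hm : max 0 (t - c) < t := max_lt ht0 (by linarith)
      have h3 := hstep (max 0 (t - c)) (t - max 0 (t - c)) (le_max_left _ _) (by linarith)
        (by linarith [le_max_right 0 (t - c)]) (by linarith [ht.2])
        (ih _ ⟨le_max_left _ _, by linarith [ht.2]⟩ (max_le hkc (by linarith)))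
      rwa [add_sub_cancel] at h3
  obtain ⟨k, hk⟩ := exists_nat_ge (t / c)
  exact hiter k t ht (by rwa [div_le_iff₀ hc] at hk)

theorem IsFracMeanCurvFlow.movingFamily {s T : ℝ} {E : ℝ → Set (Space n)}
    (h : IsFracMeanCurvFlow s T E) : MovingFamily T E fun t x => -fracMeanCurv s (E t) x :=
  ⟨h.isC1Family, h.motion⟩

end FracFlow

end

theorem mainTheorem9 (n : ℕ) (s T : ℝ) (hs : s ∈ Set.Ioo (0 : ℝ) 1) (hT : 0 < T)
    (E : ℝ → Set (FracFlow.Space n))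
    (hflow : FracFlow.IsFracMeanCurvFlow s T E)
    (hdiff : DifferentiableOn ℝ
      (fun p : FracFlow.Space n × ℝ => FracFlow.fracMeanCurv s (E p.2) p.1)
      (FracFlow.boundaryTrack T E))
    (hC2 : FracFlow.UniformlyC2 T E)
    (hpos : FracFlow.StrictlyPositiveCurv s (E 0)) :
    ∀ t ∈ Set.Icc (0 : ℝ) T, FracFlow.StrictlyPositiveCurv s (E t) := by
  obtain ⟨r, C, hr, hC2⟩ := hC2
  have hf : ∀ t ∈ Icc 0 T, FracFlow.UnifFlat r |C| (E t) := fun t ht x hx =>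
    (hC2 t ht x hx).imp fun ν hν => hν.flatAt
  have hcont : ∀ t ∈ Icc 0 T,
      ContinuousOn (FracFlow.fracMeanCurv s (E t)) (frontier (E t)) := fun t ht =>
    hdiff.continuousOn.comp (f := fun x : FracFlow.Space n => (x, t)) (by fun_prop)
      fun x hx => ⟨ht, hx⟩
  have hmain := fun t ht => FracFlow.fracMeanCurv_pos hs hr (abs_nonneg C) hflow.movingFamily hf
    hcont (fun x hx => by
      obtain ⟨h, h0, h1⟩ := hpos x hx
      rwa [FracFlow.fracMeanCurv, h1.limUnder_eq]) (t := t) ht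
  intro t ht x hx
  obtain ⟨ν, hν⟩ := hf t ht x hx
  have hA := FracFlow.nullMeasurableSet_of_volume_frontier
    (FracFlow.volume_frontier_eq_zero hr (abs_nonneg C) (hf t ht))
  have h1 := FracFlow.hasFracMeanCurv_symCurv hs hr (abs_nonneg C) hν hA
  rw [← FracFlow.fracMeanCurv_eq hs hr (abs_nonneg C) hν hA] at h1
  exact ⟨_, hmain t ht x hx, h1⟩
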